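/- Fix a clipping level $B>0$. There is a constant $C=C_B>0$, depending only on $B$, such that the following holds for every dimension $d\ge 1$, every probability distribution $p_{\mathrm{data}}$ on $\mathbb R^d$ with finite second moment $M_2^2=\mathbb E_{X\sim p_{\mathrm{data}}}\|X\|^2<\infty$, and every $\delta\in(0,\tfrac12]$. Setting. A variance-preserving schedule of length $T\ge 1$ with early-stopping noise level $\sigma_\ast\in(0,1)$ is a sequence $\sigma_1=\sigma_\ast,\sigma_2,\dots,\sigma_T\in(0,1)$; put $\bar\alpha_t=\sqrt{1-\sigma_t^2}$ for $1\le t\le T$, with $\bar\alpha_0=1$ and noise level $0$ at time $0$, and $\alpha_t=\bar\alpha_{t+1}/\bar\alpha_t$, $\eta_t=\sigma_{t+1}^2/\alpha_t^2-\sigma_t^2$ (the term $\sigma_t^2$ being $0$ for $t=0$), all $\eta_t$ being required to be positive. The forward process is $X_0\sim p_{\mathrm{data}}$, $X_{t+1}\mid X_t\sim N(\alpha_tX_t,\alpha_t^2\eta_tI)$, and $p_t$ is the law of $X_t$. Given measurable score estimates $s_t:\mathbb R^d\to\mathbb R^d$, let $\varepsilon_{\mathrm{score},t}^2=\mathbb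 E_{X\sim p_t}\|s_t(X)-\nabla\log p_t(X)\|^2\in[0,\infty]$. The sampler draws $\hat X_T\sim\hat p_T=N(0,\sigma_T^2I)$ and, for $t=T-1,\dots,1$, with $\bar x_t=\alpha_t^{-1}\hat X_{t+1}$, repeats independent rounds until one accepts: draw $x\sim N(\bar x_t,\eta_tI)$, $J\sim\mathrm{Poisson}(2B)$ and i.i.d. $r_1,\dots,r_J\sim\mathrm{Unif}[0,1]$, put $W_j=\max\{-B,\min\{B,\langle x-\bar x_t,\ s_t(r_jx+(1-r_j)\bar x_t)\rangle\}\}$, and accept $\hat X_t=x$ with probability $\prod_{j=1}^J\frac{B+W_j}{2B}$. Let $\hat p_1$ be the law of $\hat X_1$ and $N$ the total number of score queries (one per $W_j$, rejected rounds included). (i) For every $\sigma_0\in(0,1)$, with $\kappa=(d+M_2^2)/\sigma_0^2$, there is a variance-preserving schedule with $\sigma_1=\sigma_0$ and $$T\le C\,(d+\log(1/\delta))\,\log^2(\kappa/\delta)$$ such that for all measurable score estimates $(s_t)$ $$\mathrm{KL}(p_1\,\|\,\hat p_1)\le C\Big(\delta^2+\sum_{t=1}^{T-1}\eta_t\,\varepsilon_{\mathrm{score},t}^2\Big),$$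 and $N=O(T)$ with high probability: $\Pr(N\le CT)\ge1-\delta$, and $\Pr\big(N\le C(T+\log(1/\varepsilon))\big)\ge1-\varepsilon$ for every $\varepsilon\in(0,1)$. (ii) There is a variance-preserving schedule with $\sigma_1=\delta/\sqrt{d+M_2^2}$ and $$T\le C\max\{d,\log(1/\delta)\}\,\log^2\Big(\frac{d+M_2^2}{\delta^2}\Big)$$ such that for all measurable score estimates $(s_t)$ $$D_{\mathrm{BL}}(p_{\mathrm{data}},\hat p_1)^2\le C\Big(\delta^2+\sum_{t=1}^{T-1}\eta_t\,\varepsilon_{\mathrm{score},t}^2\Big),$$ with the same two bounds on $N$; here $D_{\mathrm{BL}}(\mu,\nu)=\sup\{\mathbb E_\mu f-\mathbb E_\nu f:\ |f|\le1,\ \|f\|_{\mathrm{Lip}}\le1\}$. -/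

import Mathlib

open MeasureTheory ProbabilityTheory InformationTheory
open scoped ENNReal NNReal

noncomputable section

/-- The space `ℝ^d` with its Euclidean norm. -/
abbrev Euc (d : ℕ) : Type := EuclideanSpace ℝ (Fin d)

/-! ### Densities, scores, the bounded Lipschitz metric -/

open Classical in
/-- The continuous probability density function of `μ` with respect to Lebesgue measure (it is
unique if it exists); the zero function if `μ` has no continuous density. -/
def contDensity {d : ℕ} (μ : Measure (Euc d)) : Euc d → ℝ :=
  if h : ∃ ρ : Euc d → ℝ, Continuous ρ ∧ (∀ x, 0 ≤ ρ x) ∧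
      μ = volume.withDensity (fun x => ENNReal.ofReal (ρ x))
  then h.choose else 0

/-- The score `∇ log p` of the law `μ` with continuous density `p`. -/
def score {d : ℕ} (μ : Measure (Euc d)) (x : Euc d) : Euc d :=
  gradient (fun y => Real.log (contDensity μ y)) x

/-- The squared score error `E_{X ∼ μ} ‖s(X) - ∇ log p(X)‖²` of the estimate `s`. -/
def scoreErrorSq {d : ℕ} (μ : Measure (Euc d)) (s : Euc d → Euc d) : ℝ≥0∞ :=
  ∫⁻ x, ‖s x - score μ x‖ₑ ^ 2 ∂μ

/-- The bounded Lipschitz metric: the supremum of `E_μ f - E_ν f` over all `f` with `|f| ≤ 1` and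
Lipschitz constant at most `1`. -/
def blDist {d : ℕ} (μ ν : Measure (Euc d)) : ℝ≥0∞ :=
  ⨆ f ∈ {f : Euc d → ℝ | (∀ x, |f x| ≤ 1) ∧ LipschitzWith 1 f},
    ENNReal.ofReal (∫ x, f x ∂μ - ∫ x, f x ∂ν)

/-- The second moment `E_{X ∼ μ} ‖X‖²`. -/
def secondMoment {d : ℕ} (μ : Measure (Euc d)) : ℝ := ∫ x, ‖x‖ ^ 2 ∂μ

/-- The isotropic Gaussian `N(m, v I)`. -/
def isoGaussian {d : ℕ} (m : Euc d) (v : ℝ) : Measure (Euc d) :=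
  (stdGaussian (Euc d)).map (fun g => m + √v • g)

/-! ### The forward process in the variance-preserving setting -/

/-- `ᾱ_t = √(1 - σ_t²)`, that is, `ᾱ_t² + σ_t² = 1`. -/
def vpAlphaBar (σ : ℕ → ℝ) (t : ℕ) : ℝ := √(1 - σ t ^ 2)

/-- `α_t = ᾱ_{t+1} / ᾱ_t`. -/
def vpAlpha (σ : ℕ → ℝ) (t : ℕ) : ℝ := vpAlphaBar σ (t + 1) / vpAlphaBar σ t

/-- `η_t = σ_{t+1}² / α_t² - σ_t²`. -/
def vpEta (σ : ℕ → ℝ) (t : ℕ) : ℝ := σ (t + 1) ^ 2 / vpAlpha σ t ^ 2 - σ t ^ 2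

/-- `σ_1, …, σ_T` is a variance-preserving noise schedule with first (early stopping) noise level
`σ₁`. The value `σ 0 = 0` (so `ᾱ_0 = 1`) encodes that the forward process starts from the data. -/
structure IsVPSchedule (T : ℕ) (σ : ℕ → ℝ) (σ₁ : ℝ) : Prop where
  one_le : 1 ≤ T
  zero : σ 0 = 0
  one : σ 1 = σ₁
  pos : ∀ t, 1 ≤ t → t ≤ T → 0 < σ t
  lt_one : ∀ t, 1 ≤ t → t ≤ T → σ t < 1
  eta_pos : ∀ t, t < T → 0 < vpEta σ t

/-- The law `p_t` of `X_t`, where `X_0 ∼ p_data` and, given `X_t`,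
`X_{t+1} ∼ N(α_t X_t, α_t² η_t I)`. -/
def forwardLaw {d : ℕ} (pdata : Measure (Euc d)) (σ : ℕ → ℝ) : ℕ → Measure (Euc d)
  | 0 => pdata
  | t + 1 => ((forwardLaw pdata σ t).prod (stdGaussian (Euc d))).map
      (fun z => vpAlpha σ t • z.1 + (vpAlpha σ t * √(vpEta σ t)) • z.2)

/-! ### First-order rejection sampling -/

/-- `clip_B(x) = max(-B, min(B, x))`. -/
def clip (B x : ℝ) : ℝ := max (-B) (min B x)

/-- The random inputs of one round of the rejection loop: a seed for the proposal, the number `J`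
of estimator draws, seeds for the estimator draws, a seed for the acceptance coin. -/
abbrev RoundNoise (d : ℕ) : Type := Euc d × ℕ × (ℕ → unitInterval) × unitInterval

/-- The law of the random inputs of one round: they are independent, the proposal seed is standard
Gaussian, `J ∼ Poisson(2B)`, and the other seeds are uniform on `[0,1]`. -/
def roundNoise (d : ℕ) (B : ℝ) : Measure (RoundNoise d) :=
  (stdGaussian (Euc d)).prod ((poissonMeasure (2 * B).toNNReal).prod
    ((Measure.infinitePi (fun _ : ℕ => (volume : Measure unitInterval))).prod (volume : Measure unitInterval)))

/-- The law of the random inputs of the rejection loop: independent rounds `0, 1, 2, …`. -/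
def forsNoise (d : ℕ) (B : ℝ) : Measure (ℕ → RoundNoise d) :=
  Measure.infinitePi (fun _ : ℕ => roundNoise d B)

/-- The round with inputs `ω = (g, J, r, u)` accepts its proposal `x = propose g` if
`u ≤ ∏_{j < J} (B + W_j) / (2B)` with `W_j = est x (r j)`: it does so with this product as
probability, given `x`, `J` and the `W_j`. -/
def roundAccepts {d : ℕ} (B : ℝ) (propose : Euc d → Euc d) (est : Euc d → unitInterval → ℝ)
    (ω : RoundNoise d) : Prop :=
  (ω.2.2.2 : ℝ) ≤ ∏ j ∈ Finset.range ω.2.1, (B + est (propose ω.1) (ω.2.2.1 j)) / (2 * B)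

/-- The index of the first accepting round (there is one almost surely). -/
def forsStop {d : ℕ} (B : ℝ) (propose : Euc d → Euc d) (est : Euc d → unitInterval → ℝ)
    (ω : ℕ → RoundNoise d) : ℕ :=
  sInf {i | roundAccepts B propose est (ω i)}

/-- The output of first-order rejection sampling: the first accepted proposal. -/
def forsOutput {d : ℕ} (B : ℝ) (propose : Euc d → Euc d) (est : Euc d → unitInterval → ℝ)
    (ω : ℕ → RoundNoise d) : Euc d :=
  propose (ω (forsStop B propose est ω)).1

/-- The total number of estimator draws `W_j` made up to and including the accepting round. -/
def forsCount {d : ℕ} (B : ℝ) (propose : Euc d → Euc d) (est : Euc d → unitInterval → ℝ)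
    (ω : ℕ → RoundNoise d) : ℕ :=
  ∑ i ∈ Finset.range (forsStop B propose est ω + 1), (ω i).2.1

/-! ### Backward diffusion sampling -/

/-- The proposal `N(x̄, η I)` as a function of a standard Gaussian seed. -/
def stepPropose {d : ℕ} (η : ℝ) (xbar : Euc d) (g : Euc d) : Euc d := xbar + √η • g

/-- The estimator `clip_B ⟨x - x̄, s(r x + (1 - r) x̄)⟩` with seed `r`; each draw makes exactly one
query to the score estimate `s`. -/
def stepEst {d : ℕ} (B : ℝ) (s : Euc d → Euc d) (xbar : Euc d) (x : Euc d) (r : unitInterval) : ℝ :=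
  clip B (inner ℝ (x - xbar) (s ((r : ℝ) • x + (1 - (r : ℝ)) • xbar)))

/-- One step of backward diffusion sampling at time `t`: from `X_{t+1}` and the number of queries
made so far to `X_t` and the updated number of queries. -/
def backwardStep {d : ℕ} (B : ℝ) (s : ℕ → Euc d → Euc d) (σ : ℕ → ℝ) (t : ℕ)
    (z : Euc d × ℕ) (ω : ℕ → RoundNoise d) : Euc d × ℕ :=
  let xbar := (vpAlpha σ t)⁻¹ • z.1
  (forsOutput B (stepPropose (vpEta σ t) xbar) (stepEst B (s t) xbar) ω,
    z.2 + forsCount B (stepPropose (vpEta σ t) xbar) (stepEst B (s t) xbar) ω)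

/-- The joint law of the state `X_{T-k}` and the number of score queries made so far, after the `k`
steps at times `T-1, …, T-k`, each with fresh random inputs, from `X_T ∼ init`. -/
def backwardLaw {d : ℕ} (B : ℝ) (s : ℕ → Euc d → Euc d) (σ : ℕ → ℝ) (T : ℕ)
    (init : Measure (Euc d)) : ℕ → Measure (Euc d × ℕ)
  | 0 => init.map (fun x => (x, 0))
  | k + 1 => ((backwardLaw B s σ T init k).prod (forsNoise d B)).map
      (fun z => backwardStep B s σ (T - (k + 1)) z.1 z.2)

/-- The joint law of the output `X_1` and the total number of score queries of backward diffusion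
sampling with `X_T ∼ N(0, σ_T² I)`. -/
def samplerLaw {d : ℕ} (B : ℝ) (s : ℕ → Euc d → Euc d) (σ : ℕ → ℝ) (T : ℕ) :
    Measure (Euc d × ℕ) :=
  backwardLaw B s σ T (isoGaussian 0 (σ T ^ 2)) (T - 1)

/-- The law `p̂_1` of the output. -/
def outputLaw {d : ℕ} (B : ℝ) (s : ℕ → Euc d → Euc d) (σ : ℕ → ℝ) (T : ℕ) : Measure (Euc d) :=
  (samplerLaw B s σ T).map Prod.fst

/-- The law of the total number of score queries. -/
def queryLaw {d : ℕ} (B : ℝ) (s : ℕ → Euc d → Euc d) (σ : ℕ → ℝ) (T : ℕ) : Measure ℕ :=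
  (samplerLaw B s σ T).map Prod.snd

/-- The weighted score error `∑_{t=1}^{T-1} η_t ε_{score,t}²`. -/
def totalScoreError {d : ℕ} (pdata : Measure (Euc d)) (s : ℕ → Euc d → Euc d) (σ : ℕ → ℝ)
    (T : ℕ) : ℝ≥0∞ :=
  ∑ t ∈ Finset.Ico 1 T, ENNReal.ofReal (vpEta σ t) * scoreErrorSq (forwardLaw pdata σ t) (s t)

end

/-! By the chain rule for the Kullback-Leibler divergence, the divergence of the exact time reversal
from the sampler is at most that of the two initial laws plus, for each backward step, the expected
divergence of the two transition kernels. The former is at most `ᾱ_T² M₂² / (2 σ_T²)` since the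
divergence is convex and the forward law is a mixture of translated Gaussians.

For the latter, both kernels tilt the same Gaussian proposal. A Poisson number of coins with success
probabilities `(B + W_j) / (2B)` all succeed with probability `exp (E W - B)`, so rejection sampling
tilts it by the exponential of the mean of the clipped estimates, while the exact reversal tilts it
by `p_t`, and the log-ratio of `p_t` along the step is the integral of the score. The divergence is
quadratic in the difference of the logarithmic weights as long as that difference is bounded, and
this gives the score error term. It remains to see that the true score is rarely clipped. As `p_t`
is a smoothing at scale `σ_t`, `log p_t + ‖x‖² / (2 σ_t²)` is convex; hence exponential moments of
the score in a Gaussian direction are bounded by Gaussian ones, and for `η_t = h σ_t²` with `1 / h`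
of order `(d + log (1 / δ)) log (κ / δ)` clipping is as rare as the bound requires. Along this
schedule the noise-to-signal ratio grows by the factor `1 + h` in each step, so `log (κ / δ) / h`
steps, up to a constant, suffice.

A round accepts with probability at least `exp (-2B)` and makes a Poisson number of queries, so the
number of queries of a step has an exponential moment and Chernoff's bound applies to their sum.
Finally, `D_BL` is compared with the divergence through the variational formula of Donsker and
Varadhan. -/

noncomputable section

section FirstHit

variable {Ω : Type*}

/-- The first index at which the sequence `ω` hits the set `A`: the index of the accepting round of
a rejection loop. It is `0` if `ω` never hits `A`. -/
def firstHit (A : Set Ω) (ω : ℕ → Ω) : ℕ := sInf {i | ω i ∈ A}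

lemma apply_firstHit_mem {A : Set Ω} {ω : ℕ → Ω} (h : ∃ i, ω i ∈ A) : ω (firstHit A ω) ∈ A :=
  Nat.sInf_mem h

lemma notMem_of_lt_firstHit {A : Set Ω} {ω : ℕ → Ω} {i : ℕ} (h : i < firstHit A ω) : ω i ∉ A :=
  Nat.notMem_of_lt_sInf h

lemma tsum_prod_indicator_mul_indicator {A : Set Ω} {ω : ℕ → Ω} (h : ∃ i, ω i ∈ A)
    (c f : Ω → ℝ≥0∞) :
    ∑' k, (∏ i ∈ Finset.range k, Aᶜ.indicator c (ω i)) * A.indicator f (ω k) =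
      (∏ i ∈ Finset.range (firstHit A ω), c (ω i)) * f (ω (firstHit A ω)) := by
  have hmem := apply_firstHit_mem h
  rw [tsum_eq_single (firstHit A ω), Set.indicator_of_mem hmem]
  · congr 1
    exact Finset.prod_congr rfl fun i hi =>
      Set.indicator_of_mem (s := Aᶜ) (notMem_of_lt_firstHit (Finset.mem_range.1 hi)) c
  · intro k hk
    rcases lt_or_gt_of_ne hk with hlt | hgt
    · rw [Set.indicator_of_notMem (notMem_of_lt_firstHit hlt), mul_zero]
    · rw [Finset.prod_eq_zero (Finset.mem_range.2 hgt)
        (Set.indicator_of_notMem (not_not_intro hmem) c), zero_mul]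

lemma measurable_firstHit {α : Type*} [MeasurableSpace α] {A : Set Ω} {φ : α → ℕ → Ω}
    (hφ : ∀ i, MeasurableSet {a | φ a i ∈ A}) : Measurable fun a => firstHit A (φ a) := by
  classical
  have hex : MeasurableSet {a | ∃ i, φ a i ∈ A} := by
    simpa only [Set.ofPred_exists] using MeasurableSet.iUnion hφ
  have hfind : Measurable fun a => if h : ∃ i, φ a i ∈ A then Nat.find h else 0 :=
    Measurable.dite (s := {a | ∃ i, φ a i ∈ A})
      (measurable_find (p := fun (a : {a | ∃ i, φ a i ∈ A}) i => φ a i ∈ A) (fun a => a.2)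
        fun i => measurable_subtype_coe (hφ i)) measurable_const hex
  convert! hfind using 2

end FirstHit

section IIDSequence

lemma lintegral_infinitePi_prod {ι : Type*} {X : ι → Type*} [∀ i, MeasurableSpace (X i)]
    (μ : ∀ i, Measure (X i)) [∀ i, IsProbabilityMeasure (μ i)] (s : Finset ι)
    {f : ∀ i, X i → ℝ≥0∞} (hf : ∀ i, Measurable (f i)) :
    ∫⁻ ω, ∏ i ∈ s, f i (ω i) ∂(Measure.infinitePi μ) = ∏ i ∈ s, ∫⁻ x, f i x ∂μ i := by
  refine (lintegral_prod_eq_prod_lintegral_of_indepFun s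
    (fun i (ω : ∀ i, X i) => f i (ω i)) (iIndepFun_infinitePi hf)
    fun i => (hf i).comp (measurable_pi_apply i)).trans ?_
  exact Finset.prod_congr rfl fun i _ =>
    (measurePreserving_eval_infinitePi μ i).lintegral_comp (hf i)

variable {Ω : Type*} [MeasurableSpace Ω] (ν : Measure Ω) [IsProbabilityMeasure ν]

lemma lintegral_infinitePi_prod_range_mul {u v : Ω → ℝ≥0∞} (hu : Measurable u) (hv : Measurable v)
    (k : ℕ) :
    ∫⁻ ω, (∏ i ∈ Finset.range k, u (ω i)) * v (ω k) ∂(Measure.infinitePi fun _ : ℕ => ν) =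
      (∫⁻ x, u x ∂ν) ^ k * ∫⁻ x, v x ∂ν := by
  have hw (i : ℕ) (hi : i ∈ Finset.range k) : (if i < k then u else v) = u :=
    if_pos (Finset.mem_range.1 hi)
  have h := lintegral_infinitePi_prod (fun _ : ℕ => ν) (Finset.range (k + 1))
    (f := fun i => if i < k then u else v) fun i => by split_ifs <;> assumption
  simp only [Finset.prod_range_succ, lt_irrefl, if_false] at h
  rw [Finset.prod_congr rfl fun i hi => by rw [hw i hi], Finset.prod_const,
    Finset.card_range] at h
  rw [← h]
  exact lintegral_congr fun ω =>
    congrArg (· * v (ω k)) (Finset.prod_congr rfl fun i hi => by rw [hw i hi])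

lemma ae_exists_mem_infinitePi {A : Set Ω} (hA : MeasurableSet A) (h0 : ν A ≠ 0) :
    ∀ᵐ ω ∂(Measure.infinitePi fun _ : ℕ => ν), ∃ i, ω i ∈ A := by
  have hlt : ν Aᶜ < 1 := by
    rw [prob_compl_eq_one_sub hA]
    exact ENNReal.sub_lt_self ENNReal.one_ne_top one_ne_zero h0
  refine le_antisymm (ge_of_tendsto' (ENNReal.tendsto_pow_atTop_nhds_zero_of_lt_one hlt)
    fun n => ?_) zero_le
  have hbox : Measure.infinitePi (fun _ : ℕ => ν) (Set.pi (Finset.range n) fun _ => Aᶜ) =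
      ν Aᶜ ^ n := by
    rw [Measure.infinitePi_pi _ fun _ _ => hA.compl, Finset.prod_const, Finset.card_range]
  rw [← hbox]
  exact measure_mono fun ω hω i _ hi => hω ⟨i, hi⟩

lemma lintegral_firstHit {A : Set Ω} (hA : MeasurableSet A) (h0 : ν A ≠ 0) {c f : Ω → ℝ≥0∞}
    (hc : Measurable c) (hf : Measurable f) :
    ∫⁻ ω, (∏ i ∈ Finset.range (firstHit A ω), c (ω i)) * f (ω (firstHit A ω))
        ∂(Measure.infinitePi fun _ : ℕ => ν) =
      (1 - ∫⁻ x in Aᶜ, c x ∂ν)⁻¹ * ∫⁻ x in A, f x ∂ν := by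
  have hcm := hc.indicator hA.compl
  have hfm := hf.indicator hA
  have hterm (k : ℕ) :
      ∫⁻ ω, (∏ i ∈ Finset.range k, Aᶜ.indicator c (ω i)) * A.indicator f (ω k)
        ∂(Measure.infinitePi fun _ : ℕ => ν) =
      (∫⁻ x in Aᶜ, c x ∂ν) ^ k * ∫⁻ x in A, f x ∂ν := by
    rw [lintegral_infinitePi_prod_range_mul ν hcm hfm, lintegral_indicator hA.compl,
      lintegral_indicator hA]
  calc _ = ∫⁻ ω, ∑' k, (∏ i ∈ Finset.range k, Aᶜ.indicator c (ω i)) * A.indicator f (ω k)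
        ∂(Measure.infinitePi fun _ : ℕ => ν) := by
        refine lintegral_congr_ae ?_
        filter_upwards [ae_exists_mem_infinitePi ν hA h0] with ω hω
        exact (tsum_prod_indicator_mul_indicator hω c f).symm
    _ = ∑' k : ℕ, (∫⁻ x in Aᶜ, c x ∂ν) ^ k * ∫⁻ x in A, f x ∂ν := by
        rw [lintegral_tsum fun k => by fun_prop]
        exact tsum_congr hterm
    _ = _ := by rw [ENNReal.tsum_mul_right, ENNReal.tsum_geometric]

-- A round is rejected with weight at most `1 + p / 2 - p`, so the geometric series sums to `2 / p`.
lemma lintegral_prod_range_firstHit_le {A : Set Ω} (hA : MeasurableSet A) {p : ℝ} (hp : 0 < p)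
    (hpA : ENNReal.ofReal p ≤ ν A) {c : Ω → ℝ≥0∞} (hc : Measurable c) (hc1 : ∀ x, 1 ≤ c x)
    (hcν : ∫⁻ x, c x ∂ν ≤ ENNReal.ofReal (1 + p / 2)) :
    ∫⁻ ω, ∏ i ∈ Finset.range (firstHit A ω + 1), c (ω i) ∂(Measure.infinitePi fun _ : ℕ => ν) ≤
      ENNReal.ofReal (4 / p) := by
  have hp1 : p ≤ 1 := ENNReal.ofReal_le_one.1 (hpA.trans prob_le_one)
  have hA0 : ν A ≠ 0 := ((ENNReal.ofReal_pos.2 hp).trans_le hpA).ne'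
  have hacc : ∫⁻ x in A, c x ∂ν ≤ ENNReal.ofReal 2 :=
    (setLIntegral_le_lintegral _ _).trans
      (hcν.trans (ENNReal.ofReal_le_ofReal (by linarith)))
  have hpacc : ENNReal.ofReal p ≤ ∫⁻ x in A, c x ∂ν :=
    calc ENNReal.ofReal p ≤ ∫⁻ _ in A, 1 ∂ν := by simpa using hpA
      _ ≤ ∫⁻ x in A, c x ∂ν := lintegral_mono hc1
  have hrej : ∫⁻ x in Aᶜ, c x ∂ν ≤ ENNReal.ofReal (1 - p / 2) := by
    refine (ENNReal.add_le_add_iff_left (a := ENNReal.ofReal p) ENNReal.ofReal_ne_top).1 ?_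
    calc ENNReal.ofReal p + ∫⁻ x in Aᶜ, c x ∂ν
        ≤ ∫⁻ x in A, c x ∂ν + ∫⁻ x in Aᶜ, c x ∂ν := by gcongr
      _ = ∫⁻ x, c x ∂ν := lintegral_add_compl c hA
      _ ≤ ENNReal.ofReal (1 + p / 2) := hcν
      _ = ENNReal.ofReal p + ENNReal.ofReal (1 - p / 2) := by
        rw [← ENNReal.ofReal_add hp.le (by linarith)]
        congr 1
        ring
  have hgap : ENNReal.ofReal (p / 2) ≤ 1 - ∫⁻ x in Aᶜ, c x ∂ν :=
    calc ENNReal.ofReal (p / 2) = 1 - ENNReal.ofReal (1 - p / 2) := by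
          rw [← ENNReal.ofReal_one, ← ENNReal.ofReal_sub _ (by linarith), sub_sub_cancel]
      _ ≤ _ := tsub_le_tsub_left hrej 1
  simp only [Finset.prod_range_succ]
  calc _ = (1 - ∫⁻ x in Aᶜ, c x ∂ν)⁻¹ * ∫⁻ x in A, c x ∂ν := lintegral_firstHit ν hA hA0 hc hc
    _ ≤ (ENNReal.ofReal (p / 2))⁻¹ * ENNReal.ofReal 2 := by gcongr
    _ = ENNReal.ofReal (4 / p) := by
        rw [← ENNReal.ofReal_inv_of_pos (by positivity), ← ENNReal.ofReal_mul (by positivity)]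
        congr 1
        field_simp
        norm_num

end IIDSequence

section PoissonCoin

lemma volume_setOf_coe_le {q : ℝ} (h0 : 0 ≤ q) (h1 : q ≤ 1) :
    (volume : Measure unitInterval) {u | (u : ℝ) ≤ q} = ENNReal.ofReal q :=
  unitInterval.volume_Iic ⟨q, h0, h1⟩

lemma lintegral_poissonMeasure_pow (r : ℝ≥0) {q : ℝ} (hq : 0 ≤ q) :
    ∫⁻ n, ENNReal.ofReal (q ^ n) ∂(poissonMeasure r) = ENNReal.ofReal (Real.exp (r * (q - 1))) := by
  have hs : HasSum (fun n : ℕ => q ^ n * (Real.exp (-r) * r ^ n / n.factorial))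
      (Real.exp (r * (q - 1))) := by
    have h := (NormedSpace.expSeries_div_hasSum_exp (q * (r : ℝ))).mul_left (Real.exp (-r))
    rw [← Real.exp_eq_exp_ℝ, ← Real.exp_add, show -(r : ℝ) + q * r = r * (q - 1) by ring] at h
    refine h.congr_fun fun n => ?_
    rw [mul_pow]
    ring
  rw [lintegral_countable', ← hs.tsum_eq,
    ENNReal.ofReal_tsum_of_nonneg (fun n => by positivity) hs.summable]
  refine tsum_congr fun n => ?_
  rw [poissonMeasure_singleton, ← ENNReal.ofReal_mul (by positivity)]

variable {S : Type*} [MeasurableSpace S] (ν : Measure S) [IsProbabilityMeasure ν] {q : S → ℝ}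

lemma measure_coin_le_prod (hq : Measurable q) (h0 : ∀ r, 0 ≤ q r) (h1 : ∀ r, q r ≤ 1) (n : ℕ) :
    ((Measure.infinitePi fun _ : ℕ => ν).prod (volume : Measure unitInterval))
      {z | (z.2 : ℝ) ≤ ∏ j ∈ Finset.range n, q (z.1 j)} = ENNReal.ofReal ((∫ r, q r ∂ν) ^ n) := by
  have hqint : Integrable q ν := Integrable.of_bound hq.aestronglyMeasurable 1
    (ae_of_all _ fun r => by rw [Real.norm_of_nonneg (h0 r)]; exact h1 r)
  rw [Measure.prod_apply (measurableSet_le (by fun_prop) (by fun_prop))]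
  calc _ = ∫⁻ r : ℕ → S, ∏ j ∈ Finset.range n, ENNReal.ofReal (q (r j))
        ∂(Measure.infinitePi fun _ : ℕ => ν) := by
        refine lintegral_congr fun r => ?_
        rw [← ENNReal.ofReal_prod_of_nonneg fun j _ => h0 _]
        exact volume_setOf_coe_le (Finset.prod_nonneg fun j _ => h0 _)
          (Finset.prod_le_one (fun j _ => h0 _) fun j _ => h1 _)
    _ = _ := by
        rw [lintegral_infinitePi_prod _ _ (f := fun _ r => ENNReal.ofReal (q r))
            fun _ => by fun_prop, Finset.prod_const, Finset.card_range,
          ENNReal.ofReal_pow (integral_nonneg h0),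
          ofReal_integral_eq_lintegral_ofReal hqint (ae_of_all _ h0)]

lemma measurable_prod_range_apply {α : Type*} [MeasurableSpace α] {w : α → S → ℝ}
    (hw : Measurable fun z : α × S => w z.1 z.2) {N : α → ℕ} (hN : Measurable N)
    {r : α → ℕ → S} (hr : Measurable r) :
    Measurable fun a => ∏ j ∈ Finset.range (N a), w a (r a j) := by
  have h : Measurable fun z : α × ℕ => ∏ j ∈ Finset.range z.2, w z.1 (r z.1 j) :=
    measurable_from_prod_countable_left fun n =>
      Finset.measurable_fun_prod (f := fun j a => w a (r a j)) (Finset.range n) fun j _ =>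
        hw.comp (measurable_id.prodMk ((measurable_pi_apply j).comp hr))
  exact h.comp (measurable_id.prodMk hN)

-- The Bernoulli factory behind the sampler: a Poisson number of coins with mean `m` all come up
-- heads with probability `E m ^ J = exp (ℓ (m - 1))`, so no exponential has to be evaluated.
lemma measure_poissonCoin (ℓ : ℝ≥0) (hq : Measurable q) (h0 : ∀ r, 0 ≤ q r) (h1 : ∀ r, q r ≤ 1) :
    ((poissonMeasure ℓ).prod
        ((Measure.infinitePi fun _ : ℕ => ν).prod (volume : Measure unitInterval)))
      {z | (z.2.2 : ℝ) ≤ ∏ j ∈ Finset.range z.1, q (z.2.1 j)} =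
      ENNReal.ofReal (Real.exp (ℓ * (∫ r, q r ∂ν - 1))) := by
  have hmeas : Measurable fun z : ℕ × (ℕ → S) × unitInterval =>
      ∏ j ∈ Finset.range z.1, q (z.2.1 j) :=
    measurable_prod_range_apply (hq.comp measurable_snd) (by fun_prop) (by fun_prop)
  rw [Measure.prod_apply (measurableSet_le (by fun_prop) hmeas),
    ← lintegral_poissonMeasure_pow ℓ (integral_nonneg h0)]
  exact lintegral_congr fun n => measure_coin_le_prod ν hq h0 h1 n

end PoissonCoin

section RejectionSampling

lemma setLIntegral_prod_fst {α β : Type*} [MeasurableSpace α] [MeasurableSpace β] (μ : Measure α)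
    (ν : Measure β) [SFinite ν] {A : Set (α × β)} (hA : MeasurableSet A) {f : α → ℝ≥0∞}
    (hf : Measurable f) :
    ∫⁻ z in A, f z.1 ∂(μ.prod ν) = ∫⁻ x, f x * ν (Prod.mk x ⁻¹' A) ∂μ := by
  have hind : Measurable (A.indicator fun z => f z.1) := (hf.comp measurable_fst).indicator hA
  rw [← lintegral_indicator hA, lintegral_prod _ hind.aemeasurable]
  refine lintegral_congr fun x => ?_
  rw [← setLIntegral_const, ← lintegral_indicator (measurable_prodMk_left hA)]
  rfl

variable {d : ℕ} {B : ℝ} {propose : Euc d → Euc d} {est : Euc d → unitInterval → ℝ}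

/-- The inputs of a round for which the proposal is accepted, so that `forsStop` is the `firstHit`
of this set. -/
def acceptSet {d : ℕ} (B : ℝ) (propose : Euc d → Euc d) (est : Euc d → unitInterval → ℝ) :
    Set (RoundNoise d) := {ω | roundAccepts B propose est ω}

/-- The mean of the estimator draws given the seed `g` of the proposal: the logarithm, up to a
constant, of the density of the output with respect to the proposal. -/
def meanEst {d : ℕ} (propose : Euc d → Euc d) (est : Euc d → unitInterval → ℝ) (g : Euc d) : ℝ :=
  ∫ r, est (propose g) r

instance (d : ℕ) (B : ℝ) : IsProbabilityMeasure (roundNoise d B) := by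
  unfold roundNoise; infer_instance

instance (d : ℕ) (B : ℝ) : IsProbabilityMeasure (forsNoise d B) := by
  unfold forsNoise; infer_instance

lemma measurableSet_roundAccepts {α : Type*} [MeasurableSpace α] {φ : α → RoundNoise d}
    (hφ : Measurable φ) {w : α → unitInterval → ℝ}
    (hw : Measurable fun z : α × unitInterval => w z.1 z.2) :
    MeasurableSet {a | ((φ a).2.2.2 : ℝ) ≤
      ∏ j ∈ Finset.range (φ a).2.1, (B + w a ((φ a).2.2.1 j)) / (2 * B)} :=
  measurableSet_le (by fun_prop) <| measurable_prod_range_apply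
    (w := fun a r => (B + w a r) / (2 * B)) (by fun_prop) (by fun_prop) (by fun_prop)

lemma measurableSet_acceptSet (hp : Measurable propose)
    (he : Measurable fun z : Euc d × unitInterval => est z.1 z.2) :
    MeasurableSet (acceptSet B propose est) :=
  measurableSet_roundAccepts (φ := id) measurable_id (w := fun ω r => est (propose ω.1) r)
    (he.comp ((hp.comp measurable_fst.fst).prodMk measurable_snd))

lemma measurable_meanEst (hp : Measurable propose)
    (he : Measurable fun z : Euc d × unitInterval => est z.1 z.2) :
    Measurable (meanEst propose est) := by
  have h : StronglyMeasurable fun z : Euc d × unitInterval => est (propose z.1) z.2 :=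
    (he.comp ((hp.comp measurable_fst).prodMk measurable_snd)).stronglyMeasurable
  exact h.integral_prod_right.measurable

lemma abs_meanEst_le (hb : ∀ x r, |est x r| ≤ B) (g : Euc d) : |meanEst propose est g| ≤ B := by
  simpa [meanEst] using norm_integral_le_of_norm_le_const (μ := (volume : Measure unitInterval))
    (f := est (propose g)) (C := B) (ae_of_all _ fun r => hb _ r)

lemma lintegral_acceptSet (hB : 0 < B) (hp : Measurable propose)
    (he : Measurable fun z : Euc d × unitInterval => est z.1 z.2)
    (hb : ∀ x r, |est x r| ≤ B) {f : Euc d → ℝ≥0∞} (hf : Measurable f) :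
    ∫⁻ ω in acceptSet B propose est, f ω.1 ∂(roundNoise d B) =
      ∫⁻ g, f g * ENNReal.ofReal (Real.exp (meanEst propose est g - B)) ∂(stdGaussian (Euc d)) := by
  rw [roundNoise, setLIntegral_prod_fst _ _ (measurableSet_acceptSet hp he) hf]
  refine lintegral_congr fun g => congrArg (f g * ·) ?_
  have heg : Measurable (est (propose g)) := he.comp measurable_prodMk_left
  have hcoin := measure_poissonCoin volume (2 * B).toNNReal
    (q := fun r => (B + est (propose g) r) / (2 * B)) (by fun_prop)
    (fun r => div_nonneg (by linarith [(abs_le.1 (hb (propose g) r)).1]) (by positivity))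
    (fun r => (div_le_one (by positivity)).2 (by linarith [(abs_le.1 (hb (propose g) r)).2]))
  have hestint : Integrable (est (propose g)) (volume : Measure unitInterval) :=
    Integrable.of_bound heg.aestronglyMeasurable B (ae_of_all _ fun r => hb _ r)
  have hmean : ∫ r, (B + est (propose g) r) / (2 * B) = (B + meanEst propose est g) / (2 * B) := by
    rw [integral_div, integral_add (integrable_const _) hestint]
    simp [meanEst]
  refine hcoin.trans ?_
  rw [hmean, Real.coe_toNNReal _ (by positivity)]
  congr 2
  field_simp
  ring

lemma roundNoise_acceptSet (hB : 0 < B) (hp : Measurable propose)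
    (he : Measurable fun z : Euc d × unitInterval => est z.1 z.2)
    (hb : ∀ x r, |est x r| ≤ B) :
    roundNoise d B (acceptSet B propose est) =
      ∫⁻ g, ENNReal.ofReal (Real.exp (meanEst propose est g - B)) ∂(stdGaussian (Euc d)) := by
  simpa using lintegral_acceptSet hB hp he hb (f := 1) measurable_one

lemma le_roundNoise_acceptSet (hB : 0 < B) (hp : Measurable propose)
    (he : Measurable fun z : Euc d × unitInterval => est z.1 z.2)
    (hb : ∀ x r, |est x r| ≤ B) :
    ENNReal.ofReal (Real.exp (-(2 * B))) ≤ roundNoise d B (acceptSet B propose est) := by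
  rw [roundNoise_acceptSet hB hp he hb]
  calc ENNReal.ofReal (Real.exp (-(2 * B)))
      = ∫⁻ _ : Euc d, ENNReal.ofReal (Real.exp (-(2 * B))) ∂(stdGaussian (Euc d)) := by simp
    _ ≤ _ := by
        gcongr with g
        linarith [(abs_le.1 (abs_meanEst_le (propose := propose) hb g)).1]

lemma lintegral_forsOutput (hB : 0 < B) (hp : Measurable propose)
    (he : Measurable fun z : Euc d × unitInterval => est z.1 z.2)
    (hb : ∀ x r, |est x r| ≤ B) {f : Euc d → ℝ≥0∞} (hf : Measurable f) :
    (∫⁻ g, ENNReal.ofReal (Real.exp (meanEst propose est g)) ∂(stdGaussian (Euc d))) *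
      ∫⁻ ω, f (forsOutput B propose est ω) ∂(forsNoise d B) =
      ∫⁻ g, f (propose g) * ENNReal.ofReal (Real.exp (meanEst propose est g))
        ∂(stdGaussian (Euc d)) := by
  have hA := measurableSet_acceptSet (B := B) hp he
  have hm := measurable_meanEst hp he
  have h0 : roundNoise d B (acceptSet B propose est) ≠ 0 :=
    ((ENNReal.ofReal_pos.2 (Real.exp_pos _)).trans_le (le_roundNoise_acceptSet hB hp he hb)).ne'
  have hout : ∫⁻ ω, f (forsOutput B propose est ω) ∂(forsNoise d B) =
      (roundNoise d B (acceptSet B propose est))⁻¹ *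
        ∫⁻ g, f (propose g) * ENNReal.ofReal (Real.exp (meanEst propose est g - B))
          ∂(stdGaussian (Euc d)) := by
    have h := lintegral_firstHit (roundNoise d B) hA h0 (c := 1) (f := fun ω => f (propose ω.1))
      measurable_one (by fun_prop)
    simp only [Pi.one_apply, Finset.prod_const_one, one_mul] at h
    rw [lintegral_acceptSet hB hp he hb (f := fun g => f (propose g)) (by fun_prop),
      setLIntegral_const, one_mul, prob_compl_eq_one_sub hA,
      ENNReal.sub_sub_cancel ENNReal.one_ne_top prob_le_one] at h
    exact h
  have hexp (g : Euc d) : ENNReal.ofReal (Real.exp (meanEst propose est g)) =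
      ENNReal.ofReal (Real.exp B) * ENNReal.ofReal (Real.exp (meanEst propose est g - B)) := by
    rw [← ENNReal.ofReal_mul (Real.exp_pos _).le, ← Real.exp_add, add_sub_cancel]
  simp_rw [hexp, mul_left_comm _ (ENNReal.ofReal (Real.exp B))]
  rw [lintegral_const_mul _ (by fun_prop), lintegral_const_mul _ (by fun_prop),
    ← roundNoise_acceptSet hB hp he hb, hout, mul_assoc, ← mul_assoc (roundNoise d B _),
    ENNReal.mul_inv_cancel h0 (measure_ne_top _ _), one_mul]

end RejectionSampling

section QueryCount

/-- The rate at which the exponential moments of the number of queries are controlled. It is chosen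
so that the queries of one round have exponential moment `1 + exp (-2B) / 2`, where `exp (-2B)` is a
lower bound for the probability of acceptance. -/
def queryRate (B : ℝ) : ℝ := Real.log (1 + Real.log (1 + Real.exp (-(2 * B)) / 2) / (2 * B))

variable {d : ℕ} {B : ℝ} {propose : Euc d → Euc d} {est : Euc d → unitInterval → ℝ}

lemma log_one_add_exp_div_two_pos (B : ℝ) : 0 < Real.log (1 + Real.exp (-(2 * B)) / 2) :=
  Real.log_pos (by linarith [Real.exp_pos (-(2 * B))])

lemma queryRate_pos (hB : 0 < B) : 0 < queryRate B :=
  Real.log_pos (by linarith [div_pos (log_one_add_exp_div_two_pos B) (by positivity : 0 < 2 * B)])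

lemma lintegral_exp_queryRate_poissonMeasure (hB : 0 < B) :
    ∫⁻ n, ENNReal.ofReal (Real.exp (queryRate B * (n : ℕ))) ∂(poissonMeasure (2 * B).toNNReal) =
      ENNReal.ofReal (1 + Real.exp (-(2 * B)) / 2) := by
  have hlog := log_one_add_exp_div_two_pos B
  have h := lintegral_poissonMeasure_pow (2 * B).toNNReal (Real.exp_pos (queryRate B)).le
  simp_rw [← Real.exp_nat_mul, mul_comm _ (queryRate B)] at h
  rw [h, queryRate, Real.exp_log (by positivity), Real.coe_toNNReal _ (by positivity),
    add_sub_cancel_left, mul_div_cancel₀ _ (by positivity), Real.exp_log (by positivity)]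

lemma lintegral_exp_queryRate_roundNoise (hB : 0 < B) :
    ∫⁻ ω, ENNReal.ofReal (Real.exp (queryRate B * ω.2.1)) ∂(roundNoise d B) =
      ENNReal.ofReal (1 + Real.exp (-(2 * B)) / 2) := by
  rw [← lintegral_exp_queryRate_poissonMeasure hB]
  exact (measurePreserving_fst.comp measurePreserving_snd).lintegral_comp
    (f := fun n : ℕ => ENNReal.ofReal (Real.exp (queryRate B * n))) (by fun_prop)

lemma exp_mul_forsCount (θ : ℝ) (ω : ℕ → RoundNoise d) :
    ENNReal.ofReal (Real.exp (θ * forsCount B propose est ω)) =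
      ∏ i ∈ Finset.range (firstHit (acceptSet B propose est) ω + 1),
        ENNReal.ofReal (Real.exp (θ * (ω i).2.1)) := by
  rw [← ENNReal.ofReal_prod_of_nonneg fun i _ => (Real.exp_pos _).le, ← Real.exp_sum,
    ← Finset.mul_sum, forsCount, Nat.cast_sum]
  rfl

lemma lintegral_exp_forsCount_le (hB : 0 < B) (hp : Measurable propose)
    (he : Measurable fun z : Euc d × unitInterval => est z.1 z.2)
    (hb : ∀ x r, |est x r| ≤ B) :
    ∫⁻ ω, ENNReal.ofReal (Real.exp (queryRate B * forsCount B propose est ω)) ∂(forsNoise d B) ≤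
      ENNReal.ofReal (4 * Real.exp (2 * B)) := by
  simp_rw [exp_mul_forsCount]
  refine (lintegral_prod_range_firstHit_le (roundNoise d B) (measurableSet_acceptSet hp he)
    (Real.exp_pos _) (le_roundNoise_acceptSet hB hp he hb)
    (c := fun ω => ENNReal.ofReal (Real.exp (queryRate B * ω.2.1))) (by fun_prop) (fun ω => ?_)
    (lintegral_exp_queryRate_roundNoise hB).le).trans_eq ?_
  · exact ENNReal.one_le_ofReal.2
      (Real.one_le_exp (mul_nonneg (queryRate_pos hB).le (Nat.cast_nonneg _)))
  · rw [Real.exp_neg, div_inv_eq_mul]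

end QueryCount

section GaussDensity

variable {E : Type*} [NormedAddCommGroup E] [InnerProductSpace ℝ E] {σ : ℝ}

/-- The density of the isotropic Gaussian `N(0, σ² I)` with respect to Lebesgue measure. -/
def gaussDensity (σ : ℝ) (x : E) : ℝ :=
  (2 * Real.pi * σ ^ 2) ^ (-(Module.finrank ℝ E / 2 : ℝ)) * Real.exp (-(‖x‖ ^ 2 / (2 * σ ^ 2)))

lemma gaussDensity_pos (hσ : 0 < σ) (x : E) : 0 < gaussDensity σ x := by
  unfold gaussDensity; positivity

lemma gaussDensity_le (x : E) : gaussDensity σ x ≤ gaussDensity σ (0 : E) := by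
  have : 0 ≤ ‖x‖ ^ 2 / (2 * σ ^ 2) := by positivity
  refine mul_le_mul_of_nonneg_left (Real.exp_le_exp.2 ?_) (by positivity)
  simpa using this

@[fun_prop]
lemma continuous_gaussDensity (σ : ℝ) : Continuous (gaussDensity σ : E → ℝ) := by
  unfold gaussDensity; fun_prop

lemma hasFDerivAt_gaussDensity (x : E) :
    HasFDerivAt (gaussDensity σ : E → ℝ) (-(gaussDensity σ x / σ ^ 2) • innerSL ℝ x) x := by
  have h1 : HasFDerivAt (fun x : E => -(‖x‖ ^ 2 / (2 * σ ^ 2)))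
      (-((2 * σ ^ 2)⁻¹ • (2 • innerSL ℝ x))) x := by
    refine ((hasStrictFDerivAt_norm_sq x).hasFDerivAt.const_mul
      ((2 * σ ^ 2)⁻¹)).neg.congr_of_eventuallyEq (Filter.Eventually.of_forall fun y => ?_)
    simp only [Pi.neg_apply]
    ring
  refine (h1.exp.const_mul
    ((2 * Real.pi * σ ^ 2) ^ (-(Module.finrank ℝ E / 2 : ℝ)))).congr_fderiv ?_
  ext v
  simp [gaussDensity]
  ring

variable [FiniteDimensional ℝ E] [MeasurableSpace E] [BorelSpace E]

lemma integrable_rexp_neg_mul_sq_norm {b : ℝ} (hb : 0 < b) :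
    Integrable (fun x : E => Real.exp (-b * ‖x‖ ^ 2)) := by
  have h := GaussianFourier.integrable_cexp_neg_mul_sq_norm_add (V := E) (b := b)
    (by simpa using hb) 0 0
  refine h.re.congr (ae_of_all _ fun x => ?_)
  simp only [zero_mul, add_zero]
  rw [show -(b : ℂ) * (‖x‖ : ℂ) ^ 2 = ((-b * ‖x‖ ^ 2 : ℝ) : ℂ) by push_cast; ring]
  exact Complex.exp_ofReal_re _

lemma integrable_gaussDensity (hσ : 0 < σ) : Integrable (gaussDensity σ : E → ℝ) := by
  refine ((integrable_rexp_neg_mul_sq_norm (b := 1 / (2 * σ ^ 2)) (by positivity)).const_mul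
    ((2 * Real.pi * σ ^ 2) ^ (-(Module.finrank ℝ E / 2 : ℝ)))).congr (ae_of_all _ fun x => ?_)
  simp only [gaussDensity]
  congr 2
  ring

lemma integral_gaussDensity_mul_cexp (hσ : 0 < σ) (t : E) :
    ∫ x, (gaussDensity σ x : ℂ) * Complex.exp (inner ℝ x t * Complex.I) =
      Complex.exp (-(σ ^ 2 * ‖t‖ ^ 2 / 2)) := by
  have hσ' : (σ : ℂ) ≠ 0 := by exact_mod_cast hσ.ne'
  have hfactor (x : E) : (gaussDensity σ x : ℂ) * Complex.exp (inner ℝ x t * Complex.I) =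
      (((2 * Real.pi * σ ^ 2) ^ (-(Module.finrank ℝ E / 2 : ℝ)) : ℝ) : ℂ) *
        Complex.exp (-((1 / (2 * σ ^ 2) : ℝ) : ℂ) * (‖x‖ : ℂ) ^ 2 +
          Complex.I * (inner ℝ t x : ℝ)) := by
    rw [gaussDensity, Complex.exp_add, real_inner_comm, mul_comm Complex.I]
    push_cast
    rw [mul_assoc]
    congr 3
    ring
  have hnorm : ((Real.pi : ℂ) / ((1 / (2 * σ ^ 2) : ℝ) : ℂ)) ^ ((Module.finrank ℝ E : ℂ) / 2) =
      (((2 * Real.pi * σ ^ 2) ^ (Module.finrank ℝ E / 2 : ℝ) : ℝ) : ℂ) := by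
    rw [Complex.ofReal_cpow (by positivity)]
    congr 1
    · push_cast; field_simp
    · simp
  simp_rw [hfactor]
  rw [integral_const_mul, GaussianFourier.integral_cexp_neg_mul_sq_norm_add
    (by rw [Complex.ofReal_re]; positivity), ← mul_assoc, hnorm, ← Complex.ofReal_mul,
    ← Real.rpow_add (by positivity), neg_add_cancel, Real.rpow_zero, Complex.ofReal_one, one_mul,
    Complex.I_sq]
  congr 1
  push_cast
  field_simp
  ring

lemma map_smul_stdGaussian (hσ : 0 < σ) :
    (stdGaussian E).map (σ • ·) =
      volume.withDensity fun x => ENNReal.ofReal (gaussDensity σ x) := by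
  have : IsProbabilityMeasure ((stdGaussian E).map (σ • ·)) :=
    Measure.isProbabilityMeasure_map (by fun_prop)
  have : IsFiniteMeasure ((volume : Measure E).withDensity
      fun x => ENNReal.ofReal (gaussDensity σ x)) :=
    isFiniteMeasure_withDensity_ofReal (integrable_gaussDensity hσ).2
  refine Measure.ext_of_charFun (funext fun t => ?_)
  rw [charFun_map_smul, charFun_stdGaussian, charFun_apply,
    integral_withDensity_eq_integral_toReal_smul (by fun_prop)
      (ae_of_all _ fun _ => ENNReal.ofReal_lt_top)]
  simp_rw [ENNReal.toReal_ofReal (gaussDensity_pos hσ _).le, Complex.real_smul]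
  rw [integral_gaussDensity_mul_cexp hσ, norm_smul, Real.norm_eq_abs, abs_of_pos hσ]
  push_cast
  ring_nf

lemma stdGaussian_eq_withDensity :
    stdGaussian E = volume.withDensity fun x => ENNReal.ofReal (gaussDensity 1 x) := by
  rw [← map_smul_stdGaussian one_pos]
  simp

end GaussDensity

section StdGaussian

lemma one_div_one_sub_rpow_half_le_exp {θ : ℝ} (h0 : 0 ≤ θ) (h1 : θ ≤ 1 / 2) :
    (1 / (1 - θ)) ^ (1 / 2 : ℝ) ≤ Real.exp θ := by
  have hp : 0 < 1 - θ := by linarith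
  rw [show Real.exp θ = Real.exp (2 * θ) ^ (1 / 2 : ℝ) by rw [← Real.exp_mul]; congr 1; ring]
  refine Real.rpow_le_rpow (by positivity) ?_ (by norm_num)
  rw [div_le_iff₀ hp]
  have := Real.quadratic_le_exp_of_nonneg (show (0 : ℝ) ≤ 2 * θ by linarith)
  nlinarith [mul_nonneg h0 (sub_nonneg.2 h1), mul_nonneg (mul_nonneg h0 h0) (sub_nonneg.2 h1)]

variable {E : Type*} [NormedAddCommGroup E] [InnerProductSpace ℝ E] [FiniteDimensional ℝ E]
  [MeasurableSpace E] [BorelSpace E]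

lemma lintegral_exp_sq_norm_stdGaussian {θ : ℝ} (hθ : θ < 1) :
    ∫⁻ g, ENNReal.ofReal (Real.exp (θ * ‖g‖ ^ 2 / 2)) ∂(stdGaussian E) =
      ENNReal.ofReal ((1 / (1 - θ)) ^ (Module.finrank ℝ E / 2 : ℝ)) := by
  have hp : 0 < 1 - θ := by linarith
  have hinner (x : E) : ENNReal.ofReal (gaussDensity 1 x) *
      ENNReal.ofReal (Real.exp (θ * ‖x‖ ^ 2 / 2)) =
      ENNReal.ofReal ((2 * Real.pi) ^ (-(Module.finrank ℝ E / 2 : ℝ)) *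
        Real.exp (-((1 - θ) / 2) * ‖x‖ ^ 2)) := by
    rw [← ENNReal.ofReal_mul (gaussDensity_pos one_pos x).le, gaussDensity, mul_assoc,
      ← Real.exp_add]
    congr 3
    · norm_num
    · ring
  rw [stdGaussian_eq_withDensity,
    lintegral_withDensity_eq_lintegral_mul _ (by fun_prop) (by fun_prop)]
  simp_rw [Pi.mul_apply, hinner]
  rw [← ofReal_integral_eq_lintegral_ofReal
    ((integrable_rexp_neg_mul_sq_norm (by linarith)).const_mul _)
    (ae_of_all _ fun x => by positivity),
    integral_const_mul, GaussianFourier.integral_rexp_neg_mul_sq_norm (by linarith),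
    show Real.pi / ((1 - θ) / 2) = (2 * Real.pi) * (1 / (1 - θ)) by field_simp,
    Real.mul_rpow (x := 2 * Real.pi) (by positivity) (by positivity), ← mul_assoc,
    ← Real.rpow_add (by positivity), neg_add_cancel, Real.rpow_zero, one_mul]

lemma lintegral_exp_sq_norm_stdGaussian_le {θ : ℝ} (h0 : 0 ≤ θ) (h1 : θ ≤ 1 / 2) :
    ∫⁻ g, ENNReal.ofReal (Real.exp (θ * ‖g‖ ^ 2 / 2)) ∂(stdGaussian E) ≤
      ENNReal.ofReal (Real.exp (θ * Module.finrank ℝ E)) := by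
  have hp : 0 < 1 - θ := by linarith
  rw [lintegral_exp_sq_norm_stdGaussian (by linarith),
    show (Module.finrank ℝ E / 2 : ℝ) = 1 / 2 * Module.finrank ℝ E by ring,
    Real.rpow_mul (by positivity), Real.exp_mul]
  gcongr
  exact one_div_one_sub_rpow_half_le_exp h0 h1

lemma map_neg_stdGaussian : (stdGaussian E).map (fun g => -g) = stdGaussian E :=
  stdGaussian_map (LinearIsometryEquiv.neg ℝ)

lemma map_add_smul_stdGaussian (a b : ℝ) :
    ((stdGaussian E).prod (stdGaussian E)).map (fun z => a • z.1 + b • z.2) =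
      (stdGaussian E).map (√(a ^ 2 + b ^ 2) • ·) := by
  have (c : ℝ) : IsProbabilityMeasure ((stdGaussian E).map (c • ·)) :=
    Measure.isProbabilityMeasure_map (by fun_prop)
  have hconv : ((stdGaussian E).prod (stdGaussian E)).map (fun z => a • z.1 + b • z.2) =
      ((stdGaussian E).map (a • ·)) ∗ ((stdGaussian E).map (b • ·)) := by
    rw [Measure.conv, Measure.map_prod_map _ _ (by fun_prop) (by fun_prop),
      Measure.map_map (by fun_prop) (by fun_prop)]
    rfl
  rw [hconv]
  refine Measure.ext_of_charFun (funext fun t => ?_)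
  rw [charFun_conv, charFun_map_smul, charFun_map_smul, charFun_map_smul, charFun_stdGaussian,
    charFun_stdGaussian, charFun_stdGaussian, ← Complex.exp_add]
  congr 1
  simp only [norm_smul, Real.norm_eq_abs, Complex.ofReal_mul, mul_pow, ← Complex.ofReal_pow, sq_abs]
  rw [Real.sq_sqrt (by positivity)]
  push_cast
  ring

lemma integrable_inner_sq_stdGaussian (e : E) :
    Integrable (fun g => (inner ℝ g e : ℝ) ^ 2) (stdGaussian E) := by
  have h := (IsGaussian.memLp_two_id (μ := stdGaussian E)).continuousLinearMap_comp (innerSL ℝ e)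
  simpa [real_inner_comm] using h.integrable_sq

lemma integral_inner_stdGaussian (e : E) : ∫ g, (inner ℝ g e : ℝ) ∂(stdGaussian E) = 0 := by
  simpa [real_inner_comm] using integral_strongDual_stdGaussian (innerSL ℝ e)

lemma integral_inner_sq_stdGaussian (e : E) :
    ∫ g, (inner ℝ g e : ℝ) ^ 2 ∂(stdGaussian E) = ‖e‖ ^ 2 := by
  have h := variance_dual_stdGaussian (innerSL ℝ e)
  rw [variance_eq_integral (by fun_prop), integral_strongDual_stdGaussian] at h
  simpa [real_inner_comm] using h

lemma lintegral_inner_sq_stdGaussian (e : E) :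
    ∫⁻ g, ENNReal.ofReal ((inner ℝ g e : ℝ) ^ 2) ∂(stdGaussian E) = ‖e‖ₑ ^ 2 := by
  rw [← ofReal_integral_eq_lintegral_ofReal (integrable_inner_sq_stdGaussian e)
    (ae_of_all _ fun g => by positivity), integral_inner_sq_stdGaussian,
    ENNReal.ofReal_pow (norm_nonneg _), ofReal_norm]

lemma integrable_norm_sq_stdGaussian : Integrable (fun g => ‖g‖ ^ 2) (stdGaussian E) :=
  (IsGaussian.memLp_two_id (μ := stdGaussian E)).integrable_norm_pow (by norm_num)

lemma integral_norm_sq_stdGaussian :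
    ∫ g, ‖g‖ ^ 2 ∂(stdGaussian E) = Module.finrank ℝ E := by
  have hsum (g : E) : ‖g‖ ^ 2 = ∑ i, (inner ℝ g (stdOrthonormalBasis ℝ E i) : ℝ) ^ 2 := by
    rw [← (stdOrthonormalBasis ℝ E).sum_sq_inner_left]
  simp_rw [hsum]
  rw [integral_finsetSum _ fun i _ => integrable_inner_sq_stdGaussian _]
  simp [integral_inner_sq_stdGaussian]

end StdGaussian

section SmoothDensity

variable {E : Type*} [NormedAddCommGroup E] [InnerProductSpace ℝ E] [MeasurableSpace E]

/-- The density of `Y + σ Z` with `Y ∼ ν` and `Z` standard Gaussian: the smoothing of `ν` at scale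
`σ`. -/
def smoothDensity (ν : Measure E) (σ : ℝ) (x : E) : ℝ :=
  ∫ y, gaussDensity σ (x - y) ∂ν

variable [FiniteDimensional ℝ E] [BorelSpace E] {ν : Measure E} [IsProbabilityMeasure ν] {σ : ℝ}

lemma integrable_gaussDensity_sub (hσ : 0 < σ) (x : E) :
    Integrable (fun y => gaussDensity σ (x - y)) ν := by
  refine Integrable.of_bound (by fun_prop) (gaussDensity σ (0 : E)) (ae_of_all _ fun y => ?_)
  rw [Real.norm_eq_abs, abs_of_pos (gaussDensity_pos hσ _)]
  exact gaussDensity_le _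

lemma smoothDensity_pos (hσ : 0 < σ) (x : E) : 0 < smoothDensity ν σ x := by
  refine (integral_pos_iff_support_of_nonneg (fun _ => (gaussDensity_pos hσ _).le)
    (integrable_gaussDensity_sub hσ x)).2 ?_
  have : Function.support (fun y => gaussDensity σ (x - y)) = Set.univ := by
    ext; simp [(gaussDensity_pos hσ _).ne']
  simp [this]

lemma lintegral_gaussDensity_sub (hσ : 0 < σ) (x : E) :
    ∫⁻ y, ENNReal.ofReal (gaussDensity σ (x - y)) ∂ν = ENNReal.ofReal (smoothDensity ν σ x) :=
  (ofReal_integral_eq_lintegral_ofReal (integrable_gaussDensity_sub hσ x)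
    (ae_of_all _ fun _ => (gaussDensity_pos hσ _).le)).symm

lemma map_add_smul_eq_withDensity (hσ : 0 < σ) :
    (ν.prod (stdGaussian E)).map (fun z => z.1 + σ • z.2) =
      volume.withDensity fun x => ENNReal.ofReal (smoothDensity ν σ x) := by
  refine Measure.ext_of_lintegral _ fun f hf => ?_
  rw [lintegral_map hf (by fun_prop), lintegral_prod _ (by fun_prop)]
  have hshift (y : E) : ∫⁻ g, f (y + σ • g) ∂(stdGaussian E) =
      ∫⁻ x, f x * ENNReal.ofReal (gaussDensity σ (x - y)) := by
    rw [← lintegral_map (f := fun z => f (y + z)) (g := fun g : E => σ • g)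
      (by fun_prop) (by fun_prop), map_smul_stdGaussian hσ,
      lintegral_withDensity_eq_lintegral_mul _ (by fun_prop) (by fun_prop),
      ← lintegral_sub_right_eq_self _ y]
    refine lintegral_congr fun x => ?_
    simp [mul_comm]
  simp_rw [hshift]
  rw [lintegral_lintegral_swap (by fun_prop)]
  simp_rw [← lintegral_gaussDensity_sub (ν := ν) hσ]
  rw [lintegral_withDensity_eq_lintegral_mul _ (Measurable.lintegral_prod_right (by fun_prop)) hf]
  refine lintegral_congr fun x => ?_
  rw [lintegral_const_mul _ (by fun_prop)]
  simp [mul_comm]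

lemma mul_exp_neg_sq_div_le (hσ : 0 < σ) (t : ℝ) :
    t * Real.exp (-(t ^ 2 / (2 * σ ^ 2))) ≤ σ := by
  rw [Real.exp_neg, ← div_eq_mul_inv, div_le_iff₀ (Real.exp_pos _)]
  have hsq : σ * (t ^ 2 / (2 * σ ^ 2) + 1) - t = ((t - σ) ^ 2 + σ ^ 2) / (2 * σ) := by
    field_simp; ring
  have hnonneg : 0 ≤ ((t - σ) ^ 2 + σ ^ 2) / (2 * σ) := by positivity
  exact (by linarith : t ≤ σ * (t ^ 2 / (2 * σ ^ 2) + 1)).trans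
    (mul_le_mul_of_nonneg_left (Real.add_one_le_exp _) hσ.le)

lemma differentiable_smoothDensity (hσ : 0 < σ) : Differentiable ℝ (smoothDensity ν σ) := by
  intro x
  refine (hasFDerivAt_integral_of_dominated_of_fderiv_le (𝕜 := ℝ) (μ := ν) (s := Set.univ)
    (F := fun x y => gaussDensity σ (x - y))
    (F' := fun x y => -(gaussDensity σ (x - y) / σ ^ 2) • innerSL ℝ (x - y))
    (bound := fun _ => (2 * Real.pi * σ ^ 2) ^ (-(Module.finrank ℝ E / 2 : ℝ)) * σ / σ ^ 2)
    Filter.univ_mem (Filter.Eventually.of_forall fun x => by fun_prop)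
    (integrable_gaussDensity_sub hσ x) ?_ ?_ (integrable_const _) ?_).differentiableAt
  · have hsmul : Continuous fun y : E => -(gaussDensity σ (x - y) / σ ^ 2) := by fun_prop
    exact (hsmul.smul
      ((innerSL ℝ).continuous.comp (continuous_const.sub continuous_id))).aestronglyMeasurable
  · refine ae_of_all _ fun y z _ => ?_
    rw [norm_smul, innerSL_apply_norm, norm_neg, Real.norm_eq_abs,
      abs_of_nonneg (div_nonneg (gaussDensity_pos hσ _).le (by positivity)), gaussDensity]
    have := mul_exp_neg_sq_div_le hσ ‖z - y‖
    rw [div_mul_eq_mul_div, mul_assoc, mul_comm (Real.exp _)]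
    gcongr
  · refine ae_of_all _ fun y z _ => ?_
    simpa [Function.comp_def] using
      (hasFDerivAt_gaussDensity (σ := σ) (z - y)).comp z ((hasFDerivAt_id z).sub_const y)

lemma smoothDensity_mul_exp (hσ : 0 < σ) (x : E) :
    ENNReal.ofReal (smoothDensity ν σ x * Real.exp (‖x‖ ^ 2 / (2 * σ ^ 2))) =
      ∫⁻ y, ENNReal.ofReal ((2 * Real.pi * σ ^ 2) ^ (-(Module.finrank ℝ E / 2 : ℝ)) *
        Real.exp ((2 * inner ℝ x y - ‖y‖ ^ 2) / (2 * σ ^ 2))) ∂ν := by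
  rw [ENNReal.ofReal_mul (smoothDensity_pos hσ x).le, ← lintegral_gaussDensity_sub hσ,
    ← lintegral_mul_const _ (by fun_prop)]
  refine lintegral_congr fun y => ?_
  rw [← ENNReal.ofReal_mul (gaussDensity_pos hσ _).le, gaussDensity, mul_assoc, ← Real.exp_add]
  congr 3
  rw [norm_sub_sq_real]
  ring

lemma ofReal_mul_exp_combo {K : ℝ} (hK : 0 < K) {a b : ℝ} (hab : a + b = 1) (u v : ℝ) :
    ENNReal.ofReal (K * Real.exp (a * u + b * v)) =
      ENNReal.ofReal (K * Real.exp u) ^ a * ENNReal.ofReal (K * Real.exp v) ^ b := by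
  rw [ENNReal.ofReal_rpow_of_pos (by positivity), ENNReal.ofReal_rpow_of_pos (by positivity),
    ← ENNReal.ofReal_mul (by positivity), Real.mul_rpow hK.le (Real.exp_pos _).le,
    Real.mul_rpow hK.le (Real.exp_pos _).le, mul_mul_mul_comm, ← Real.rpow_add hK, hab,
    Real.rpow_one, ← Real.exp_mul, ← Real.exp_mul, ← Real.exp_add, mul_comm u, mul_comm v]

/- Up to the factor `exp (-‖x‖² / (2σ²))` the smoothed density is a Laplace transform, and Laplace
transforms are log-convex by Hölder's inequality. -/
lemma convexOn_log_smoothDensity (hσ : 0 < σ) :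
    ConvexOn ℝ Set.univ fun x => Real.log (smoothDensity ν σ x) + ‖x‖ ^ 2 / (2 * σ ^ 2) := by
  have hpos (x : E) : 0 < smoothDensity ν σ x * Real.exp (‖x‖ ^ 2 / (2 * σ ^ 2)) :=
    mul_pos (smoothDensity_pos hσ x) (Real.exp_pos _)
  have hlog (x : E) : Real.log (smoothDensity ν σ x) + ‖x‖ ^ 2 / (2 * σ ^ 2) =
      Real.log (smoothDensity ν σ x * Real.exp (‖x‖ ^ 2 / (2 * σ ^ 2))) := by
    rw [Real.log_mul (smoothDensity_pos hσ x).ne' (Real.exp_pos _).ne', Real.log_exp]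
  refine ⟨convex_univ, fun x _ z _ a b ha hb hab => ?_⟩
  simp only [hlog, smul_eq_mul]
  rw [← Real.log_rpow (hpos x), ← Real.log_rpow (hpos z),
    ← Real.log_mul (Real.rpow_pos_of_pos (hpos x) _).ne' (Real.rpow_pos_of_pos (hpos z) _).ne']
  refine Real.log_le_log (hpos _) ?_
  rw [← ENNReal.ofReal_le_ofReal_iff (by have := hpos x; have := hpos z; positivity),
    ENNReal.ofReal_mul (Real.rpow_nonneg (hpos x).le _),
    ← ENNReal.ofReal_rpow_of_pos (hpos x), ← ENNReal.ofReal_rpow_of_pos (hpos z),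
    smoothDensity_mul_exp hσ, smoothDensity_mul_exp hσ, smoothDensity_mul_exp hσ]
  refine le_trans (le_of_eq (lintegral_congr fun y => ?_))
    (ENNReal.lintegral_mul_norm_pow_le (by fun_prop) (by fun_prop) ha hb hab)
  rw [← ofReal_mul_exp_combo (by positivity) hab, inner_add_left, real_inner_smul_left,
    real_inner_smul_left]
  congr 3
  linear_combination (‖y‖ ^ 2 / (2 * σ ^ 2)) * hab

end SmoothDensity

section LogSmooth

variable {E : Type*} [NormedAddCommGroup E] [InnerProductSpace ℝ E] [CompleteSpace E]
  {p : E → ℝ} {σ : ℝ}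

/-- The density `p` is positive and differentiable, and `log p + ‖x‖² / (2σ²)` lies above its
tangent hyperplanes. All that is used of a density smoothed at scale `σ` is that it has this
property. -/
structure LogSmooth (p : E → ℝ) (σ : ℝ) : Prop where
  pos : ∀ x, 0 < p x
  diff : Differentiable ℝ p
  inner_gradient_le : ∀ x v, inner ℝ v (gradient (fun y => Real.log (p y)) x) ≤
    Real.log (p (x + v)) - Real.log (p x) + ‖v‖ ^ 2 / (2 * σ ^ 2)

lemma hasDerivAt_log_comp_line (hpos : ∀ x, 0 < p x) (hdiff : Differentiable ℝ p) (x v : E)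
    (t : ℝ) :
    HasDerivAt (fun t : ℝ => Real.log (p (x + t • v)))
      (inner ℝ v (gradient (fun y => Real.log (p y)) (x + t • v))) t := by
  have hline : HasDerivAt (fun t : ℝ => x + t • v) v t := by
    simpa using ((hasDerivAt_id t).smul_const v).const_add x
  have hlog : DifferentiableAt ℝ (fun y => Real.log (p y)) (x + t • v) :=
    (hdiff _).log (hpos _).ne'
  have := hlog.hasFDerivAt.comp_hasDerivAt t hline
  rwa [← toDual_gradient, InnerProductSpace.toDual_apply_apply, real_inner_comm] at this

lemma LogSmooth.of_convexOn (hpos : ∀ x, 0 < p x) (hdiff : Differentiable ℝ p)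
    (hconv : ConvexOn ℝ Set.univ fun x => Real.log (p x) + ‖x‖ ^ 2 / (2 * σ ^ 2)) :
    LogSmooth p σ where
  pos := hpos
  diff := hdiff
  inner_gradient_le x v := by
    have hline : ConvexOn ℝ Set.univ fun t : ℝ => Real.log (p (x + t • v)) +
        ‖x + t • v‖ ^ 2 / (2 * σ ^ 2) :=
      (hconv.comp_affineMap (AffineMap.lineMap x (x + v))).congr fun t _ => by
        simp [AffineMap.lineMap_apply, add_comm]
    have hsq : HasDerivAt (fun t : ℝ => ‖x + t • v‖ ^ 2 / (2 * σ ^ 2))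
        (2 * inner ℝ (x + (0 : ℝ) • v) v / (2 * σ ^ 2)) 0 := by
      have := ((hasDerivAt_id (0 : ℝ)).smul_const v).const_add x
      simpa using this.norm_sq.div_const (2 * σ ^ 2)
    have h := hline.le_slope_of_hasDerivAt (Set.mem_univ _) (Set.mem_univ _) one_pos
      ((hasDerivAt_log_comp_line hpos hdiff x v 0).add hsq)
    simp only [slope_def_field, zero_smul, add_zero, one_smul, sub_zero, div_one] at h
    rw [norm_add_sq_real x v] at h
    have hexp : (‖x‖ ^ 2 + 2 * inner ℝ x v + ‖v‖ ^ 2) / (2 * σ ^ 2) = ‖x‖ ^ 2 / (2 * σ ^ 2) +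
      2 * inner ℝ x v / (2 * σ ^ 2) + ‖v‖ ^ 2 / (2 * σ ^ 2) := by ring
    linarith

lemma logSmooth_smoothDensity {F : Type*} [NormedAddCommGroup F] [InnerProductSpace ℝ F]
    [FiniteDimensional ℝ F] [MeasurableSpace F] [BorelSpace F] {ν : Measure F}
    [IsProbabilityMeasure ν] (hσ : 0 < σ) : LogSmooth (smoothDensity ν σ) σ :=
  .of_convexOn (smoothDensity_pos hσ) (differentiable_smoothDensity hσ)
    (convexOn_log_smoothDensity hσ)

lemma LogSmooth.inner_gradient_mono (h : LogSmooth p σ) (hσ : 0 < σ) (x v : E) {r t : ℝ}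
    (hrt : r ≤ t) :
    inner ℝ v (gradient (fun y => Real.log (p y)) (x + r • v)) + r * (‖v‖ ^ 2 / σ ^ 2) ≤
      inner ℝ v (gradient (fun y => Real.log (p y)) (x + t • v)) + t * (‖v‖ ^ 2 / σ ^ 2) := by
  rcases hrt.eq_or_lt with rfl | hlt
  · rfl
  have hr := h.inner_gradient_le (x + r • v) ((t - r) • v)
  have ht := h.inner_gradient_le (x + t • v) ((r - t) • v)
  rw [show x + r • v + (t - r) • v = x + t • v by module] at hr
  rw [show x + t • v + (r - t) • v = x + r • v by module] at ht
  rw [real_inner_smul_left, norm_smul, mul_pow, Real.norm_eq_abs, sq_abs] at hr ht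
  set a := inner ℝ v (gradient (fun y => Real.log (p y)) (x + r • v))
  set b := inner ℝ v (gradient (fun y => Real.log (p y)) (x + t • v))
  have hsum : (t - r) * (a - b) ≤ (t - r) * ((t - r) * (‖v‖ ^ 2 / σ ^ 2)) := by
    have : (t - r) ^ 2 * ‖v‖ ^ 2 / (2 * σ ^ 2) + (r - t) ^ 2 * ‖v‖ ^ 2 / (2 * σ ^ 2) =
      (t - r) * ((t - r) * (‖v‖ ^ 2 / σ ^ 2)) := by field_simp; ring
    linarith
  linarith [le_of_mul_le_mul_left hsum (sub_pos.2 hlt)]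

lemma LogSmooth.intervalIntegrable_inner_gradient (h : LogSmooth p σ) (hσ : 0 < σ) (x v : E)
    (a b : ℝ) :
    IntervalIntegrable (fun t : ℝ => inner ℝ v (gradient (fun y => Real.log (p y)) (x + t • v)))
      volume a b := by
  have hmono : Monotone fun t : ℝ => inner ℝ v (gradient (fun y => Real.log (p y)) (x + t • v)) +
      t * (‖v‖ ^ 2 / σ ^ 2) := fun r t hrt => h.inner_gradient_mono hσ x v hrt
  have hcont : Continuous fun t : ℝ => t * (‖v‖ ^ 2 / σ ^ 2) := by fun_prop
  simpa using (hmono.intervalIntegrable (μ := volume)).sub (hcont.intervalIntegrable a b)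

lemma LogSmooth.log_sub_log_eq_integral (h : LogSmooth p σ) (hσ : 0 < σ) (x v : E) :
    Real.log (p (x + v)) - Real.log (p x) =
      ∫ t in (0 : ℝ)..1, inner ℝ v (gradient (fun y => Real.log (p y)) (x + t • v)) := by
  rw [intervalIntegral.integral_eq_sub_of_hasDerivAt
    (fun t _ => hasDerivAt_log_comp_line h.pos h.diff x v t)
    (h.intervalIntegrable_inner_gradient hσ x v 0 1)]
  simp

lemma measurable_gradient [MeasurableSpace E] [BorelSpace E] (f : E → ℝ) :
    Measurable (gradient f) :=
  (InnerProductSpace.toDual ℝ E).symm.continuous.measurable.comp (measurable_fderiv ℝ f)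

end LogSmooth

lemma contDensity_withDensity {d : ℕ} {p : Euc d → ℝ} (hc : Continuous p) (h0 : ∀ x, 0 ≤ p x) :
    contDensity (volume.withDensity fun x => ENNReal.ofReal (p x)) = p := by
  have h : ∃ ρ : Euc d → ℝ, Continuous ρ ∧ (∀ x, 0 ≤ ρ x) ∧
      (volume.withDensity fun x => ENNReal.ofReal (p x)) =
        volume.withDensity (fun x => ENNReal.ofReal (ρ x)) := ⟨p, hc, h0, rfl⟩
  rw [contDensity, dif_pos h]
  obtain ⟨hcont, hnonneg, heq⟩ := h.choose_spec
  have hae := (withDensity_eq_iff_of_sigmaFinite (by fun_prop) (by fun_prop)).1 heq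
  refine ((Continuous.ae_eq_iff_eq volume hc hcont).1 ?_).symm
  filter_upwards [hae] with x hx
  exact (ENNReal.ofReal_eq_ofReal_iff (h0 x) (hnonneg x)).1 hx

section Forward

variable {d T t : ℕ} {σ : ℕ → ℝ} {σ₁ : ℝ}

lemma IsVPSchedule.vpAlphaBar_pos (h : IsVPSchedule T σ σ₁) (ht : t ≤ T) :
    0 < vpAlphaBar σ t := by
  refine Real.sqrt_pos.2 ?_
  rcases Nat.eq_zero_or_pos t with rfl | h1
  · simp [h.zero]
  · nlinarith [h.pos t h1 ht, h.lt_one t h1 ht]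

lemma IsVPSchedule.vpAlpha_pos (h : IsVPSchedule T σ σ₁) (ht : t < T) : 0 < vpAlpha σ t :=
  div_pos (h.vpAlphaBar_pos ht) (h.vpAlphaBar_pos ht.le)

lemma IsVPSchedule.vpAlpha_mul_vpAlphaBar (h : IsVPSchedule T σ σ₁) (ht : t < T) :
    vpAlpha σ t * vpAlphaBar σ t = vpAlphaBar σ (t + 1) :=
  div_mul_cancel₀ _ (h.vpAlphaBar_pos ht.le).ne'

lemma IsVPSchedule.sqrt_noise_add_noise (h : IsVPSchedule T σ σ₁) (ht : t < T) :
    √((vpAlpha σ t * σ t) ^ 2 + (vpAlpha σ t * √(vpEta σ t)) ^ 2) = σ (t + 1) := by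
  have := h.vpAlpha_pos ht
  rw [mul_pow, mul_pow, Real.sq_sqrt (h.eta_pos t ht).le, ← mul_add, vpEta, add_sub_cancel,
    mul_div_cancel₀ _ (by positivity), Real.sqrt_sq (h.pos (t + 1) (by omega) ht).le]

lemma forwardLaw_eq_map (pdata : Measure (Euc d)) [IsProbabilityMeasure pdata]
    (h : IsVPSchedule T σ σ₁) (ht : t ≤ T) :
    forwardLaw pdata σ t = (pdata.prod (stdGaussian (Euc d))).map
      (fun z => vpAlphaBar σ t • z.1 + σ t • z.2) := by
  induction t with
  | zero =>
    have hfst : (fun z : Euc d × Euc d => vpAlphaBar σ 0 • z.1 + σ 0 • z.2) = Prod.fst := by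
      ext z; simp [vpAlphaBar, h.zero]
    rw [forwardLaw, hfst, ← Measure.fst, Measure.fst_prod]
  | succ t ih =>
    rw [forwardLaw, ih (by omega)]
    refine Measure.ext_of_lintegral _ fun f hf => ?_
    rw [lintegral_map hf (by fun_prop), lintegral_map hf (by fun_prop),
      lintegral_prod _ (by fun_prop),
      lintegral_map (Measurable.lintegral_prod_right (by fun_prop)) (by fun_prop),
      lintegral_prod _ (by fun_prop), lintegral_prod _ (by fun_prop)]
    refine lintegral_congr fun y => ?_
    rw [← lintegral_map (f := fun z => f (vpAlphaBar σ (t + 1) • y + z))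
        (g := fun g : Euc d => σ (t + 1) • g) (by fun_prop) (by fun_prop),
      ← h.sqrt_noise_add_noise ht, ← map_add_smul_stdGaussian,
      lintegral_map (by fun_prop) (by fun_prop), lintegral_prod _ (by fun_prop)]
    refine lintegral_congr fun g => lintegral_congr fun g' => ?_
    rw [← h.vpAlpha_mul_vpAlphaBar ht]
    congr 1
    module

instance isProbabilityMeasure_map_smul {E : Type*} [MeasurableSpace E] [SMul ℝ E]
    [MeasurableConstSMul ℝ E] (ν : Measure E) [IsProbabilityMeasure ν] (a : ℝ) :
    IsProbabilityMeasure (ν.map (a • ·)) :=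
  Measure.isProbabilityMeasure_map (by fun_prop)

/-- The density of the law of `X_t` for `t ≥ 1`, where `X_t` is the rescaled data plus independent
Gaussian noise of scale `σ_t`. -/
def forwardDensity (pdata : Measure (Euc d)) (σ : ℕ → ℝ) (t : ℕ) : Euc d → ℝ :=
  smoothDensity (pdata.map (vpAlphaBar σ t • ·)) (σ t)

variable (pdata : Measure (Euc d)) [IsProbabilityMeasure pdata]

lemma logSmooth_forwardDensity (h : IsVPSchedule T σ σ₁) (h1 : 1 ≤ t) (ht : t ≤ T) :
    LogSmooth (forwardDensity pdata σ t) (σ t) :=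
  logSmooth_smoothDensity (h.pos t h1 ht)

lemma forwardLaw_eq_withDensity (h : IsVPSchedule T σ σ₁) (h1 : 1 ≤ t) (ht : t ≤ T) :
    forwardLaw pdata σ t =
      volume.withDensity fun x => ENNReal.ofReal (forwardDensity pdata σ t x) := by
  rw [forwardDensity, ← map_add_smul_eq_withDensity (h.pos t h1 ht), forwardLaw_eq_map pdata h ht]
  refine Measure.ext_of_lintegral _ fun f hf => ?_
  rw [lintegral_map hf (by fun_prop), lintegral_map hf (by fun_prop),
    lintegral_prod _ (by fun_prop), lintegral_prod _ (by fun_prop),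
    lintegral_map (Measurable.lintegral_prod_right (by fun_prop)) (by fun_prop)]

lemma score_forwardLaw (h : IsVPSchedule T σ σ₁) (h1 : 1 ≤ t) (ht : t ≤ T) :
    score (forwardLaw pdata σ t) = gradient fun y => Real.log (forwardDensity pdata σ t y) := by
  have hs := logSmooth_forwardDensity pdata h h1 ht
  ext1 x
  rw [score, forwardLaw_eq_withDensity pdata h h1 ht, contDensity_withDensity hs.diff.continuous
    fun x => (hs.pos x).le]

lemma isProbabilityMeasure_forwardLaw (h : IsVPSchedule T σ σ₁) (ht : t ≤ T) :
    IsProbabilityMeasure (forwardLaw pdata σ t) := by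
  rw [forwardLaw_eq_map pdata h ht]
  exact Measure.isProbabilityMeasure_map (by fun_prop)

end Forward

section RelativeEntropy

/-- The excess of the exponential over its tangent at `0`. The relative entropy of densities is the
expectation of the `expGap` of the difference of their logarithms, so that it is controlled
pointwise by the square of this difference. -/
def expGap (u : ℝ) : ℝ := Real.exp u - 1 - u

lemma expGap_nonneg (u : ℝ) : 0 ≤ expGap u := by
  unfold expGap; linarith [Real.add_one_le_exp u]

@[fun_prop]
lemma measurable_expGap : Measurable expGap := by unfold expGap; fun_prop

lemma expGap_le_sq {u b : ℝ} (hu : |u| ≤ b) : expGap u ≤ Real.exp b * u ^ 2 := by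
  have h := Complex.norm_exp_sub_sum_le_norm_mul_exp u 2
  have hgap : Complex.exp u - ∑ m ∈ Finset.range 2, (u : ℂ) ^ m / m.factorial = expGap u := by
    simp [Finset.sum_range_succ, expGap, sub_sub]
  rw [hgap, Complex.norm_real, Complex.norm_real, Real.norm_eq_abs, Real.norm_eq_abs, sq_abs,
    mul_comm] at h
  exact (le_abs_self _).trans (h.trans (by gcongr))

lemma mul_klFun_div {a b : ℝ} (ha : 0 < a) (hb : 0 < b) :
    b * klFun (a / b) = a * expGap (Real.log b - Real.log a) := by
  rw [klFun_apply, expGap, Real.exp_sub, Real.exp_log ha, Real.exp_log hb,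
    Real.log_div ha.ne' hb.ne']
  field_simp
  ring

variable {α : Type*} [MeasurableSpace α] {f g : α → ℝ}

lemma withDensity_withDensity_div (m : Measure α) (hf : Measurable f) (hg : Measurable g)
    (hg0 : ∀ x, 0 < g x) :
    (m.withDensity fun x => ENNReal.ofReal (g x)).withDensity
        (fun x => ENNReal.ofReal (f x / g x)) =
      m.withDensity fun x => ENNReal.ofReal (f x) := by
  rw [← withDensity_mul _ (by fun_prop) (by fun_prop)]
  congr 1
  ext x
  rw [Pi.mul_apply, ← ENNReal.ofReal_mul (hg0 x).le, mul_div_cancel₀ _ (hg0 x).ne']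

lemma klDiv_withDensity (m : Measure α) (hf : Measurable f) (hg : Measurable g)
    (hf0 : ∀ x, 0 < f x) (hg0 : ∀ x, 0 < g x)
    (hfi : ∫⁻ x, ENNReal.ofReal (f x) ∂m ≠ ∞) (hgi : ∫⁻ x, ENNReal.ofReal (g x) ∂m ≠ ∞) :
    klDiv (m.withDensity fun x => ENNReal.ofReal (f x))
        (m.withDensity fun x => ENNReal.ofReal (g x)) =
      ∫⁻ x, ENNReal.ofReal (f x) *
        ENNReal.ofReal (expGap (Real.log (g x) - Real.log (f x))) ∂m := by
  have : IsFiniteMeasure (m.withDensity fun x => ENNReal.ofReal (f x)) :=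
    isFiniteMeasure_withDensity hfi
  have : IsFiniteMeasure (m.withDensity fun x => ENNReal.ofReal (g x)) :=
    isFiniteMeasure_withDensity hgi
  have hac : (m.withDensity fun x => ENNReal.ofReal (f x)) ≪
      m.withDensity fun x => ENNReal.ofReal (g x) := by
    rw [← withDensity_withDensity_div m hf hg hg0]
    exact withDensity_absolutelyContinuous _ _
  have hrn : (m.withDensity fun x => ENNReal.ofReal (f x)).rnDeriv
      (m.withDensity fun x => ENNReal.ofReal (g x))
      =ᵐ[m.withDensity fun x => ENNReal.ofReal (g x)] fun x => ENNReal.ofReal (f x / g x) := by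
    rw [← withDensity_withDensity_div m hf hg hg0]
    exact Measure.rnDeriv_withDensity _ (by fun_prop)
  have hkl : Measurable fun x => ENNReal.ofReal (klFun (f x / g x)) :=
    ENNReal.measurable_ofReal.comp (measurable_klFun.comp (hf.div hg))
  rw [klDiv_eq_lintegral_klFun_of_ac hac,
    lintegral_congr_ae (g := fun x => ENNReal.ofReal (klFun (f x / g x)))
      (by
        filter_upwards [hrn] with x hx
        rw [hx, ENNReal.toReal_ofReal (div_pos (hf0 x) (hg0 x)).le]),
    lintegral_withDensity_eq_lintegral_mul _ (by fun_prop) hkl]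
  refine lintegral_congr fun x => ?_
  rw [Pi.mul_apply, ← ENNReal.ofReal_mul (hg0 x).le, ← ENNReal.ofReal_mul (hf0 x).le,
    mul_klFun_div (hf0 x) (hg0 x)]

lemma measure_setOf_le_of_lintegral_exp_le {μ : Measure α} (hf : Measurable f) {a : ℝ}
    (h : ∫⁻ x, ENNReal.ofReal (Real.exp (f x)) ∂μ ≤ ENNReal.ofReal (Real.exp a)) (b : ℝ) :
    μ {x | b ≤ f x} ≤ ENNReal.ofReal (Real.exp (a - b)) := by
  have hmarkov := meas_ge_le_lintegral_div (μ := μ)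
    (f := fun x => ENNReal.ofReal (Real.exp (f x))) (by fun_prop)
    (ENNReal.ofReal_pos.2 (Real.exp_pos b)).ne' ENNReal.ofReal_ne_top
  calc μ {x | b ≤ f x} ≤ μ {x | ENNReal.ofReal (Real.exp b) ≤ ENNReal.ofReal (Real.exp (f x))} :=
        measure_mono fun x hx => ENNReal.ofReal_le_ofReal (Real.exp_le_exp.2 hx)
    _ ≤ ENNReal.ofReal (Real.exp a) / ENNReal.ofReal (Real.exp b) :=
        hmarkov.trans (ENNReal.div_le_div_right h _)
    _ = ENNReal.ofReal (Real.exp (a - b)) := by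
        rw [← ENNReal.ofReal_div_of_pos (Real.exp_pos _), ← Real.exp_sub]

end RelativeEntropy

section ScoreStep

variable {E : Type*} [NormedAddCommGroup E] [InnerProductSpace ℝ E] [CompleteSpace E]
  {p : E → ℝ} {σ η β h : ℝ}

/-- The directional derivative of `log p` at `x` in the direction `√η g`, for `z = (x, g)`. -/
def scoreStep (p : E → ℝ) (η : ℝ) (z : E × E) : ℝ :=
  inner ℝ (√η • z.2) (gradient (fun y => Real.log (p y)) z.1)

lemma scoreStep_neg_right (x g : E) : scoreStep p η (x, -g) = -scoreStep p η (x, g) := by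
  simp [scoreStep]

/-- The set of all `z = (x, g)` for which the increments of `log p` along the segment from `x` to
`x + √η g` are controlled: `h` stands for `η / σ²`, with `σ` the scale at which `p` is smooth. -/
def goodStep (p : E → ℝ) (η h β : ℝ) : Set (E × E) :=
  {z | -β ≤ scoreStep p η z ∧ scoreStep p η (z.1 + √η • z.2, z.2) ≤ β ∧ h * ‖z.2‖ ^ 2 ≤ β}

lemma swap_mem_goodStep {z : E × E} :
    (z.1 + √η • z.2, -z.2) ∈ goodStep p η h β ↔ z ∈ goodStep p η h β := by
  simp only [goodStep, Set.mem_ofPred_eq, scoreStep_neg_right, smul_neg, add_neg_cancel_right,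
    norm_neg]
  constructor <;> rintro ⟨h1, h2, h3⟩ <;> exact ⟨by linarith, by linarith, h3⟩

lemma LogSmooth.mul_scoreStep_le (hp : LogSmooth p σ) (hσ : 0 < σ) (hh : 0 ≤ h)
    (hη : η = h * σ ^ 2) (z : E × E) (t : ℝ) :
    t * scoreStep p η z ≤
      Real.log (p (z.1 + (t * √η) • z.2)) - Real.log (p z.1) + t ^ 2 * (h * ‖z.2‖ ^ 2) / 2 := by
  have hη0 : 0 ≤ η := by rw [hη]; positivity
  have hinner : t * scoreStep p η z =
      inner ℝ ((t * √η) • z.2) (gradient (fun y => Real.log (p y)) z.1) := by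
    rw [scoreStep, mul_smul, real_inner_smul_left _ _ t]
  have hnorm : ‖(t * √η) • z.2‖ ^ 2 / (2 * σ ^ 2) = t ^ 2 * (h * ‖z.2‖ ^ 2) / 2 := by
    rw [norm_smul, mul_pow, Real.norm_eq_abs, sq_abs, mul_pow, Real.sq_sqrt hη0, hη]
    field_simp
  rw [hinner, ← hnorm]
  exact hp.inner_gradient_le _ _

lemma le_exp_mul_of_log_le {x y a : ℝ} (hx : 0 < x) (hy : 0 < y)
    (h : Real.log x ≤ a + Real.log y) : x ≤ Real.exp a * y :=
  calc x = Real.exp (Real.log x) := (Real.exp_log hx).symm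
    _ ≤ Real.exp (a + Real.log y) := Real.exp_le_exp.2 h
    _ = Real.exp a * y := by rw [Real.exp_add, Real.exp_log hy]

end ScoreStep

section StateNoise

variable {E : Type*} [NormedAddCommGroup E] [InnerProductSpace ℝ E] [FiniteDimensional ℝ E]
  [MeasurableSpace E] [BorelSpace E] {p : E → ℝ} {σ η β h : ℝ}

/-- The joint law of `(X, G)` with `X` of density `p` and an independent standard Gaussian `G`: the
state together with the noise of the next step. -/
def stateNoise (p : E → ℝ) : Measure (E × E) :=
  (volume.withDensity fun x => ENNReal.ofReal (p x)).prod (stdGaussian E)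

lemma isProbabilityMeasure_stateNoise (hp1 : ∫⁻ x, ENNReal.ofReal (p x) = 1) :
    IsProbabilityMeasure (stateNoise p) := by
  have : IsProbabilityMeasure (volume.withDensity fun x => ENNReal.ofReal (p x)) :=
    ⟨by rw [withDensity_apply _ MeasurableSet.univ, setLIntegral_univ, hp1]⟩
  unfold stateNoise
  infer_instance

lemma lintegral_stateNoise (hp : Measurable p) {F : E × E → ℝ≥0∞} (hF : Measurable F) :
    ∫⁻ z, F z ∂(stateNoise p) =
      ∫⁻ z, ENNReal.ofReal (p z.1) * F z ∂((volume : Measure E).prod (stdGaussian E)) := by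
  rw [stateNoise, lintegral_prod _ (by fun_prop), lintegral_prod _ (by fun_prop),
    lintegral_withDensity_eq_lintegral_mul _ (by fun_prop)
      (Measurable.lintegral_prod_right (by fun_prop))]
  refine lintegral_congr fun x => ?_
  exact (lintegral_const_mul _ (by fun_prop)).symm

lemma lintegral_stateNoise_snd (hp1 : ∫⁻ x, ENNReal.ofReal (p x) = 1) {f : E → ℝ≥0∞}
    (hf : Measurable f) : ∫⁻ z, f z.2 ∂(stateNoise p) = ∫⁻ g, f g ∂(stdGaussian E) := by
  rw [stateNoise, lintegral_prod_symm _ (by fun_prop)]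
  simp [hp1]

lemma lintegral_volume_prod_shift (c : ℝ) {F : E × E → ℝ≥0∞} (hF : Measurable F) :
    ∫⁻ z, F (z.1 + c • z.2, z.2) ∂((volume : Measure E).prod (stdGaussian E)) =
      ∫⁻ z, F z ∂((volume : Measure E).prod (stdGaussian E)) := by
  rw [lintegral_prod_symm _ (by fun_prop), lintegral_prod_symm _ (by fun_prop)]
  exact lintegral_congr fun g => lintegral_add_right_eq_self (fun x => F (x, g)) (c • g)

lemma lintegral_volume_prod_neg {F : E × E → ℝ≥0∞} (hF : Measurable F) :
    ∫⁻ z, F (z.1, -z.2) ∂((volume : Measure E).prod (stdGaussian E)) =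
      ∫⁻ z, F z ∂((volume : Measure E).prod (stdGaussian E)) := by
  rw [lintegral_prod _ (by fun_prop), lintegral_prod _ (by fun_prop)]
  refine lintegral_congr fun x => ?_
  conv_rhs => rw [← map_neg_stdGaussian]
  rw [lintegral_map (by fun_prop) (by fun_prop)]

lemma lintegral_volume_prod_swap (c : ℝ) {F : E × E → ℝ≥0∞} (hF : Measurable F) :
    ∫⁻ z, F (z.1 + c • z.2, -z.2) ∂((volume : Measure E).prod (stdGaussian E)) =
      ∫⁻ z, F z ∂((volume : Measure E).prod (stdGaussian E)) := by
  rw [← lintegral_volume_prod_neg hF,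
    ← lintegral_volume_prod_shift c (F := fun z => F (z.1, -z.2)) (by fun_prop)]

lemma lintegral_stateNoise_swap (hp : Measurable p) (c : ℝ) {F : E × E → ℝ≥0∞}
    (hF : Measurable F) :
    ∫⁻ z, F z ∂(stateNoise p) = ∫⁻ z, ENNReal.ofReal (p (z.1 + c • z.2)) *
      F (z.1 + c • z.2, -z.2) ∂((volume : Measure E).prod (stdGaussian E)) := by
  rw [lintegral_stateNoise hp hF,
    ← lintegral_volume_prod_swap c (F := fun z => ENNReal.ofReal (p z.1) * F z) (by fun_prop)]

lemma stateNoise_le_of_swap_mem (hp : Measurable p) {c K : ℝ} (hK : 0 ≤ K) {A A' : Set (E × E)}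
    (hA : MeasurableSet A) (hA' : MeasurableSet A')
    (hmem : ∀ z ∈ A, (z.1 + c • z.2, -z.2) ∈ A') (hle : ∀ z ∈ A, p z.1 ≤ K * p (z.1 + c • z.2)) :
    stateNoise p A ≤ ENNReal.ofReal K * stateNoise p A' := by
  rw [← lintegral_indicator_one hA, ← lintegral_indicator_const hA',
    lintegral_stateNoise hp (measurable_one.indicator hA),
    lintegral_stateNoise_swap hp c (measurable_const.indicator hA')]
  refine lintegral_mono fun z => ?_
  by_cases hz : z ∈ A
  · simp only [Set.indicator_of_mem hz, Set.indicator_of_mem (hmem z hz), Pi.one_apply, mul_one]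
    rw [mul_comm, ← ENNReal.ofReal_mul hK]
    exact ENNReal.ofReal_le_ofReal (hle z hz)
  · simp [Set.indicator_of_notMem hz]

@[fun_prop]
lemma measurable_scoreStep : Measurable (scoreStep p η) := by
  have := measurable_gradient (fun y => Real.log (p y))
  unfold scoreStep
  fun_prop

lemma measurable_scoreStep_end : Measurable fun z : E × E => scoreStep p η (z.1 + √η • z.2, z.2) :=
  measurable_scoreStep.comp (by fun_prop)

lemma measurableSet_goodStep : MeasurableSet (goodStep p η h β) :=
  (measurableSet_le measurable_const measurable_scoreStep).inter
    ((measurableSet_le measurable_scoreStep_end measurable_const).inter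
      (measurableSet_le ((measurable_snd.norm.pow_const 2).const_mul h) measurable_const))

/- Exponentiating the tangent inequality of `log p` turns the exponential moment of the score into
that of the norm of the Gaussian noise. -/
lemma lintegral_exp_scoreStep_le (hp : LogSmooth p σ) (hp1 : ∫⁻ x, ENNReal.ofReal (p x) = 1)
    (hσ : 0 < σ) (hh : 0 ≤ h) (hη : η = h * σ ^ 2) {c : ℝ} (hc : c ^ 2 * h ≤ 1 / 2) :
    ∫⁻ z, ENNReal.ofReal (Real.exp (c * scoreStep p η z)) ∂(stateNoise p) ≤
      ENNReal.ofReal (Real.exp (c ^ 2 * h * Module.finrank ℝ E)) := by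
  have hpm : Measurable p := hp.diff.continuous.measurable
  have htangent (z : E × E) : p z.1 * Real.exp (c * scoreStep p η z) ≤
      p (z.1 + (c * √η) • z.2) * Real.exp (c ^ 2 * h * ‖z.2‖ ^ 2 / 2) := by
    rw [← Real.exp_log (hp.pos z.1), ← Real.exp_log (hp.pos (z.1 + (c * √η) • z.2)),
      ← Real.exp_add, ← Real.exp_add, Real.exp_le_exp]
    linarith [hp.mul_scoreStep_le hσ hh hη z c]
  calc ∫⁻ z, ENNReal.ofReal (Real.exp (c * scoreStep p η z)) ∂(stateNoise p)
      ≤ ∫⁻ z, ENNReal.ofReal (p (z.1 + (c * √η) • z.2)) *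
          ENNReal.ofReal (Real.exp (c ^ 2 * h * ‖z.2‖ ^ 2 / 2))
          ∂((volume : Measure E).prod (stdGaussian E)) := by
        rw [lintegral_stateNoise hpm (by fun_prop)]
        refine lintegral_mono fun z => ?_
        rw [← ENNReal.ofReal_mul (hp.pos _).le, ← ENNReal.ofReal_mul (hp.pos _).le]
        exact ENNReal.ofReal_le_ofReal (htangent z)
    _ = ∫⁻ g, ENNReal.ofReal (Real.exp (c ^ 2 * h * ‖g‖ ^ 2 / 2)) ∂(stdGaussian E) := by
        rw [lintegral_volume_prod_shift (c * √η) (F := fun z => ENNReal.ofReal (p z.1) *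
            ENNReal.ofReal (Real.exp (c ^ 2 * h * ‖z.2‖ ^ 2 / 2))) (by fun_prop),
          ← lintegral_stateNoise hpm (by fun_prop), lintegral_stateNoise_snd hp1
            (f := fun g => ENNReal.ofReal (Real.exp (c ^ 2 * h * ‖g‖ ^ 2 / 2))) (by fun_prop)]
    _ ≤ ENNReal.ofReal (Real.exp (c ^ 2 * h * Module.finrank ℝ E)) :=
        lintegral_exp_sq_norm_stdGaussian_le (by positivity) hc

lemma measure_scoreStep_lt_le (hp : LogSmooth p σ) (hp1 : ∫⁻ x, ENNReal.ofReal (p x) = 1)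
    (hσ : 0 < σ) (hh : 0 ≤ h) (hη : η = h * σ ^ 2) {c : ℝ} (hc0 : 0 < c)
    (hc : c ^ 2 * h ≤ 1 / 2) :
    stateNoise p {z | scoreStep p η z < -β} ≤
      ENNReal.ofReal (Real.exp (c ^ 2 * h * Module.finrank ℝ E - c * β)) := by
  have hexp := lintegral_exp_scoreStep_le hp hp1 hσ hh hη (c := -c) (by rwa [neg_sq])
  rw [neg_sq] at hexp
  refine (measure_mono fun z (hz : scoreStep p η z < -β) => ?_).trans
    (measure_setOf_le_of_lintegral_exp_le (by fun_prop) hexp (c * β))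
  rw [Set.mem_ofPred_eq]
  nlinarith

lemma measure_norm_sq_gt_le (hp1 : ∫⁻ x, ENNReal.ofReal (p x) = 1) (hh : 0 < h) :
    stateNoise p {z : E × E | β < h * ‖z.2‖ ^ 2} ≤
      ENNReal.ofReal (Real.exp (Module.finrank ℝ E / 2 - β / (4 * h))) := by
  have hexp : ∫⁻ z : E × E, ENNReal.ofReal (Real.exp (1 / 2 * ‖z.2‖ ^ 2 / 2)) ∂(stateNoise p) ≤
      ENNReal.ofReal (Real.exp (Module.finrank ℝ E / 2)) := by
    rw [lintegral_stateNoise_snd hp1 (f := fun g =>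
      ENNReal.ofReal (Real.exp (1 / 2 * ‖g‖ ^ 2 / 2))) (by fun_prop),
      show (Module.finrank ℝ E / 2 : ℝ) = 1 / 2 * Module.finrank ℝ E by ring]
    exact lintegral_exp_sq_norm_stdGaussian_le (by norm_num) le_rfl
  refine (measure_mono fun (z : E × E) (hz : β < h * ‖z.2‖ ^ 2) => ?_).trans
    (measure_setOf_le_of_lintegral_exp_le (by fun_prop) hexp (β / (4 * h)))
  rw [Set.mem_ofPred_eq, div_le_iff₀ (by positivity)]
  linarith

lemma measure_scoreStep_end_gt_le (hp : LogSmooth p σ) (hσ : 0 < σ) (hh : 0 ≤ h)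
    (hη : η = h * σ ^ 2) :
    stateNoise p {z | -β ≤ scoreStep p η z ∧ β < scoreStep p η (z.1 + √η • z.2, z.2) ∧
        h * ‖z.2‖ ^ 2 ≤ β} ≤
      ENNReal.ofReal (Real.exp (β + β / 2)) * stateNoise p {z | scoreStep p η z < -β} := by
  refine stateNoise_le_of_swap_mem (c := √η) hp.diff.continuous.measurable (Real.exp_pos _).le
    ((measurableSet_le measurable_const measurable_scoreStep).inter
      ((measurableSet_lt measurable_const measurable_scoreStep_end).inter
        (measurableSet_le ((measurable_snd.norm.pow_const 2).const_mul h) measurable_const)))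
    (measurableSet_lt measurable_scoreStep measurable_const) ?_ ?_
  · rintro z ⟨-, hz, -⟩
    rw [Set.mem_ofPred_eq, scoreStep_neg_right]
    linarith
  · rintro z ⟨hstart, -, hnorm⟩
    have h1 := hp.mul_scoreStep_le hσ hh hη z 1
    rw [one_mul, one_mul, one_pow, one_mul] at h1
    exact le_exp_mul_of_log_le (hp.pos _) (hp.pos _) (by linarith)

lemma measure_compl_goodStep_le (hp : LogSmooth p σ) (hp1 : ∫⁻ x, ENNReal.ofReal (p x) = 1)
    (hσ : 0 < σ) (hh : 0 < h) (hη : η = h * σ ^ 2) (hβ : 0 ≤ β) {c : ℝ}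
    (hc0 : 0 < c) (hc : c ^ 2 * h ≤ 1 / 2) :
    stateNoise p (goodStep p η h β)ᶜ ≤
      ENNReal.ofReal ((1 + Real.exp (2 * β)) *
          Real.exp (c ^ 2 * h * Module.finrank ℝ E - c * β) +
        Real.exp (Module.finrank ℝ E / 2 - β / (4 * h))) := by
  have hsub : (goodStep p η h β)ᶜ ⊆ ({z | scoreStep p η z < -β} ∪
      {z | -β ≤ scoreStep p η z ∧ β < scoreStep p η (z.1 + √η • z.2, z.2) ∧ h * ‖z.2‖ ^ 2 ≤ β}) ∪
      {z | β < h * ‖z.2‖ ^ 2} := by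
    intro z hz
    simp only [goodStep, Set.mem_compl_iff, Set.mem_ofPred_eq, Set.mem_union] at hz ⊢
    grind
  have hstart := measure_scoreStep_lt_le (β := β) hp hp1 hσ hh.le hη hc0 hc
  have hend := measure_scoreStep_end_gt_le (β := β) hp hσ hh.le hη
  have hnorm := measure_norm_sq_gt_le (β := β) hp1 hh
  refine (measure_mono hsub).trans ((measure_union_le _ _).trans
    ((add_le_add (measure_union_le _ _) hnorm).trans ?_))
  rw [ENNReal.ofReal_add (by positivity) (by positivity), ENNReal.ofReal_mul (by positivity),
    ENNReal.ofReal_add zero_le_one (by positivity), ENNReal.ofReal_one, add_mul, one_mul]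
  gcongr
  refine hend.trans ?_
  gcongr
  linarith

lemma setLIntegral_swap_ratio (hp : Measurable p) (hp0 : ∀ x, 0 < p x) (c : ℝ) {A : Set (E × E)}
    (hA : MeasurableSet A) (hswap : ∀ z, (z.1 + c • z.2, -z.2) ∈ A ↔ z ∈ A) :
    ∫⁻ z in A, ENNReal.ofReal (p (z.1 + c • z.2) / p z.1) ∂(stateNoise p) = stateNoise p A := by
  rw [← lintegral_indicator_one hA, lintegral_stateNoise_swap hp c (measurable_one.indicator hA),
    ← lintegral_indicator hA, lintegral_stateNoise hp (Measurable.indicator (by fun_prop) hA)]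
  refine lintegral_congr fun z => ?_
  by_cases hz : z ∈ A
  · rw [Set.indicator_of_mem hz, Set.indicator_of_mem ((hswap z).2 hz),
      ← ENNReal.ofReal_mul (hp0 _).le, mul_div_cancel₀ _ (hp0 _).ne', Pi.one_apply, mul_one]
  · rw [Set.indicator_of_notMem hz, Set.indicator_of_notMem (mt (hswap z).1 hz), mul_zero,
      mul_zero]

end StateNoise

section Clip

variable {d : ℕ} {B : ℝ} {s : Euc d → Euc d}

lemma abs_clip_le (hB : 0 ≤ B) (x : ℝ) : |clip B x| ≤ B :=
  abs_le.2 ⟨le_max_left _ _, max_le (by linarith) (min_le_left _ _)⟩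

lemma clip_of_abs_le {x : ℝ} (hx : |x| ≤ B) : clip B x = x := by
  rw [clip, min_eq_right (abs_le.1 hx).2, max_eq_right (abs_le.1 hx).1]

lemma abs_clip_sub_clip_le (B x y : ℝ) : |clip B x - clip B y| ≤ |x - y| :=
  calc |clip B x - clip B y| ≤ |min B x - min B y| := by
        simpa [clip] using abs_max_sub_max_le_max (-B) (min B x) (-B) (min B y)
    _ ≤ |x - y| := by simpa using abs_min_sub_min_le_max B x B y

@[fun_prop]
lemma measurable_clip : Measurable (clip B) := by unfold clip; fun_prop

lemma measurable_stepEst (hs : Measurable s) :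
    Measurable fun y : (Euc d × Euc d) × unitInterval => stepEst B s y.1.1 y.1.2 y.2 := by
  unfold stepEst
  fun_prop

end Clip

section StepAlong

variable {E : Type*} [NormedAddCommGroup E] [InnerProductSpace ℝ E]
  {p : E → ℝ} {s : E → E} {σ η β h t : ℝ} {z : E × E}

/-- The pair `z = (x, g)` with its state moved to the point `x + t √η g` of the segment which is
traversed by the step. -/
def alongStep (η t : ℝ) (z : E × E) : E × E := (z.1 + (t * √η) • z.2, z.2)

lemma LogSmooth.abs_scoreStep_alongStep_le [CompleteSpace E] (hp : LogSmooth p σ) (hσ : 0 < σ)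
    (hh : 0 ≤ h) (hη : η = h * σ ^ 2) (hz : z ∈ goodStep p η h β) (ht0 : 0 ≤ t) (ht1 : t ≤ 1) :
    |scoreStep p η (alongStep η t z)| ≤ 2 * β := by
  obtain ⟨hstart, hend, hnorm⟩ := hz
  have hη0 : 0 ≤ η := by rw [hη]; positivity
  have hstep : ‖√η • z.2‖ ^ 2 / σ ^ 2 = h * ‖z.2‖ ^ 2 := by
    rw [norm_smul, mul_pow, Real.norm_eq_abs, sq_abs, Real.sq_sqrt hη0, hη]
    field_simp
  have hfrom := hp.inner_gradient_mono hσ z.1 (√η • z.2) ht0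
  have hto := hp.inner_gradient_mono hσ z.1 (√η • z.2) ht1
  rw [hstep, zero_smul, add_zero] at hfrom
  rw [hstep, one_smul] at hto
  simp only [scoreStep, alongStep, mul_smul] at hstart hend ⊢
  have hnonneg : 0 ≤ h * ‖z.2‖ ^ 2 := by positivity
  rw [abs_le]
  constructor <;> nlinarith

lemma LogSmooth.le_exp_mul_alongStep [CompleteSpace E] (hp : LogSmooth p σ) (hσ : 0 < σ)
    (hh : 0 ≤ h) (hη : η = h * σ ^ 2) (hz : z ∈ goodStep p η h β) (ht0 : 0 ≤ t) (ht1 : t ≤ 1) :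
    p z.1 ≤ Real.exp (2 * β) * p (alongStep η t z).1 := by
  obtain ⟨hstart, -, hnorm⟩ := hz
  have htangent := hp.mul_scoreStep_le hσ hh hη z t
  have hnonneg : 0 ≤ h * ‖z.2‖ ^ 2 := by positivity
  have hsq : t ^ 2 * (h * ‖z.2‖ ^ 2) ≤ h * ‖z.2‖ ^ 2 :=
    mul_le_of_le_one_left hnonneg (pow_le_one₀ ht0 ht1)
  refine le_exp_mul_of_log_le (hp.pos _) (hp.pos _) ?_
  change Real.log (p z.1) ≤ 2 * β + Real.log (p (z.1 + (t * √η) • z.2))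
  nlinarith

lemma integral_unitInterval (f : ℝ → ℝ) : ∫ r : unitInterval, f r = ∫ t in (0 : ℝ)..1, f t := by
  rw [intervalIntegral.integral_of_le zero_le_one, ← integral_Icc_eq_integral_Ioc]
  exact integral_subtype_comap measurableSet_Icc f

lemma LogSmooth.log_sub_log_eq_integral_scoreStep [CompleteSpace E] (hp : LogSmooth p σ)
    (hσ : 0 < σ) (z : E × E) :
    Real.log (p (z.1 + √η • z.2)) - Real.log (p z.1) =
      ∫ r : unitInterval, scoreStep p η (alongStep η (1 - (r : ℝ)) z) := by
  rw [integral_unitInterval (fun t => scoreStep p η (alongStep η (1 - t) z)),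
    intervalIntegral.integral_comp_sub_left (fun t => scoreStep p η (alongStep η t z)),
    sub_self, sub_zero, hp.log_sub_log_eq_integral hσ]
  simp only [scoreStep, alongStep, mul_smul]

/-- The error of the score estimate `s` at `x` in the direction `√η g`, for `z = (x, g)`. -/
def stepError [CompleteSpace E] (s : E → E) (p : E → ℝ) (η : ℝ) (z : E × E) : ℝ :=
  inner ℝ (√η • z.2) (s z.1 - gradient (fun y => Real.log (p y)) z.1)

variable [FiniteDimensional ℝ E] [MeasurableSpace E] [BorelSpace E]

@[fun_prop]
lemma measurable_stepError (hs : Measurable s) : Measurable (stepError s p η) := by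
  have := measurable_gradient (fun y => Real.log (p y))
  unfold stepError
  fun_prop

lemma lintegral_sq_stepError (hs : Measurable s) (hp : Measurable p) (hη : 0 ≤ η) :
    ∫⁻ z, ENNReal.ofReal (p z.1) * ENNReal.ofReal (stepError s p η z ^ 2)
        ∂((volume : Measure E).prod (stdGaussian E)) =
      ENNReal.ofReal η *
        ∫⁻ x, ENNReal.ofReal (p x) * ‖s x - gradient (fun y => Real.log (p y)) x‖ₑ ^ 2 := by
  have hgrad := measurable_gradient (fun y => Real.log (p y))
  have hscale (x g : E) : ENNReal.ofReal (stepError s p η (x, g) ^ 2) = ENNReal.ofReal η *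
      ENNReal.ofReal ((inner ℝ g (s x - gradient (fun y => Real.log (p y)) x) : ℝ) ^ 2) := by
    rw [stepError, real_inner_smul_left, mul_pow, Real.sq_sqrt hη, ENNReal.ofReal_mul hη]
  rw [lintegral_prod _ (by fun_prop), ← lintegral_const_mul _ (by fun_prop)]
  refine lintegral_congr fun x => ?_
  simp only [hscale]
  rw [lintegral_const_mul _ (by fun_prop), lintegral_const_mul _ (by fun_prop),
    lintegral_inner_sq_stdGaussian, mul_left_comm]

end StepAlong

section StepError

variable {d : ℕ} {p : Euc d → ℝ} {σ η B h τ Pb : ℝ} {s : Euc d → Euc d}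

/-- The logarithmic weight of the proposal with seed `z.2` from the state `z.1`. -/
def stepWeight {d : ℕ} (B : ℝ) (s : Euc d → Euc d) (η : ℝ) (z : Euc d × Euc d) : ℝ :=
  meanEst (stepPropose η z.1) (stepEst B s z.1) z.2

@[fun_prop]
lemma measurable_stepWeight (hs : Measurable s) : Measurable (stepWeight B s η) := by
  have hpair : Measurable fun y : (Euc d × Euc d) × unitInterval =>
      ((y.1.1, stepPropose η y.1.1 y.1.2), y.2) := by
    unfold stepPropose
    fun_prop
  have hest : StronglyMeasurable fun y : (Euc d × Euc d) × unitInterval =>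
      stepEst B s y.1.1 (stepPropose η y.1.1 y.1.2) y.2 :=
    ((measurable_stepEst hs).comp hpair).stronglyMeasurable
  exact hest.integral_prod_right.measurable

lemma abs_stepWeight_le (hB : 0 ≤ B) (z : Euc d × Euc d) : |stepWeight B s η z| ≤ B :=
  abs_meanEst_le (fun _ _ => abs_clip_le hB _) _

/-- The difference of the logarithmic weights of the sampler and of the exact reverse process, in
terms of the forward step `z`: the reverse step starts at `z.1 + √η z.2` with seed `-z.2`. -/
def weightGap {d : ℕ} (B : ℝ) (s : Euc d → Euc d) (p : Euc d → ℝ) (η : ℝ) (z : Euc d × Euc d) :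
    ℝ :=
  stepWeight B s η (z.1 + √η • z.2, -z.2) + Real.log (p (z.1 + √η • z.2)) - Real.log (p z.1)

@[fun_prop]
lemma measurable_weightGap (hs : Measurable s) (hp : Measurable p) :
    Measurable (weightGap B s p η) := by
  unfold weightGap
  fun_prop

lemma ofReal_sq_integral_le {α : Type*} [MeasurableSpace α] {μ : Measure α}
    [IsProbabilityMeasure μ] {f : α → ℝ} (hf : MemLp f 2 μ) :
    ENNReal.ofReal ((∫ x, f x ∂μ) ^ 2) ≤ ∫⁻ x, ENNReal.ofReal (f x ^ 2) ∂μ := by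
  rw [← ofReal_integral_eq_lintegral_ofReal hf.integrable_sq (ae_of_all _ fun x => sq_nonneg _)]
  have hvar := variance_eq_sub hf
  simp only [Pi.pow_apply] at hvar
  exact ENNReal.ofReal_le_ofReal (by linarith [variance_nonneg f μ])

/-- The contribution of the seed `r` to `weightGap`. -/
def weightGapAt {d : ℕ} (B : ℝ) (s : Euc d → Euc d) (p : Euc d → ℝ) (η : ℝ) (z : Euc d × Euc d)
    (r : unitInterval) : ℝ :=
  clip B (inner ℝ (-(√η • z.2)) (s (alongStep η (1 - (r : ℝ)) z).1)) +
    scoreStep p η (alongStep η (1 - (r : ℝ)) z)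

lemma measurable_alongStep_unitInterval (z : Euc d × Euc d) :
    Measurable fun r : unitInterval => alongStep η (1 - (r : ℝ)) z := by
  unfold alongStep
  fun_prop

lemma measurable_weightGapAt (hs : Measurable s) (z : Euc d × Euc d) :
    Measurable (weightGapAt B s p η z) := by
  have := measurable_alongStep_unitInterval (η := η) z
  unfold weightGapAt
  fun_prop

lemma stepWeight_swap (z : Euc d × Euc d) :
    stepWeight B s η (z.1 + √η • z.2, -z.2) =
      ∫ r : unitInterval, clip B (inner ℝ (-(√η • z.2)) (s (alongStep η (1 - (r : ℝ)) z).1)) := by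
  refine integral_congr_ae (ae_of_all _ fun r => ?_)
  simp only [stepPropose, stepEst, alongStep, smul_neg, add_neg_cancel_right, sub_add_cancel_left]
  congr 3
  module

section GoodStep

variable (hp : LogSmooth p σ) (hσ : 0 < σ) (hh : 0 ≤ h) (hη : η = h * σ ^ 2) (hB : 0 ≤ B)
  {z : Euc d × Euc d} (hz : z ∈ goodStep p η h (B / 2))

include hp hσ hh hη hz

lemma abs_scoreStep_le_of_mem_goodStep (r : unitInterval) :
    |scoreStep p η (alongStep η (1 - (r : ℝ)) z)| ≤ B :=
  (hp.abs_scoreStep_alongStep_le hσ hh hη hz (by linarith [r.2.2]) (by linarith [r.2.1])).trans_eq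
    (mul_div_cancel₀ B two_ne_zero)

lemma abs_weightGapAt_le_abs_stepError (r : unitInterval) :
    |weightGapAt B s p η z r| ≤ |stepError s p η (alongStep η (1 - (r : ℝ)) z)| := by
  set y := alongStep η (1 - (r : ℝ)) z with hy
  have hclip : clip B (-scoreStep p η y) = -scoreStep p η y := clip_of_abs_le (by
    rw [abs_neg]; exact abs_scoreStep_le_of_mem_goodStep hp hσ hh hη hz r)
  have hdir : inner ℝ (-(√η • z.2)) (s y.1) + scoreStep p η y = -stepError s p η y := by
    rw [stepError, scoreStep, inner_sub_right, inner_neg_left, hy, alongStep]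
    ring
  calc |weightGapAt B s p η z r|
      = |clip B (inner ℝ (-(√η • z.2)) (s y.1)) - clip B (-scoreStep p η y)| := by
        rw [hclip, sub_neg_eq_add, weightGapAt]
    _ ≤ |inner ℝ (-(√η • z.2)) (s y.1) - -scoreStep p η y| := abs_clip_sub_clip_le _ _ _
    _ = |stepError s p η y| := by rw [sub_neg_eq_add, hdir, abs_neg]

include hB

lemma abs_weightGapAt_le (r : unitInterval) : |weightGapAt B s p η z r| ≤ 2 * B :=
  (abs_add_le _ _).trans (by
    linarith [abs_scoreStep_le_of_mem_goodStep hp hσ hh hη hz r, abs_clip_le hB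
      (inner ℝ (-(√η • z.2)) (s (alongStep η (1 - (r : ℝ)) z).1))])

lemma weightGap_eq_integral (hs : Measurable s) :
    weightGap B s p η z = ∫ r, weightGapAt B s p η z r := by
  have halong := measurable_alongStep_unitInterval (η := η) z
  unfold weightGapAt
  rw [integral_add
    (Integrable.of_bound (Measurable.aestronglyMeasurable (by fun_prop)) B
      (ae_of_all _ fun r => abs_clip_le hB _))
    (Integrable.of_bound (Measurable.aestronglyMeasurable (by fun_prop)) B
      (ae_of_all _ (abs_scoreStep_le_of_mem_goodStep hp hσ hh hη hz))),
    ← stepWeight_swap, ← hp.log_sub_log_eq_integral_scoreStep hσ, weightGap, add_sub_assoc]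

lemma expGap_weightGap_le_lintegral (hs : Measurable s) :
    ENNReal.ofReal (expGap (weightGap B s p η z)) ≤ ENNReal.ofReal (Real.exp (2 * B)) *
      ∫⁻ r : unitInterval, ENNReal.ofReal (stepError s p η (alongStep η (1 - (r : ℝ)) z) ^ 2) := by
  have hbound := abs_weightGapAt_le (s := s) hp hσ hh hη hB hz
  have hgap := weightGap_eq_integral hp hσ hh hη hB hz hs
  have hgap_le : |weightGap B s p η z| ≤ 2 * B := by
    simpa [hgap] using norm_integral_le_of_norm_le_const
      (μ := (volume : Measure unitInterval)) (f := weightGapAt B s p η z) (ae_of_all _ hbound)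
  have hmemLp : MemLp (weightGapAt B s p η z) 2 volume :=
    MemLp.of_bound (measurable_weightGapAt hs z).aestronglyMeasurable (2 * B) (ae_of_all _ hbound)
  calc ENNReal.ofReal (expGap (weightGap B s p η z))
      ≤ ENNReal.ofReal (Real.exp (2 * B)) * ENNReal.ofReal (weightGap B s p η z ^ 2) := by
        rw [← ENNReal.ofReal_mul (Real.exp_pos _).le]
        exact ENNReal.ofReal_le_ofReal (expGap_le_sq hgap_le)
    _ ≤ ENNReal.ofReal (Real.exp (2 * B)) *
        ∫⁻ r, ENNReal.ofReal (weightGapAt B s p η z r ^ 2) := by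
        rw [hgap]
        gcongr
        exact ofReal_sq_integral_le hmemLp
    _ ≤ _ := by
        exact mul_le_mul_right (lintegral_mono fun r => ENNReal.ofReal_le_ofReal
          (sq_le_sq.2 (abs_weightGapAt_le_abs_stepError hp hσ hh hη hz r))) _

lemma expGap_weightGap_le_of_mem_goodStep (hs : Measurable s) :
    ENNReal.ofReal (p z.1) * ENNReal.ofReal (expGap (weightGap B s p η z)) ≤
      ENNReal.ofReal (Real.exp (3 * B)) * ∫⁻ r : unitInterval,
        ENNReal.ofReal (p (alongStep η (1 - (r : ℝ)) z).1) *
          ENNReal.ofReal (stepError s p η (alongStep η (1 - (r : ℝ)) z) ^ 2) := by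
  have halong := measurable_alongStep_unitInterval (η := η) z
  have hpm : Measurable p := hp.diff.continuous.measurable
  have hdensity (r : unitInterval) : ENNReal.ofReal (p z.1) ≤
      ENNReal.ofReal (Real.exp B) * ENNReal.ofReal (p (alongStep η (1 - (r : ℝ)) z).1) := by
    rw [← ENNReal.ofReal_mul (Real.exp_pos _).le]
    refine ENNReal.ofReal_le_ofReal ((hp.le_exp_mul_alongStep hσ hh hη hz (t := 1 - (r : ℝ))
      (by linarith [r.2.2]) (by linarith [r.2.1])).trans_eq ?_)
    rw [mul_div_cancel₀ B two_ne_zero]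
  refine (mul_le_mul_right (expGap_weightGap_le_lintegral hp hσ hh hη hB hz hs) _).trans ?_
  rw [show 3 * B = 2 * B + B by ring, Real.exp_add, ENNReal.ofReal_mul (Real.exp_pos _).le,
    mul_left_comm, mul_assoc]
  refine mul_le_mul_right ?_ _
  rw [← lintegral_const_mul _ (by fun_prop), ← lintegral_const_mul _ (by fun_prop)]
  refine lintegral_mono fun r => ?_
  rw [← mul_assoc]
  exact mul_le_mul_left (hdensity r) _

end GoodStep

lemma lintegral_goodStep_le (hp : LogSmooth p σ) (hs : Measurable s) (hσ : 0 < σ) (hB : 0 ≤ B)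
    (hh : 0 ≤ h) (hη : η = h * σ ^ 2) :
    ∫⁻ z in goodStep p η h (B / 2), ENNReal.ofReal (expGap (weightGap B s p η z)) ∂(stateNoise p) ≤
      ENNReal.ofReal (Real.exp (3 * B)) * (ENNReal.ofReal η *
        ∫⁻ x, ENNReal.ofReal (p x) * ‖s x - gradient (fun y => Real.log (p y)) x‖ₑ ^ 2) := by
  have hpm : Measurable p := hp.diff.continuous.measurable
  have hη0 : 0 ≤ η := by rw [hη]; positivity
  have hG := measurableSet_goodStep (p := p) (η := η) (h := h) (β := B / 2)
  set error : Euc d × Euc d → ℝ≥0∞ := fun z =>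
    ENNReal.ofReal (p z.1) * ENNReal.ofReal (stepError s p η z ^ 2)
  have herrorm : Measurable error := by fun_prop
  have herror_along : Measurable fun y : (Euc d × Euc d) × unitInterval =>
      error (alongStep η (1 - (y.2 : ℝ)) y.1) := by
    unfold alongStep
    fun_prop
  rw [← lintegral_indicator hG, lintegral_stateNoise hpm (Measurable.indicator (by fun_prop) hG),
    ← lintegral_sq_stepError hs hpm hη0]
  calc ∫⁻ z, ENNReal.ofReal (p z.1) * (goodStep p η h (B / 2)).indicator
          (fun z => ENNReal.ofReal (expGap (weightGap B s p η z))) z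
          ∂((volume : Measure (Euc d)).prod (stdGaussian (Euc d)))
      ≤ ∫⁻ z, ENNReal.ofReal (Real.exp (3 * B)) *
          (∫⁻ r : unitInterval, error (alongStep η (1 - (r : ℝ)) z))
          ∂((volume : Measure (Euc d)).prod (stdGaussian (Euc d))) := by
        refine lintegral_mono fun z => ?_
        by_cases hz : z ∈ goodStep p η h (B / 2)
        · rw [Set.indicator_of_mem hz]
          exact expGap_weightGap_le_of_mem_goodStep hp hσ hh hη hB hz hs
        · rw [Set.indicator_of_notMem hz, mul_zero]
          exact zero_le
    _ = ENNReal.ofReal (Real.exp (3 * B)) * ∫⁻ r : unitInterval,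
          (∫⁻ z, error (alongStep η (1 - (r : ℝ)) z)
            ∂((volume : Measure (Euc d)).prod (stdGaussian (Euc d)))) := by
        rw [lintegral_const_mul _ (Measurable.lintegral_prod_right herror_along),
          lintegral_lintegral_swap herror_along.aemeasurable]
    _ = ENNReal.ofReal (Real.exp (3 * B)) *
          ∫⁻ z, error z ∂((volume : Measure (Euc d)).prod (stdGaussian (Euc d))) := by
        simp [alongStep, lintegral_volume_prod_shift _ herrorm]

/-- An upper bound for `-weightGap` which has all exponential moments of order at most `1`. -/
def weightGapBound {d : ℕ} (B : ℝ) (p : Euc d → ℝ) (η h : ℝ) (z : Euc d × Euc d) : ℝ :=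
  B + |scoreStep p η z| + h * ‖z.2‖ ^ 2 / 2

@[fun_prop]
lemma measurable_weightGapBound : Measurable (weightGapBound B p η h) := by
  have := (measurable_scoreStep (p := p) (η := η)).abs
  unfold weightGapBound
  fun_prop

lemma weightGapBound_nonneg (hB : 0 ≤ B) (hh : 0 ≤ h) (z : Euc d × Euc d) :
    0 ≤ weightGapBound B p η h z := by
  unfold weightGapBound; positivity

lemma neg_weightGap_le (hp : LogSmooth p σ) (hσ : 0 < σ) (hB : 0 ≤ B) (hh : 0 ≤ h)
    (hη : η = h * σ ^ 2) (z : Euc d × Euc d) :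
    -weightGap B s p η z ≤ weightGapBound B p η h z := by
  have htangent := hp.mul_scoreStep_le hσ hh hη z 1
  rw [one_mul, one_mul, one_pow, one_mul] at htangent
  have hweight := (abs_le.1 (abs_stepWeight_le (s := s) (η := η) hB (z.1 + √η • z.2, -z.2))).1
  unfold weightGap weightGapBound
  linarith [neg_le_abs (scoreStep p η z)]

lemma expGap_le_exp_add (u : ℝ) : expGap u ≤ Real.exp u + max (-u) 0 := by
  unfold expGap
  linarith [le_max_left (-u) 0]

lemma le_mul_sq_add_one_div (hτ : 0 < τ) (x : ℝ) : x ≤ τ * x ^ 2 + 1 / τ := by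
  have hsq : τ * x ^ 2 + 1 / τ - x = ((2 * τ * x - 1) ^ 2 + 3) / (4 * τ) := by
    field_simp
    ring
  rw [← sub_nonneg, hsq]
  positivity

lemma exp_weightGap_le (hp : ∀ x, 0 < p x) (hB : 0 ≤ B) (z : Euc d × Euc d) :
    Real.exp (weightGap B s p η z) ≤ Real.exp B * (p (z.1 + √η • z.2) / p z.1) := by
  rw [weightGap, add_sub_assoc, Real.exp_add, Real.exp_sub, Real.exp_log (hp _),
    Real.exp_log (hp _)]
  gcongr
  · exact div_nonneg (hp _).le (hp _).le
  · exact (abs_le.1 (abs_stepWeight_le hB _)).2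

lemma expGap_weightGap_le (hp : LogSmooth p σ) (hσ : 0 < σ) (hB : 0 ≤ B) (hh : 0 ≤ h)
    (hη : η = h * σ ^ 2) (hτ : 0 < τ) (z : Euc d × Euc d) :
    ENNReal.ofReal (expGap (weightGap B s p η z)) ≤
      ENNReal.ofReal (Real.exp B) * ENNReal.ofReal (p (z.1 + √η • z.2) / p z.1) +
        (ENNReal.ofReal τ * ENNReal.ofReal (weightGapBound B p η h z ^ 2) +
          ENNReal.ofReal (1 / τ)) := by
  have hratio : 0 ≤ p (z.1 + √η • z.2) / p z.1 := div_nonneg (hp.pos _).le (hp.pos _).le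
  rw [← ENNReal.ofReal_mul (Real.exp_pos _).le, ← ENNReal.ofReal_mul hτ.le,
    ← ENNReal.ofReal_add (by positivity) (by positivity),
    ← ENNReal.ofReal_add (by positivity) (by positivity)]
  refine ENNReal.ofReal_le_ofReal ((expGap_le_exp_add _).trans
    (add_le_add (exp_weightGap_le hp.pos hB z) ?_))
  exact (max_le (neg_weightGap_le hp hσ hB hh hη z) (weightGapBound_nonneg hB hh z)).trans
    (le_mul_sq_add_one_div hτ _)

lemma sq_le_two_mul_exp {x : ℝ} (hx : 0 ≤ x) : x ^ 2 ≤ 2 * Real.exp x := by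
  nlinarith [Real.quadratic_le_exp_of_nonneg hx]

lemma exp_abs_le_exp_add_exp_neg (x : ℝ) : Real.exp |x| ≤ Real.exp x + Real.exp (-x) := by
  rcases abs_choice x with h | h <;> rw [h] <;> linarith [Real.exp_pos x, Real.exp_pos (-x)]

lemma sq_weightGapBound_le (hh : 0 ≤ h) (z : Euc d × Euc d) :
    weightGapBound B p η h z ^ 2 ≤ 6 * (B ^ 2 + (Real.exp (1 * scoreStep p η z) +
      Real.exp (-1 * scoreStep p η z) + Real.exp (h * ‖z.2‖ ^ 2 / 2))) := by
  have hscore := sq_le_two_mul_exp (abs_nonneg (scoreStep p η z))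
  have hnorm := sq_le_two_mul_exp (show 0 ≤ h * ‖z.2‖ ^ 2 / 2 by positivity)
  have hexp := exp_abs_le_exp_add_exp_neg (scoreStep p η z)
  rw [weightGapBound, one_mul, neg_one_mul]
  set a := |scoreStep p η z|
  set b := h * ‖z.2‖ ^ 2 / 2
  nlinarith [sq_nonneg (B - a), sq_nonneg (B - b), sq_nonneg (a - b), sq_nonneg B]

lemma lintegral_sq_weightGapBound_le (hp : LogSmooth p σ)
    (hp1 : ∫⁻ x, ENNReal.ofReal (p x) = 1) (hσ : 0 < σ) (hh : 0 ≤ h) (hη : η = h * σ ^ 2)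
    (hh2 : h ≤ 1 / 2) (hhd : h * d ≤ 1) :
    ∫⁻ z, ENNReal.ofReal (weightGapBound B p η h z ^ 2) ∂(stateNoise p) ≤
      ENNReal.ofReal (6 * (B ^ 2 + 3 * Real.exp 1)) := by
  have := isProbabilityMeasure_stateNoise hp1
  have hexp : ENNReal.ofReal (Real.exp (h * Module.finrank ℝ (Euc d))) ≤
      ENNReal.ofReal (Real.exp 1) :=
    ENNReal.ofReal_le_ofReal (Real.exp_le_exp.2 (by rwa [finrank_euclideanSpace_fin]))
  have hpos := lintegral_exp_scoreStep_le hp hp1 hσ hh hη (c := 1) (by linarith)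
  have hneg := lintegral_exp_scoreStep_le hp hp1 hσ hh hη (c := -1) (by linarith)
  rw [one_pow, one_mul] at hpos
  rw [neg_one_sq, one_mul] at hneg
  have hnorm : ∫⁻ z : Euc d × Euc d, ENNReal.ofReal (Real.exp (h * ‖z.2‖ ^ 2 / 2))
      ∂(stateNoise p) ≤ ENNReal.ofReal (Real.exp (h * Module.finrank ℝ (Euc d))) := by
    rw [lintegral_stateNoise_snd hp1
      (f := fun g => ENNReal.ofReal (Real.exp (h * ‖g‖ ^ 2 / 2))) (by fun_prop)]
    exact lintegral_exp_sq_norm_stdGaussian_le hh hh2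
  calc ∫⁻ z, ENNReal.ofReal (weightGapBound B p η h z ^ 2) ∂(stateNoise p)
      ≤ ∫⁻ z, ENNReal.ofReal 6 * (ENNReal.ofReal (B ^ 2) +
          (ENNReal.ofReal (Real.exp (1 * scoreStep p η z)) +
            ENNReal.ofReal (Real.exp (-1 * scoreStep p η z)) +
            ENNReal.ofReal (Real.exp (h * ‖z.2‖ ^ 2 / 2)))) ∂(stateNoise p) := by
        refine lintegral_mono fun z => ?_
        rw [← ENNReal.ofReal_add (by positivity) (by positivity),
          ← ENNReal.ofReal_add (by positivity) (by positivity),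
          ← ENNReal.ofReal_add (by positivity) (by positivity), ← ENNReal.ofReal_mul (by simp)]
        exact ENNReal.ofReal_le_ofReal (sq_weightGapBound_le hh z)
    _ ≤ ENNReal.ofReal 6 * (ENNReal.ofReal (B ^ 2) + (ENNReal.ofReal (Real.exp 1) +
          ENNReal.ofReal (Real.exp 1) + ENNReal.ofReal (Real.exp 1))) := by
        rw [lintegral_const_mul _ (by fun_prop), lintegral_add_left (by fun_prop),
          lintegral_add_left (by fun_prop), lintegral_add_left (by fun_prop), lintegral_const,
          measure_univ, mul_one]
        gcongr
        exacts [hpos.trans hexp, hneg.trans hexp, hnorm.trans hexp]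
    _ = ENNReal.ofReal (6 * (B ^ 2 + 3 * Real.exp 1)) := by
        rw [← ENNReal.ofReal_add (by positivity) (by positivity),
          ← ENNReal.ofReal_add (by positivity) (by positivity),
          ← ENNReal.ofReal_add (by positivity) (by positivity), ← ENNReal.ofReal_mul (by simp)]
        ring_nf

lemma lintegral_compl_goodStep_le (hp : LogSmooth p σ) (hp1 : ∫⁻ x, ENNReal.ofReal (p x) = 1)
    (hσ : 0 < σ) (hB : 0 ≤ B) (hh : 0 ≤ h) (hη : η = h * σ ^ 2) (hh2 : h ≤ 1 / 2)
    (hhd : h * d ≤ 1) (hτ : 0 < τ) (hPb : 0 ≤ Pb)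
    (hP : stateNoise p (goodStep p η h (B / 2))ᶜ ≤ ENNReal.ofReal Pb) :
    ∫⁻ z in (goodStep p η h (B / 2))ᶜ, ENNReal.ofReal (expGap (weightGap B s p η z))
        ∂(stateNoise p) ≤
      ENNReal.ofReal (Real.exp B * Pb + (τ * (6 * (B ^ 2 + 3 * Real.exp 1)) + 1 / τ * Pb)) := by
  have hpm : Measurable p := hp.diff.continuous.measurable
  have hsq := (setLIntegral_le_lintegral (goodStep p η h (B / 2))ᶜ _).trans
    (lintegral_sq_weightGapBound_le (B := B) hp hp1 hσ hh hη hh2 hhd)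
  refine (lintegral_mono (expGap_weightGap_le hp hσ hB hh hη hτ)).trans ?_
  rw [lintegral_add_left (by fun_prop), lintegral_add_left (by fun_prop),
    lintegral_const_mul _ (by fun_prop), lintegral_const_mul _ (by fun_prop), setLIntegral_const,
    setLIntegral_swap_ratio hpm hp.pos (√η) measurableSet_goodStep.compl
      (fun _ => not_congr swap_mem_goodStep),
    ENNReal.ofReal_add (by positivity) (by positivity),
    ENNReal.ofReal_add (by positivity) (by positivity), ENNReal.ofReal_mul (Real.exp_pos _).le,
    ENNReal.ofReal_mul hτ.le, ENNReal.ofReal_mul (one_div_pos.2 hτ).le]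
  gcongr

lemma lintegral_volume_prod_stdGaussian (hp : Measurable p) :
    ∫⁻ z, ENNReal.ofReal (p z.1) ∂((volume : Measure (Euc d)).prod (stdGaussian (Euc d))) =
      ∫⁻ x, ENNReal.ofReal (p x) := by
  rw [lintegral_prod _ (by fun_prop)]
  simp

/-- The joint law of the center `x̄` of a backward step and of the seed `(x - x̄) / √η` of its
endpoint `x` in the exact time reversal, when the endpoint has density `p`. -/
def reverseStep (p : Euc d → ℝ) (η : ℝ) : Measure (Euc d × Euc d) :=
  (volume.prod (stdGaussian (Euc d))).withDensity fun z => ENNReal.ofReal (p (z.1 + √η • z.2))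

/-- A law of the center and the seed of a backward step under which the seed of the endpoint, given
the center, is distributed as for the output of rejection sampling. The center has an unnormalised
density comparable to `p`, chosen so that the density of this law is explicit. -/
def weightedStep (B : ℝ) (s : Euc d → Euc d) (p : Euc d → ℝ) (η : ℝ) : Measure (Euc d × Euc d) :=
  (volume.prod (stdGaussian (Euc d))).withDensity fun z =>
    ENNReal.ofReal (p z.1 * Real.exp (stepWeight B s η z))

lemma lintegral_shift_ne_top (hp : Measurable p) (hp1 : ∫⁻ x, ENNReal.ofReal (p x) = 1) :
    ∫⁻ z, ENNReal.ofReal (p (z.1 + √η • z.2))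
      ∂((volume : Measure (Euc d)).prod (stdGaussian (Euc d))) ≠ ∞ := by
  rw [lintegral_volume_prod_shift (√η) (F := fun z => ENNReal.ofReal (p z.1)) (by fun_prop),
    lintegral_volume_prod_stdGaussian hp, hp1]
  exact ENNReal.one_ne_top

lemma lintegral_mul_exp_stepWeight_ne_top (hp : Measurable p) (hp0 : ∀ x, 0 ≤ p x)
    (hp1 : ∫⁻ x, ENNReal.ofReal (p x) = 1) (hB : 0 ≤ B) :
    ∫⁻ z, ENNReal.ofReal (p z.1 * Real.exp (stepWeight B s η z))
      ∂((volume : Measure (Euc d)).prod (stdGaussian (Euc d))) ≠ ∞ := by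
  refine ne_top_of_le_ne_top (b := ENNReal.ofReal (Real.exp B)) ENNReal.ofReal_ne_top ?_
  calc ∫⁻ z, ENNReal.ofReal (p z.1 * Real.exp (stepWeight B s η z))
        ∂((volume : Measure (Euc d)).prod (stdGaussian (Euc d)))
      ≤ ∫⁻ z, ENNReal.ofReal (p z.1) * ENNReal.ofReal (Real.exp B)
          ∂((volume : Measure (Euc d)).prod (stdGaussian (Euc d))) := by
        refine lintegral_mono fun z => ?_
        rw [ENNReal.ofReal_mul (hp0 _)]
        gcongr
        exact (abs_le.1 (abs_stepWeight_le hB z)).2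
    _ = ENNReal.ofReal (Real.exp B) := by
        rw [lintegral_mul_const _ (by fun_prop), lintegral_volume_prod_stdGaussian hp, hp1,
          one_mul]

/- Both sides are expressed by the forward step, by the volume-preserving change of variables
`(x, g) ↦ (x + √η g, -g)` which exchanges the two ends of the step. -/
lemma klDiv_reverseStep_weightedStep (hp : Measurable p) (hp0 : ∀ x, 0 < p x)
    (hp1 : ∫⁻ x, ENNReal.ofReal (p x) = 1) (hs : Measurable s) (hB : 0 ≤ B) :
    klDiv (reverseStep p η) (weightedStep B s p η) =
      ∫⁻ z, ENNReal.ofReal (expGap (weightGap B s p η z)) ∂(stateNoise p) := by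
  rw [reverseStep, weightedStep, klDiv_withDensity _ (by fun_prop) (by fun_prop) (fun _ => hp0 _)
    (fun _ => mul_pos (hp0 _) (Real.exp_pos _)) (lintegral_shift_ne_top hp hp1)
    (lintegral_mul_exp_stepWeight_ne_top hp (fun x => (hp0 x).le) hp1 hB),
    ← lintegral_volume_prod_swap (√η) (by fun_prop), lintegral_stateNoise hp (by fun_prop)]
  refine lintegral_congr fun z => ?_
  simp only [smul_neg, add_neg_cancel_right]
  rw [Real.log_mul (hp0 _).ne' (Real.exp_pos _).ne', Real.log_exp, weightGap,
    add_comm (Real.log _)]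

lemma klDiv_reverseStep_weightedStep_le (hp : LogSmooth p σ) (hp1 : ∫⁻ x, ENNReal.ofReal (p x) = 1)
    (hs : Measurable s) (hσ : 0 < σ) (hB : 0 ≤ B) (hh : 0 ≤ h) (hη : η = h * σ ^ 2)
    (hh2 : h ≤ 1 / 2) (hhd : h * d ≤ 1) (hτ : 0 < τ) (hPb : 0 ≤ Pb)
    (hP : stateNoise p (goodStep p η h (B / 2))ᶜ ≤ ENNReal.ofReal Pb) :
    klDiv (reverseStep p η) (weightedStep B s p η) ≤
      ENNReal.ofReal (Real.exp (3 * B)) * (ENNReal.ofReal η *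
        ∫⁻ x, ENNReal.ofReal (p x) * ‖s x - gradient (fun y => Real.log (p y)) x‖ₑ ^ 2) +
      ENNReal.ofReal (Real.exp B * Pb + (τ * (6 * (B ^ 2 + 3 * Real.exp 1)) + 1 / τ * Pb)) := by
  rw [klDiv_reverseStep_weightedStep hp.diff.continuous.measurable hp.pos hp1 hs hB,
    ← lintegral_add_compl _ (measurableSet_goodStep (p := p) (η := η) (h := h) (β := B / 2))]
  exact add_le_add (lintegral_goodStep_le hp hs hσ hB hh hη)
    (lintegral_compl_goodStep_le hp hp1 hσ hB hh hη hh2 hhd hτ hPb hP)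

end StepError

section BackwardStep

variable {d : ℕ} {B η α : ℝ} {s : Euc d → Euc d}

@[fun_prop]
lemma measurable_stepPropose :
    Measurable fun y : Euc d × Euc d => stepPropose η y.1 y.2 := by
  unfold stepPropose
  fun_prop

lemma measurable_stepPropose_right (x : Euc d) : Measurable (stepPropose η x) :=
  measurable_stepPropose.of_uncurry_left

lemma measurable_stepEst_right (hs : Measurable s) (x : Euc d) :
    Measurable fun z : Euc d × unitInterval => stepEst B s x z.1 z.2 := by
  unfold stepEst
  fun_prop

lemma measurable_stepStop (hs : Measurable s) :
    Measurable fun z : Euc d × (ℕ → RoundNoise d) =>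
      forsStop B (stepPropose η (α⁻¹ • z.1)) (stepEst B s (α⁻¹ • z.1)) z.2 := by
  refine measurable_firstHit (A := {y : Euc d × RoundNoise d |
      roundAccepts B (stepPropose η (α⁻¹ • y.1)) (stepEst B s (α⁻¹ • y.1)) y.2})
    (φ := fun (z : Euc d × (ℕ → RoundNoise d)) i => (z.1, z.2 i)) fun i => ?_
  exact measurableSet_roundAccepts (φ := fun z : Euc d × (ℕ → RoundNoise d) => z.2 i) (by fun_prop)
    (w := fun z r => stepEst B s (α⁻¹ • z.1) (stepPropose η (α⁻¹ • z.1) (z.2 i).1) r)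
    ((measurable_stepEst hs).comp (f := fun y : (Euc d × (ℕ → RoundNoise d)) × unitInterval =>
      ((α⁻¹ • y.1.1, stepPropose η (α⁻¹ • y.1.1) (y.1.2 i).1), y.2)) (by fun_prop))

lemma measurable_stepOutput (hs : Measurable s) :
    Measurable fun z : Euc d × (ℕ → RoundNoise d) =>
      forsOutput B (stepPropose η (α⁻¹ • z.1)) (stepEst B s (α⁻¹ • z.1)) z.2 := by
  have hround : Measurable fun y : (Euc d × (ℕ → RoundNoise d)) × ℕ =>
      stepPropose η (α⁻¹ • y.1.1) (y.1.2 y.2).1 :=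
    measurable_from_prod_countable_left fun n => by dsimp only; fun_prop
  exact hround.comp (measurable_id.prodMk (measurable_stepStop hs))

lemma measurable_stepCount (hs : Measurable s) :
    Measurable fun z : Euc d × (ℕ → RoundNoise d) =>
      forsCount B (stepPropose η (α⁻¹ • z.1)) (stepEst B s (α⁻¹ • z.1)) z.2 := by
  have hround : Measurable fun y : (Euc d × (ℕ → RoundNoise d)) × ℕ =>
      ∑ i ∈ Finset.range (y.2 + 1), (y.1.2 i).2.1 :=
    measurable_from_prod_countable_left fun n =>
      Finset.measurable_fun_sum (f := fun i (z : Euc d × (ℕ → RoundNoise d)) => (z.2 i).2.1)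
        (Finset.range (n + 1)) fun _ _ => by fun_prop
  exact hround.comp (measurable_id.prodMk (measurable_stepStop hs))

/-- The transition kernel of one backward step, from `X_{t+1}` to `X_t`. -/
def stepKernel (B : ℝ) (s : Euc d → Euc d) (η α : ℝ) : Kernel (Euc d) (Euc d) :=
  (Kernel.id ×ₖ Kernel.const (Euc d) (forsNoise d B)).map fun z =>
    forsOutput B (stepPropose η (α⁻¹ • z.1)) (stepEst B s (α⁻¹ • z.1)) z.2

lemma isMarkovKernel_stepKernel (hs : Measurable s) : IsMarkovKernel (stepKernel B s η α) :=
  Kernel.IsMarkovKernel.map _ (measurable_stepOutput hs)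

lemma lintegral_stepKernel (hs : Measurable s) (x : Euc d) {f : Euc d → ℝ≥0∞} (hf : Measurable f) :
    ∫⁻ y, f y ∂(stepKernel B s η α x) =
      ∫⁻ ω, f (forsOutput B (stepPropose η (α⁻¹ • x)) (stepEst B s (α⁻¹ • x)) ω)
        ∂(forsNoise d B) := by
  have hout := measurable_stepOutput (B := B) (η := η) (α := α) hs
  have hfout : Measurable fun z : Euc d × (ℕ → RoundNoise d) =>
      f (forsOutput B (stepPropose η (α⁻¹ • z.1)) (stepEst B s (α⁻¹ • z.1)) z.2) := hf.comp hout
  rw [stepKernel, Kernel.map_apply _ hout, lintegral_map hf hout, Kernel.prod_apply,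
    Kernel.id_apply, Kernel.const_apply, lintegral_prod _ hfout.aemeasurable,
    lintegral_dirac' _ hfout.lintegral_prod_right]

/- Rejection sampling tilts the proposal by the exponential of the mean estimate, up to a
normalisation which depends on the center only. -/
lemma lintegral_stepKernel_mul (hB : 0 < B) (hs : Measurable s) (hα : α ≠ 0) (x : Euc d)
    {f : Euc d → ℝ≥0∞} (hf : Measurable f) :
    (∫⁻ g, ENNReal.ofReal (Real.exp (stepWeight B s η (x, g))) ∂(stdGaussian (Euc d))) *
      ∫⁻ y, f y ∂(stepKernel B s η α (α • x)) =
      ∫⁻ g, ENNReal.ofReal (Real.exp (stepWeight B s η (x, g))) * f (x + √η • g)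
        ∂(stdGaussian (Euc d)) := by
  rw [lintegral_stepKernel hs _ hf, inv_smul_smul₀ hα]
  exact (lintegral_forsOutput hB (measurable_stepPropose_right x) (measurable_stepEst_right hs x)
    (fun _ _ => abs_clip_le hB.le _) hf).trans (lintegral_congr fun g => mul_comm _ _)

lemma lintegral_exp_stepCount_le (hB : 0 < B) (hs : Measurable s) (x : Euc d) :
    ∫⁻ ω, ENNReal.ofReal (Real.exp (queryRate B *
      (forsCount B (stepPropose η (α⁻¹ • x)) (stepEst B s (α⁻¹ • x)) ω : ℕ))) ∂(forsNoise d B) ≤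
      ENNReal.ofReal (4 * Real.exp (2 * B)) :=
  lintegral_exp_forsCount_le hB (measurable_stepPropose_right _) (measurable_stepEst_right hs _)
    fun _ _ => abs_clip_le hB.le _

end BackwardStep

section ReverseStep

variable {X Y : Type*} [MeasurableSpace X] [MeasurableSpace Y] [StandardBorelSpace Y] [Nonempty Y]

/- By the chain rule the divergence of the joint laws splits into that of the first marginals and
that of the transitions; only the latter is charged to `Q`. -/
lemma klDiv_snd_compProd_le {P Q : Measure (X × Y)} [IsFiniteMeasure P] [IsFiniteMeasure Q]
    {ν : Measure X} [IsFiniteMeasure ν] {K : Kernel X Y} [IsMarkovKernel K]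
    (hQ : Q = Q.fst ⊗ₘ K) :
    klDiv P.snd (ν ⊗ₘ K).snd ≤ klDiv P.fst ν + klDiv P Q := by
  have hP : P = P.fst ⊗ₘ P.condKernel := (P.disintegrate P.condKernel).symm
  have hchain (μ : Measure X) [IsFiniteMeasure μ] :
      klDiv P (μ ⊗ₘ K) = klDiv P.fst μ + klDiv P (P.fst ⊗ₘ K) := by
    conv_lhs => rw [hP]
    rw [klDiv_compProd_eq_add, ← hP]
  calc klDiv P.snd (ν ⊗ₘ K).snd ≤ klDiv P (ν ⊗ₘ K) := klDiv_map_le _ _ measurable_snd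
    _ = klDiv P.fst ν + klDiv P (P.fst ⊗ₘ K) := hchain ν
    _ ≤ klDiv P.fst ν + klDiv P Q := by
        have hPQ : klDiv P Q = klDiv P.fst Q.fst + klDiv P (P.fst ⊗ₘ K) := by
          rw [← hchain Q.fst, ← hQ]
        rw [hPQ]
        gcongr
        exact le_add_self

variable {d : ℕ} {B η α σ : ℝ} {s : Euc d → Euc d} {p : Euc d → ℝ}

/-- The states `(X_{t+1}, X_t)` before and after a backward step, as a function of the center
`X_{t+1} / α` and of the seed. -/
def stepEnds (α η : ℝ) (z : Euc d × Euc d) : Euc d × Euc d := (α • z.1, z.1 + √η • z.2)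

@[fun_prop]
lemma measurable_stepEnds : Measurable (stepEnds (d := d) α η) := by
  unfold stepEnds
  fun_prop

lemma isFiniteMeasure_reverseStep (hp : Measurable p) (hp1 : ∫⁻ x, ENNReal.ofReal (p x) = 1) :
    IsFiniteMeasure (reverseStep p η) :=
  isFiniteMeasure_withDensity (lintegral_shift_ne_top hp hp1)

lemma isFiniteMeasure_weightedStep (hp : Measurable p) (hp0 : ∀ x, 0 ≤ p x)
    (hp1 : ∫⁻ x, ENNReal.ofReal (p x) = 1) (hB : 0 ≤ B) :
    IsFiniteMeasure (weightedStep B s p η) :=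
  isFiniteMeasure_withDensity (lintegral_mul_exp_stepWeight_ne_top hp hp0 hp1 hB)

lemma lintegral_reverseStep (hp : Measurable p) {F : Euc d × Euc d → ℝ≥0∞} (hF : Measurable F) :
    ∫⁻ z, F z ∂(reverseStep p η) = ∫⁻ z, F (z.1 + √η • z.2, -z.2) ∂(stateNoise p) := by
  rw [reverseStep, lintegral_withDensity_eq_lintegral_mul _ (by fun_prop) hF,
    lintegral_stateNoise_swap hp (√η) (by fun_prop)]
  simp only [Pi.mul_apply, smul_neg, add_neg_cancel_right, neg_neg]

lemma fst_map_stepEnds_reverseStep (hp : Measurable p) :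
    ((reverseStep p η).map (stepEnds α η)).fst =
      (stateNoise p).map fun z => α • z.1 + (α * √η) • z.2 := by
  refine Measure.ext_of_lintegral _ fun f hf => ?_
  rw [Measure.fst, lintegral_map hf measurable_fst, lintegral_map (by fun_prop) (by fun_prop),
    lintegral_map hf (by fun_prop), lintegral_reverseStep hp (by fun_prop)]
  simp only [stepEnds, smul_add, mul_smul]

lemma snd_map_stepEnds_reverseStep (hp : Measurable p) :
    ((reverseStep p η).map (stepEnds α η)).snd =
      volume.withDensity fun x => ENNReal.ofReal (p x) := by
  refine Measure.ext_of_lintegral _ fun f hf => ?_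
  rw [Measure.snd, lintegral_map hf measurable_snd, lintegral_map (by fun_prop) (by fun_prop),
    lintegral_reverseStep hp (by fun_prop), stateNoise, lintegral_prod _ (by fun_prop)]
  simp [stepEnds]

lemma lintegral_weightedStep (hp : Measurable p) (hp0 : ∀ x, 0 ≤ p x) (hs : Measurable s)
    {F : Euc d × Euc d → ℝ≥0∞} (hF : Measurable F) :
    ∫⁻ z, F z ∂(weightedStep B s p η) = ∫⁻ x, ENNReal.ofReal (p x) *
      ∫⁻ g, ENNReal.ofReal (Real.exp (stepWeight B s η (x, g))) * F (x, g)
        ∂(stdGaussian (Euc d)) := by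
  rw [weightedStep, lintegral_withDensity_eq_lintegral_mul _ (by fun_prop) hF,
    lintegral_prod _ (by fun_prop)]
  refine lintegral_congr fun x => ?_
  simp only [Pi.mul_apply, ENNReal.ofReal_mul (hp0 x), mul_assoc]
  exact lintegral_const_mul _ (by fun_prop)

lemma map_stepEnds_weightedStep (hp : Measurable p) (hp0 : ∀ x, 0 ≤ p x)
    (hp1 : ∫⁻ x, ENNReal.ofReal (p x) = 1) (hB : 0 < B) (hs : Measurable s) (hα : α ≠ 0) :
    (weightedStep B s p η).map (stepEnds α η) =
      ((weightedStep B s p η).map (stepEnds α η)).fst ⊗ₘ stepKernel B s η α := by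
  have := isMarkovKernel_stepKernel (B := B) (η := η) (α := α) hs
  have := isFiniteMeasure_weightedStep (s := s) (η := η) hp hp0 hp1 hB.le
  refine Measure.ext_of_lintegral _ fun F hF => ?_
  have hK : Measurable fun x => ∫⁻ y, F (x, y) ∂(stepKernel B s η α x) :=
    hF.lintegral_kernel_prod_right'
  have hK1 : Measurable fun z : Euc d × Euc d => ∫⁻ y, F (z.1, y) ∂(stepKernel B s η α z.1) :=
    hK.comp measurable_fst
  have hK1ends : Measurable fun z : Euc d × Euc d =>
      ∫⁻ y, F ((stepEnds α η z).1, y) ∂(stepKernel B s η α (stepEnds α η z).1) :=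
    hK1.comp measurable_stepEnds
  rw [Measure.lintegral_compProd hF, Measure.fst, lintegral_map hK measurable_fst,
    lintegral_map hF measurable_stepEnds, lintegral_map hK1 measurable_stepEnds,
    lintegral_weightedStep hp hp0 hs (F := fun z => F (stepEnds α η z)) (by fun_prop),
    lintegral_weightedStep hp hp0 hs hK1ends]
  refine lintegral_congr fun x => ?_
  have hFx : Measurable fun y => F (α • x, y) := hF.comp measurable_prodMk_left
  simp only [stepEnds]
  rw [lintegral_mul_const _ (by fun_prop), lintegral_stepKernel_mul hB hs hα x hFx]

lemma klDiv_backwardStep_le (hB : 0 < B) (hp : LogSmooth p σ)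
    (hp1 : ∫⁻ x, ENNReal.ofReal (p x) = 1) (hs : Measurable s) (hα : α ≠ 0)
    {ν : Measure (Euc d)} [IsFiniteMeasure ν] :
    klDiv (volume.withDensity fun x => ENNReal.ofReal (p x)) (ν ⊗ₘ stepKernel B s η α).snd ≤
      klDiv ((stateNoise p).map fun z => α • z.1 + (α * √η) • z.2) ν +
        klDiv (reverseStep p η) (weightedStep B s p η) := by
  have hpm : Measurable p := hp.diff.continuous.measurable
  have := isMarkovKernel_stepKernel (B := B) (η := η) (α := α) hs
  have := isFiniteMeasure_reverseStep (η := η) hpm hp1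
  have := isFiniteMeasure_weightedStep (s := s) (η := η) hpm (fun x => (hp.pos x).le) hp1 hB.le
  have hQ := map_stepEnds_weightedStep (η := η) hpm (fun x => (hp.pos x).le) hp1 hB hs hα
  have hkl := klDiv_snd_compProd_le (P := (reverseStep p η).map (stepEnds α η)) (ν := ν) hQ
  rw [snd_map_stepEnds_reverseStep hpm, fst_map_stepEnds_reverseStep hpm] at hkl
  exact hkl.trans (add_le_add_right (klDiv_map_le _ _ measurable_stepEnds) _)

end ReverseStep

section BackwardChain

variable {d : ℕ} {B : ℝ} {s : ℕ → Euc d → Euc d} {σ : ℕ → ℝ} {T : ℕ} {init : Measure (Euc d)}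

lemma measurable_backwardStep (hs : ∀ t, Measurable (s t)) (σ : ℕ → ℝ) (t : ℕ) :
    Measurable fun z : (Euc d × ℕ) × (ℕ → RoundNoise d) => backwardStep B s σ t z.1 z.2 := by
  have hstate : Measurable fun z : (Euc d × ℕ) × (ℕ → RoundNoise d) => (z.1.1, z.2) := by fun_prop
  have hout := (measurable_stepOutput (η := vpEta σ t) (α := vpAlpha σ t) (B := B) (hs t)).comp
    hstate
  have hcount := (measurable_stepCount (η := vpEta σ t) (α := vpAlpha σ t) (B := B) (hs t)).comp
    hstate
  exact hout.prodMk (measurable_fst.snd.add hcount)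

/-- The law of the state `X_{T-k}` of the sampler, after `k` backward steps. -/
def backwardState (B : ℝ) (s : ℕ → Euc d → Euc d) (σ : ℕ → ℝ) (T : ℕ) (init : Measure (Euc d))
    (k : ℕ) : Measure (Euc d) :=
  (backwardLaw B s σ T init k).fst

lemma isProbabilityMeasure_backwardLaw [IsProbabilityMeasure init] (hs : ∀ t, Measurable (s t))
    (k : ℕ) : IsProbabilityMeasure (backwardLaw B s σ T init k) := by
  induction k with
  | zero => exact Measure.isProbabilityMeasure_map (by fun_prop)
  | succ k ih =>
    exact Measure.isProbabilityMeasure_map (measurable_backwardStep hs σ _).aemeasurable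

lemma isProbabilityMeasure_backwardState [IsProbabilityMeasure init]
    (hs : ∀ t, Measurable (s t)) (k : ℕ) :
    IsProbabilityMeasure (backwardState B s σ T init k) :=
  have := isProbabilityMeasure_backwardLaw (B := B) (σ := σ) (T := T) (init := init) hs k
  Measure.isProbabilityMeasure_map (by fun_prop)

lemma backwardState_zero : backwardState B s σ T init 0 = init := by
  rw [backwardState, backwardLaw, Measure.fst, Measure.map_map (by fun_prop) (by fun_prop)]
  exact Measure.map_id

lemma backwardState_succ [IsProbabilityMeasure init] (hs : ∀ t, Measurable (s t)) (k : ℕ) :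
    backwardState B s σ T init (k + 1) =
      (backwardState B s σ T init k ⊗ₘ stepKernel B (s (T - (k + 1))) (vpEta σ (T - (k + 1)))
        (vpAlpha σ (T - (k + 1)))).snd := by
  have := isProbabilityMeasure_backwardLaw (B := B) (σ := σ) (T := T) (init := init) hs k
  have := isProbabilityMeasure_backwardState (B := B) (σ := σ) (T := T) (init := init) hs k
  have := isMarkovKernel_stepKernel (B := B) (η := vpEta σ (T - (k + 1)))
    (α := vpAlpha σ (T - (k + 1))) (hs (T - (k + 1)))
  have hstep := measurable_backwardStep (B := B) hs σ (T - (k + 1))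
  refine Measure.ext_of_lintegral _ fun f hf => ?_
  have hf1 : Measurable fun z : Euc d × ℕ => f z.1 := by fun_prop
  have hfstep : Measurable fun z : (Euc d × ℕ) × (ℕ → RoundNoise d) =>
      f (backwardStep B s σ (T - (k + 1)) z.1 z.2).1 := hf1.comp hstep
  have hfout : Measurable fun z : Euc d × (ℕ → RoundNoise d) =>
      f (forsOutput B (stepPropose (vpEta σ (T - (k + 1))) ((vpAlpha σ (T - (k + 1)))⁻¹ • z.1))
        (stepEst B (s (T - (k + 1))) ((vpAlpha σ (T - (k + 1)))⁻¹ • z.1)) z.2) :=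
    hf.comp (measurable_stepOutput (hs (T - (k + 1))))
  rw [Measure.snd, lintegral_map hf measurable_snd, Measure.lintegral_compProd (by fun_prop)]
  simp_rw [lintegral_stepKernel (hs _) _ hf]
  rw [backwardState, backwardLaw, Measure.fst, lintegral_map hf measurable_fst,
    lintegral_map hf1 hstep, backwardState, Measure.fst,
    lintegral_map hfout.lintegral_prod_right measurable_fst,
    lintegral_prod _ hfstep.aemeasurable]
  rfl

lemma lintegral_exp_backwardStep_le (hB : 0 < B) (hs : ∀ t, Measurable (s t)) (t : ℕ)
    (z : Euc d × ℕ) :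
    ∫⁻ ω, ENNReal.ofReal (Real.exp (queryRate B * (backwardStep B s σ t z ω).2))
        ∂(forsNoise d B) ≤
      ENNReal.ofReal (4 * Real.exp (2 * B)) * ENNReal.ofReal (Real.exp (queryRate B * z.2)) := by
  rw [mul_comm]
  refine le_trans (le_of_eq ?_) (mul_le_mul_right (lintegral_exp_stepCount_le
    (η := vpEta σ t) (α := vpAlpha σ t) hB (hs t) z.1) _)
  rw [← lintegral_const_mul' _ _ ENNReal.ofReal_ne_top]
  refine lintegral_congr fun ω => ?_
  rw [← ENNReal.ofReal_mul (Real.exp_pos _).le, ← Real.exp_add, ← mul_add, ← Nat.cast_add]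
  rfl

lemma lintegral_exp_backwardLaw_le [IsProbabilityMeasure init] (hB : 0 < B)
    (hs : ∀ t, Measurable (s t)) (k : ℕ) :
    ∫⁻ z, ENNReal.ofReal (Real.exp (queryRate B * z.2)) ∂(backwardLaw B s σ T init k) ≤
      ENNReal.ofReal (4 * Real.exp (2 * B)) ^ k := by
  induction k with
  | zero =>
    rw [backwardLaw, lintegral_map (by fun_prop) (by fun_prop)]
    simp
  | succ k ih =>
    have := isProbabilityMeasure_backwardLaw (B := B) (σ := σ) (T := T) (init := init) hs k
    have hstep := measurable_backwardStep (B := B) hs σ (T - (k + 1))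
    have hexp : Measurable fun z : Euc d × ℕ =>
      ENNReal.ofReal (Real.exp (queryRate B * z.2)) := by fun_prop
    have hexp_step : Measurable fun z : (Euc d × ℕ) × (ℕ → RoundNoise d) => ENNReal.ofReal
        (Real.exp (queryRate B * (backwardStep B s σ (T - (k + 1)) z.1 z.2).2)) := hexp.comp hstep
    rw [backwardLaw, lintegral_map hexp hstep, lintegral_prod _ hexp_step.aemeasurable, pow_succ']
    refine (lintegral_mono (lintegral_exp_backwardStep_le hB hs (T - (k + 1)))).trans ?_
    rw [lintegral_const_mul _ hexp]
    exact mul_le_mul_right ih _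

variable {pdata : Measure (Euc d)} [IsProbabilityMeasure pdata] [IsProbabilityMeasure init]
  {σ₁ : ℝ} {t : ℕ}

lemma lintegral_forwardDensity (hσ : IsVPSchedule T σ σ₁) (h1 : 1 ≤ t) (ht : t ≤ T) :
    ∫⁻ x, ENNReal.ofReal (forwardDensity pdata σ t x) = 1 := by
  have hprob := (isProbabilityMeasure_forwardLaw pdata hσ ht).measure_univ
  rwa [forwardLaw_eq_withDensity pdata hσ h1 ht, withDensity_apply _ MeasurableSet.univ,
    setLIntegral_univ] at hprob

lemma klDiv_forwardLaw_backwardState_succ_le (hB : 0 < B) (hs : ∀ t, Measurable (s t))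
    (hσ : IsVPSchedule T σ σ₁) {k : ℕ} (h1 : 1 ≤ t) (ht : t + k + 1 = T) :
    klDiv (forwardLaw pdata σ t) (backwardState B s σ T init (k + 1)) ≤
      klDiv (forwardLaw pdata σ (t + 1)) (backwardState B s σ T init k) +
        klDiv (reverseStep (forwardDensity pdata σ t) (vpEta σ t))
          (weightedStep B (s t) (forwardDensity pdata σ t) (vpEta σ t)) := by
  have htT : t < T := by omega
  have := isProbabilityMeasure_backwardState (B := B) (σ := σ) (T := T) (init := init) hs k
  have hnext : forwardLaw pdata σ (t + 1) = (stateNoise (forwardDensity pdata σ t)).map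
      fun z => vpAlpha σ t • z.1 + (vpAlpha σ t * √(vpEta σ t)) • z.2 := by
    rw [forwardLaw, forwardLaw_eq_withDensity pdata hσ h1 htT.le, stateNoise]
  rw [backwardState_succ hs k, show T - (k + 1) = t by omega, hnext,
    forwardLaw_eq_withDensity pdata hσ h1 htT.le]
  exact klDiv_backwardStep_le hB (logSmooth_forwardDensity pdata hσ h1 htT.le)
    (lintegral_forwardDensity hσ h1 htT.le) (hs t) (hσ.vpAlpha_pos htT).ne'

lemma klDiv_forwardLaw_backwardState_le (hB : 0 < B) (hs : ∀ t, Measurable (s t))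
    (hσ : IsVPSchedule T σ σ₁) {k : ℕ} (hk : k < T) :
    klDiv (forwardLaw pdata σ (T - k)) (backwardState B s σ T init k) ≤
      klDiv (forwardLaw pdata σ T) init + ∑ t ∈ Finset.Ico (T - k) T,
        klDiv (reverseStep (forwardDensity pdata σ t) (vpEta σ t))
          (weightedStep B (s t) (forwardDensity pdata σ t) (vpEta σ t)) := by
  induction k with
  | zero => simp [backwardState_zero]
  | succ k ih =>
    obtain ⟨t, ht⟩ : ∃ t, t = T - (k + 1) := ⟨_, rfl⟩
    have ih := ih (by omega)
    rw [show T - k = t + 1 by omega] at ih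
    rw [← ht, Finset.sum_eq_sum_Ico_succ_bot (by omega)]
    refine (klDiv_forwardLaw_backwardState_succ_le hB hs hσ (by omega) (by omega)).trans ?_
    rw [add_left_comm, add_comm]
    gcongr

end BackwardChain

section GaussianShift

variable {E : Type*} [NormedAddCommGroup E] [InnerProductSpace ℝ E] [FiniteDimensional ℝ E]
  [MeasurableSpace E] [BorelSpace E]

lemma lintegral_stdGaussian_add (e : E) {F : E → ℝ≥0∞} (hF : Measurable F) :
    ∫⁻ g, F (g + e) ∂(stdGaussian E) =
      ∫⁻ g, ENNReal.ofReal (Real.exp (inner ℝ g e - ‖e‖ ^ 2 / 2)) * F g ∂(stdGaussian E) := by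
  have hdens : Measurable fun x : E => ENNReal.ofReal (gaussDensity 1 x) := by fun_prop
  have hFe : Measurable fun g => F (g + e) := by fun_prop
  rw [stdGaussian_eq_withDensity, lintegral_withDensity_eq_lintegral_mul _ hdens hFe,
    lintegral_withDensity_eq_lintegral_mul _ hdens (by fun_prop),
    ← lintegral_add_right_eq_self _ (-e)]
  refine lintegral_congr fun x => ?_
  simp only [Pi.mul_apply, neg_add_cancel_right]
  rw [← mul_assoc, ← ENNReal.ofReal_mul (gaussDensity_pos one_pos _).le]
  congr 2
  unfold gaussDensity
  rw [mul_assoc ((2 * Real.pi * 1 ^ 2) ^ _), ← Real.exp_add, ← sub_eq_add_neg, norm_sub_sq_real]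
  ring_nf

lemma lintegral_exp_inner_sub_stdGaussian (e : E) :
    ∫⁻ g, ENNReal.ofReal (Real.exp (inner ℝ g e - ‖e‖ ^ 2 / 2)) ∂(stdGaussian E) = 1 := by
  simpa using (lintegral_stdGaussian_add e (F := fun _ => 1) measurable_const).symm

lemma integrable_exp_inner_sub_stdGaussian (e : E) :
    Integrable (fun g => Real.exp (inner ℝ g e - ‖e‖ ^ 2 / 2)) (stdGaussian E) := by
  refine ⟨by fun_prop, ?_⟩
  rw [hasFiniteIntegral_iff_ofReal (ae_of_all _ fun _ => (Real.exp_pos _).le),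
    lintegral_exp_inner_sub_stdGaussian]
  exact ENNReal.one_lt_top

lemma integral_exp_inner_sub_stdGaussian (e : E) :
    ∫ g, Real.exp (inner ℝ g e - ‖e‖ ^ 2 / 2) ∂(stdGaussian E) = 1 := by
  rw [integral_eq_lintegral_of_nonneg_ae (ae_of_all _ fun _ => (Real.exp_pos _).le) (by fun_prop),
    lintegral_exp_inner_sub_stdGaussian, ENNReal.toReal_one]

lemma lintegral_expGap_inner_sub_stdGaussian (e : E) :
    ∫⁻ g, ENNReal.ofReal (expGap (inner ℝ g e - ‖e‖ ^ 2 / 2)) ∂(stdGaussian E) =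
      ENNReal.ofReal (‖e‖ ^ 2 / 2) := by
  have hexp := integrable_exp_inner_sub_stdGaussian e
  have hinner : Integrable (fun g => (inner ℝ g e : ℝ)) (stdGaussian E) := by
    simpa [real_inner_comm] using (innerSL ℝ e).integrable_comp
      (IsGaussian.integrable_id (μ := stdGaussian E))
  have hlin : Integrable (fun g => (inner ℝ g e : ℝ) - ‖e‖ ^ 2 / 2) (stdGaussian E) :=
    hinner.sub (integrable_const _)
  have hexp1 : Integrable (fun g => Real.exp (inner ℝ g e - ‖e‖ ^ 2 / 2) - 1) (stdGaussian E) :=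
    hexp.sub (integrable_const _)
  have hgap : Integrable (fun g => expGap (inner ℝ g e - ‖e‖ ^ 2 / 2)) (stdGaussian E) :=
    hexp1.sub hlin
  rw [← ofReal_integral_eq_lintegral_ofReal hgap (ae_of_all _ fun _ => expGap_nonneg _)]
  simp only [expGap]
  rw [integral_sub hexp1 hlin, integral_sub hexp (integrable_const _),
    integral_sub hinner (integrable_const _), integral_exp_inner_sub_stdGaussian,
    integral_inner_stdGaussian]
  simp

lemma lintegral_exp_mul_expGap_stdGaussian (e : E) :
    ∫⁻ g, ENNReal.ofReal (Real.exp (inner ℝ g e - ‖e‖ ^ 2 / 2)) *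
      ENNReal.ofReal (expGap (-(inner ℝ g e - ‖e‖ ^ 2 / 2))) ∂(stdGaussian E) =
      ENNReal.ofReal (‖e‖ ^ 2 / 2) := by
  rw [← lintegral_stdGaussian_add e
    (F := fun g => ENNReal.ofReal (expGap (-(inner ℝ g e - ‖e‖ ^ 2 / 2)))) (by fun_prop),
    ← norm_neg e, ← lintegral_expGap_inner_sub_stdGaussian (-e)]
  refine lintegral_congr fun g => ?_
  rw [inner_add_left, real_inner_self_eq_norm_sq, inner_neg_right, norm_neg]
  ring_nf

variable (μ : Measure E) (c : ℝ)

lemma map_shift_prod_stdGaussian :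
    (μ.prod (stdGaussian E)).map (fun z => (z.1, z.2 + c • z.1)) =
      (μ.prod (stdGaussian E)).withDensity fun z =>
        ENNReal.ofReal (Real.exp (inner ℝ z.2 (c • z.1) - ‖c • z.1‖ ^ 2 / 2)) := by
  refine Measure.ext_of_lintegral _ fun F hF => ?_
  have hFshift : Measurable fun z : E × E => F (z.1, z.2 + c • z.1) := by fun_prop
  rw [lintegral_map hF (by fun_prop), lintegral_withDensity_eq_lintegral_mul _ (by fun_prop) hF,
    lintegral_prod _ hFshift.aemeasurable, lintegral_prod _ (by fun_prop)]
  exact lintegral_congr fun x =>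
    lintegral_stdGaussian_add (c • x) (F := fun g => F (x, g)) (by fun_prop)

lemma klDiv_map_shift_prod_stdGaussian [IsFiniteMeasure μ] :
    klDiv ((μ.prod (stdGaussian E)).map fun z => (z.1, z.2 + c • z.1)) (μ.prod (stdGaussian E)) =
      ∫⁻ x, ENNReal.ofReal (‖c • x‖ ^ 2 / 2) ∂μ := by
  set w : E × E → ℝ := fun z => Real.exp (inner ℝ z.2 (c • z.1) - ‖c • z.1‖ ^ 2 / 2) with hw
  have hshift : (μ.prod (stdGaussian E)).map (fun z => (z.1, z.2 + c • z.1)) =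
      (μ.prod (stdGaussian E)).withDensity fun z => ENNReal.ofReal (w z) :=
    map_shift_prod_stdGaussian μ c
  have hfin : ∫⁻ z, ENNReal.ofReal (w z) ∂(μ.prod (stdGaussian E)) ≠ ∞ := by
    rw [← setLIntegral_univ, ← withDensity_apply _ .univ, ← hshift]
    exact measure_ne_top _ _
  have hkl := klDiv_withDensity (f := w) (g := fun _ => 1) (μ.prod (stdGaussian E)) (by fun_prop)
    measurable_const (fun _ => Real.exp_pos _) (fun _ => one_pos) hfin (by simp)
  simp only [ENNReal.ofReal_one, ← Pi.one_def, withDensity_one, Real.log_one, hw, Real.log_exp,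
    zero_sub] at hkl
  rw [hshift, hkl, lintegral_prod _ (by fun_prop)]
  exact lintegral_congr fun x => lintegral_exp_mul_expGap_stdGaussian (c • x)

end GaussianShift

section Initialization

variable {d : ℕ} {T : ℕ} {σ : ℕ → ℝ} {σ₁ : ℝ}

lemma isProbabilityMeasure_isoGaussian (m : Euc d) (v : ℝ) :
    IsProbabilityMeasure (isoGaussian m v) :=
  Measure.isProbabilityMeasure_map (by fun_prop)

lemma klDiv_forwardLaw_isoGaussian_le (pdata : Measure (Euc d)) [IsProbabilityMeasure pdata]
    (hm : Integrable (fun x : Euc d => ‖x‖ ^ 2) pdata) (h : IsVPSchedule T σ σ₁) :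
    klDiv (forwardLaw pdata σ T) (isoGaussian 0 (σ T ^ 2)) ≤
      ENNReal.ofReal ((vpAlphaBar σ T / σ T) ^ 2 * secondMoment pdata / 2) := by
  have hσ : 0 < σ T := h.pos T h.one_le le_rfl
  set c := vpAlphaBar σ T / σ T with hc
  set ψ : Euc d × Euc d → Euc d := fun z => σ T • z.2 with hψ
  have hforward : forwardLaw pdata σ T =
      ((pdata.prod (stdGaussian (Euc d))).map fun z => (z.1, z.2 + c • z.1)).map ψ := by
    rw [forwardLaw_eq_map pdata h le_rfl, Measure.map_map (by fun_prop) (by fun_prop)]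
    congr 1
    ext1 z
    simp only [hψ, Function.comp_apply, smul_add, smul_smul, hc, mul_div_cancel₀ _ hσ.ne', add_comm]
  have hinit : isoGaussian 0 (σ T ^ 2) = (pdata.prod (stdGaussian (Euc d))).map ψ := by
    have hcomp : ψ = (σ T • ·) ∘ Prod.snd := rfl
    rw [hcomp, ← Measure.map_map (by fun_prop) measurable_snd, ← Measure.snd, Measure.snd_prod,
      isoGaussian, Real.sqrt_sq hσ.le]
    simp only [zero_add]
  have hnorm (x : Euc d) : ‖c • x‖ ^ 2 / 2 = c ^ 2 / 2 * ‖x‖ ^ 2 := by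
    rw [norm_smul, mul_pow, Real.norm_eq_abs, sq_abs]; ring
  have hmean : ∫⁻ x, ENNReal.ofReal (‖c • x‖ ^ 2 / 2) ∂pdata =
      ENNReal.ofReal (c ^ 2 * secondMoment pdata / 2) := by
    simp_rw [hnorm]
    rw [← ofReal_integral_eq_lintegral_ofReal (hm.const_mul _) (ae_of_all _ fun x => by positivity),
      integral_const_mul, secondMoment]
    ring_nf
  rw [hforward, hinit, ← hmean, ← klDiv_map_shift_prod_stdGaussian]
  exact klDiv_map_le _ _ (by fun_prop)

end Initialization

section VariationalBound

lemma mul_le_klFun_add_expGap {r : ℝ} (hr : 0 ≤ r) (a : ℝ) : (r - 1) * a ≤ klFun r + expGap a := by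
  unfold klFun expGap
  rcases hr.eq_or_lt with rfl | hr
  · have := Real.exp_pos a
    simp only [Real.log_zero]
    linarith
  · have h := Real.add_one_le_exp (a - Real.log r)
    rw [Real.exp_sub, Real.exp_log hr, le_div_iff₀ hr] at h
    linarith

variable {α : Type*} [MeasurableSpace α] {μ ν : Measure α} [IsProbabilityMeasure μ]
  [IsProbabilityMeasure ν] {f : α → ℝ}

lemma mul_integral_sub_le_klDiv (hkl : klDiv μ ν ≠ ∞) (hf : Measurable f) (hf1 : ∀ x, |f x| ≤ 1)
    {l : ℝ} (hl : |l| ≤ 1) :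
    l * (∫ x, f x ∂μ - ∫ x, f x ∂ν) ≤ (klDiv μ ν).toReal + 3 * l ^ 2 := by
  obtain ⟨hac, hllr⟩ := klDiv_ne_top_iff.1 hkl
  set r : α → ℝ := fun x => (μ.rnDeriv ν x).toReal
  have hfμ : Integrable f μ := .of_bound hf.aestronglyMeasurable 1 (ae_of_all _ hf1)
  have hfν : Integrable f ν := .of_bound hf.aestronglyMeasurable 1 (ae_of_all _ hf1)
  have hklFun : Integrable (fun x => klFun (r x)) ν := (integrable_klFun_rnDeriv_iff hac).2 hllr
  have hrf : Integrable (fun x => r x * f x) ν := (integrable_rnDeriv_smul_iff hac).2 hfμ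
  have hpoint (x : α) : l * (r x * f x - f x) ≤ klFun (r x) + 3 * l ^ 2 := by
    have hyoung := mul_le_klFun_add_expGap (r := r x) ENNReal.toReal_nonneg (l * f x)
    have hgap : expGap (l * f x) ≤ Real.exp 1 * (l * f x) ^ 2 :=
      expGap_le_sq (by rw [abs_mul]; exact mul_le_one₀ hl (abs_nonneg _) (hf1 x))
    have hsq : Real.exp 1 * (l * f x) ^ 2 ≤ 3 * l ^ 2 := by
      have hfx : f x ^ 2 ≤ 1 := (sq_le_one_iff_abs_le_one _).2 (hf1 x)
      calc Real.exp 1 * (l * f x) ^ 2 = Real.exp 1 * (l ^ 2 * f x ^ 2) := by ring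
        _ ≤ 3 * (l ^ 2 * 1) := by
          gcongr
          linarith [Real.exp_one_lt_d9]
        _ = 3 * l ^ 2 := by ring
    linarith
  calc l * (∫ x, f x ∂μ - ∫ x, f x ∂ν) = ∫ x, l * (r x * f x - f x) ∂ν := by
        rw [integral_const_mul, integral_sub hrf hfν, ← integral_rnDeriv_smul (f := f) hac]
        rfl
    _ ≤ ∫ x, (klFun (r x) + 3 * l ^ 2) ∂ν :=
        integral_mono ((hrf.sub hfν).const_mul l) (hklFun.add (integrable_const _)) hpoint
    _ = (klDiv μ ν).toReal + 3 * l ^ 2 := by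
        rw [integral_add hklFun (integrable_const _), toReal_klDiv_eq_integral_klFun hac]
        simp [r]

variable (μ ν) in
/- The constant `12` comes from the choice `l = D / 6` in the variational bound, `D` being the
difference of the two expectations; `|l| ≤ 1` because `|D| ≤ 2`. -/
lemma sq_integral_sub_le_klDiv (hf : Measurable f) (hf1 : ∀ x, |f x| ≤ 1) :
    ENNReal.ofReal ((∫ x, f x ∂μ - ∫ x, f x ∂ν) ^ 2) ≤ 12 * klDiv μ ν := by
  by_cases htop : klDiv μ ν = ∞
  · simp [htop]
  set D := ∫ x, f x ∂μ - ∫ x, f x ∂ν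
  have hle (m : Measure α) [IsProbabilityMeasure m] : |∫ x, f x ∂m| ≤ 1 := by
    simpa using norm_integral_le_of_norm_le_const (μ := m) (f := f) (C := 1) (ae_of_all _ hf1)
  have hD2 : |D| ≤ 2 := (abs_sub _ _).trans (by linarith [hle μ, hle ν])
  have hl : |D / 6| ≤ 1 := by
    rw [abs_div, abs_of_pos (by norm_num : (0 : ℝ) < 6)]; linarith
  have hvar : D / 6 * D ≤ (klDiv μ ν).toReal + 3 * (D / 6) ^ 2 :=
    mul_integral_sub_le_klDiv htop hf hf1 hl
  calc ENNReal.ofReal (D ^ 2) ≤ ENNReal.ofReal (12 * (klDiv μ ν).toReal) :=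
        ENNReal.ofReal_le_ofReal (by nlinarith)
    _ = 12 * klDiv μ ν := by
      rw [ENNReal.ofReal_mul (by norm_num), ENNReal.ofReal_toReal htop, ENNReal.ofReal_ofNat]

end VariationalBound

section BoundedLipschitz

section

variable {E : Type*} [NormedAddCommGroup E]

lemma sq_sub_smul_add_smul_le_of_lipschitzWith [NormedSpace ℝ E] {f : E → ℝ} {a b : ℝ}
    (hf : LipschitzWith 1 f) (hab : |1 - a| ≤ b) (x y : E) :
    (f x - f (a • x + b • y)) ^ 2 ≤ 2 * b ^ 2 * (‖x‖ ^ 2 + ‖y‖ ^ 2) := by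
  have hb : 0 ≤ b := (abs_nonneg _).trans hab
  have habs : |f x - f (a • x + b • y)| ≤ b * (‖x‖ + ‖y‖) :=
    calc |f x - f (a • x + b • y)| ≤ ‖x - (a • x + b • y)‖ := by
          simpa [Real.dist_eq, dist_eq_norm] using hf.dist_le_mul x (a • x + b • y)
      _ = ‖(1 - a) • x - b • y‖ := by congr 1; module
      _ ≤ |1 - a| * ‖x‖ + b * ‖y‖ := by
          simpa [norm_smul, abs_of_nonneg hb] using norm_sub_le ((1 - a) • x) (b • y)
      _ ≤ b * (‖x‖ + ‖y‖) := by rw [mul_add]; gcongr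
  calc (f x - f (a • x + b • y)) ^ 2 ≤ (b * (‖x‖ + ‖y‖)) ^ 2 := by rw [← sq_abs]; gcongr
    _ = b ^ 2 * (‖x‖ + ‖y‖) ^ 2 := mul_pow _ _ _
    _ ≤ b ^ 2 * (2 * (‖x‖ ^ 2 + ‖y‖ ^ 2)) := by gcongr; exact add_sq_le
    _ = 2 * b ^ 2 * (‖x‖ ^ 2 + ‖y‖ ^ 2) := by ring

variable [InnerProductSpace ℝ E] [FiniteDimensional ℝ E] [MeasurableSpace E] [BorelSpace E]

lemma sq_integral_sub_map_noise_le {μ : Measure E} [IsProbabilityMeasure μ]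
    (hμ : Integrable (fun x => ‖x‖ ^ 2) μ) {f : E → ℝ} (hf : LipschitzWith 1 f)
    (hfμ : Integrable f μ) {a b : ℝ} (hab : |1 - a| ≤ b) :
    (∫ x, f x ∂μ - ∫ x, f x ∂((μ.prod (stdGaussian E)).map fun z => a • z.1 + b • z.2)) ^ 2 ≤
      2 * b ^ 2 * (Module.finrank ℝ E + ∫ x, ‖x‖ ^ 2 ∂μ) := by
  have hfc : Continuous f := hf.continuous
  set m := μ.prod (stdGaussian E)
  set F : E × E → ℝ := fun z => f z.1 - f (a • z.1 + b • z.2)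
  have hFm : AEStronglyMeasurable F m := by fun_prop
  have hx : Integrable (fun z : E × E => ‖z.1‖ ^ 2) m := hμ.comp_fst _
  have hg : Integrable (fun z : E × E => ‖z.2‖ ^ 2) m := integrable_norm_sq_stdGaussian.comp_snd _
  have hbound : Integrable (fun z : E × E => 2 * b ^ 2 * (‖z.1‖ ^ 2 + ‖z.2‖ ^ 2)) m :=
    (hx.add hg).const_mul _
  have hpoint (z : E × E) : F z ^ 2 ≤ 2 * b ^ 2 * (‖z.1‖ ^ 2 + ‖z.2‖ ^ 2) :=
    sq_sub_smul_add_smul_le_of_lipschitzWith hf hab z.1 z.2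
  have hFsq : Integrable (fun z => F z ^ 2) m :=
    hbound.mono' (hFm.pow 2) (ae_of_all _ fun z => by simpa using hpoint z)
  have hF : MemLp F 2 m := (memLp_two_iff_integrable_sq hFm).2 hFsq
  have hfst : Integrable (fun z : E × E => f z.1) m := hfμ.comp_fst _
  have hnoised : Integrable (fun z : E × E => f (a • z.1 + b • z.2)) m :=
    (hfst.sub (hF.integrable one_le_two)).congr (ae_of_all _ fun z => sub_sub_cancel _ _)
  have hdiff : ∫ x, f x ∂μ - ∫ x, f x ∂(m.map fun z => a • z.1 + b • z.2) = ∫ z, F z ∂m := by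
    rw [integral_sub hfst hnoised, integral_map (by fun_prop) (by fun_prop), integral_fun_fst]
    simp
  have hvar := variance_nonneg F m
  rw [variance_eq_sub hF, sub_nonneg] at hvar
  calc (∫ x, f x ∂μ - ∫ x, f x ∂(m.map fun z => a • z.1 + b • z.2)) ^ 2
      ≤ ∫ z, F z ^ 2 ∂m := by rw [hdiff]; exact hvar
    _ ≤ ∫ z, 2 * b ^ 2 * (‖z.1‖ ^ 2 + ‖z.2‖ ^ 2) ∂m := integral_mono hFsq hbound hpoint
    _ = 2 * b ^ 2 * (Module.finrank ℝ E + ∫ x, ‖x‖ ^ 2 ∂μ) := by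
      rw [integral_const_mul, integral_add hx hg, integral_fun_fst (fun x => ‖x‖ ^ 2),
        integral_fun_snd (fun x => ‖x‖ ^ 2), integral_norm_sq_stdGaussian, add_comm]
      simp

end

variable {d : ℕ} {T : ℕ} {σ : ℕ → ℝ} {σ₁ : ℝ} {f : Euc d → ℝ} (pdata : Measure (Euc d))
  [IsProbabilityMeasure pdata]

lemma secondMoment_nonneg (μ : Measure (Euc d)) : 0 ≤ secondMoment μ :=
  integral_nonneg fun _ => by positivity

lemma sq_integral_sub_forwardLaw_le (hm : Integrable (fun x : Euc d => ‖x‖ ^ 2) pdata)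
    (h : IsVPSchedule T σ σ₁) (hf1 : ∀ x, |f x| ≤ 1) (hf : LipschitzWith 1 f) :
    (∫ x, f x ∂pdata - ∫ x, f x ∂(forwardLaw pdata σ 1)) ^ 2 ≤
      2 * σ₁ ^ 2 * (d + secondMoment pdata) := by
  have hσ0 : 0 < σ 1 := h.pos 1 le_rfl h.one_le
  have hσ1 : σ 1 < 1 := h.lt_one 1 le_rfl h.one_le
  have hnoise : |1 - vpAlphaBar σ 1| ≤ σ 1 := by
    have hsq : vpAlphaBar σ 1 ^ 2 = 1 - σ 1 ^ 2 := Real.sq_sqrt (by nlinarith)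
    have hnonneg : 0 ≤ vpAlphaBar σ 1 := Real.sqrt_nonneg _
    rw [abs_le]
    constructor <;> nlinarith
  have hfi : Integrable f pdata :=
    .of_bound hf.continuous.aestronglyMeasurable 1 (ae_of_all _ hf1)
  rw [forwardLaw_eq_map pdata h h.one_le, ← h.one,
    secondMoment]
  simpa only [finrank_euclideanSpace_fin] using sq_integral_sub_map_noise_le hm hf hfi hnoise

variable (μ : Measure (Euc d)) [IsProbabilityMeasure μ]

lemma ofReal_integral_sub_sq_le (hm : Integrable (fun x : Euc d => ‖x‖ ^ 2) pdata)
    (h : IsVPSchedule T σ σ₁) (hf1 : ∀ x, |f x| ≤ 1) (hf : LipschitzWith 1 f) :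
    ENNReal.ofReal (∫ x, f x ∂pdata - ∫ x, f x ∂μ) ^ 2 ≤
      ENNReal.ofReal (4 * σ₁ ^ 2 * (d + secondMoment pdata)) +
        24 * klDiv (forwardLaw pdata σ 1) μ := by
  have := isProbabilityMeasure_forwardLaw pdata h h.one_le
  have hM := secondMoment_nonneg pdata
  set a := ∫ x, f x ∂pdata - ∫ x, f x ∂(forwardLaw pdata σ 1)
  set b := ∫ x, f x ∂(forwardLaw pdata σ 1) - ∫ x, f x ∂μ
  have hab : ∫ x, f x ∂pdata - ∫ x, f x ∂μ = a + b := by ring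
  have hnoise : a ^ 2 ≤ 2 * σ₁ ^ 2 * (d + secondMoment pdata) :=
    sq_integral_sub_forwardLaw_le pdata hm h hf1 hf
  have hkl : ENNReal.ofReal (b ^ 2) ≤ 12 * klDiv (forwardLaw pdata σ 1) μ :=
    sq_integral_sub_le_klDiv _ _ hf.continuous.measurable hf1
  calc ENNReal.ofReal (∫ x, f x ∂pdata - ∫ x, f x ∂μ) ^ 2
      ≤ ENNReal.ofReal |a + b| ^ 2 := by rw [hab]; gcongr; exact le_abs_self _
    _ = ENNReal.ofReal ((a + b) ^ 2) := by rw [← ENNReal.ofReal_pow (abs_nonneg _), sq_abs]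
    _ ≤ ENNReal.ofReal (4 * σ₁ ^ 2 * (d + secondMoment pdata) + 2 * b ^ 2) :=
        ENNReal.ofReal_le_ofReal (by nlinarith [sq_nonneg (a - b)])
    _ = ENNReal.ofReal (4 * σ₁ ^ 2 * (d + secondMoment pdata)) + 2 * ENNReal.ofReal (b ^ 2) := by
        rw [ENNReal.ofReal_add (by positivity) (by positivity),
          ENNReal.ofReal_mul (by norm_num : (0 : ℝ) ≤ 2), ENNReal.ofReal_ofNat]
    _ ≤ ENNReal.ofReal (4 * σ₁ ^ 2 * (d + secondMoment pdata)) +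
          2 * (12 * klDiv (forwardLaw pdata σ 1) μ) := by gcongr
    _ = _ := by rw [← mul_assoc]; norm_num

lemma blDist_sq_le (hm : Integrable (fun x : Euc d => ‖x‖ ^ 2) pdata) (h : IsVPSchedule T σ σ₁) :
    blDist pdata μ ^ 2 ≤ ENNReal.ofReal (4 * σ₁ ^ 2 * (d + secondMoment pdata)) +
      24 * klDiv (forwardLaw pdata σ 1) μ := by
  rw [← ENNReal.rpow_two, ← ENNReal.le_rpow_inv_iff two_pos]
  refine iSup₂_le fun f hf => ?_
  rw [ENNReal.le_rpow_inv_iff two_pos, ENNReal.rpow_two]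
  exact ofReal_integral_sub_sq_le pdata μ hm h hf.1 hf.2

end BoundedLipschitz

section Queries

variable {d : ℕ} {B : ℝ} {s : ℕ → Euc d → Euc d} {σ : ℕ → ℝ} {T : ℕ}

lemma isProbabilityMeasure_samplerLaw (hs : ∀ t, Measurable (s t)) :
    IsProbabilityMeasure (samplerLaw B s σ T) :=
  have := isProbabilityMeasure_isoGaussian (0 : Euc d) (σ T ^ 2)
  isProbabilityMeasure_backwardLaw hs _

lemma isProbabilityMeasure_outputLaw (hs : ∀ t, Measurable (s t)) :
    IsProbabilityMeasure (outputLaw B s σ T) :=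
  have := isProbabilityMeasure_samplerLaw (B := B) (σ := σ) (T := T) hs
  Measure.isProbabilityMeasure_map measurable_fst.aemeasurable

lemma isProbabilityMeasure_queryLaw (hs : ∀ t, Measurable (s t)) :
    IsProbabilityMeasure (queryLaw B s σ T) :=
  have := isProbabilityMeasure_samplerLaw (B := B) (σ := σ) (T := T) hs
  Measure.isProbabilityMeasure_map measurable_snd.aemeasurable

lemma lintegral_exp_queryLaw_le (hB : 0 < B) (hs : ∀ t, Measurable (s t)) :
    ∫⁻ n : ℕ, ENNReal.ofReal (Real.exp (queryRate B * n)) ∂(queryLaw B s σ T) ≤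
      ENNReal.ofReal (Real.exp ((2 * B + Real.log 4) * T)) := by
  have := isProbabilityMeasure_isoGaussian (0 : Euc d) (σ T ^ 2)
  have hround : 4 * Real.exp (2 * B) = Real.exp (2 * B + Real.log 4) := by
    rw [Real.exp_add, Real.exp_log (by norm_num)]; ring
  have : 0 ≤ Real.log 4 := Real.log_nonneg (by norm_num)
  rw [queryLaw, samplerLaw, lintegral_map (by fun_prop) measurable_snd]
  refine (lintegral_exp_backwardLaw_le hB hs (T - 1)).trans ?_
  rw [← ENNReal.ofReal_pow (by positivity), hround, ← Real.exp_nat_mul, mul_comm]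
  gcongr
  exact Nat.sub_le _ _

lemma le_queryLaw (hB : 0 < B) (hs : ∀ t, Measurable (s t)) {ε x : ℝ} (hε : 0 < ε)
    (hx : (2 * B + Real.log 4) * T + Real.log (1 / ε) ≤ queryRate B * x) :
    ENNReal.ofReal (1 - ε) ≤ queryLaw B s σ T {n | (n : ℝ) ≤ x} := by
  have := isProbabilityMeasure_queryLaw (B := B) (σ := σ) (T := T) hs
  have htail : queryLaw B s σ T {n | (n : ℝ) ≤ x}ᶜ ≤ ENNReal.ofReal ε :=
    calc queryLaw B s σ T {n | (n : ℝ) ≤ x}ᶜ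
        ≤ queryLaw B s σ T {n | queryRate B * x ≤ queryRate B * n} :=
          measure_mono fun n hn => by
            simp only [Set.mem_compl_iff, Set.mem_ofPred_eq, not_le] at hn
            exact mul_le_mul_of_nonneg_left hn.le (queryRate_pos hB).le
      _ ≤ ENNReal.ofReal (Real.exp ((2 * B + Real.log 4) * T - queryRate B * x)) :=
          measure_setOf_le_of_lintegral_exp_le (by fun_prop) (lintegral_exp_queryLaw_le hB hs) _
      _ ≤ ENNReal.ofReal ε := by
          rw [one_div, Real.log_inv] at hx
          refine ENNReal.ofReal_le_ofReal ?_
          rw [← Real.le_log_iff_exp_le hε]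
          linarith
  rw [ENNReal.ofReal_sub _ hε.le, ENNReal.ofReal_one, tsub_le_iff_right]
  calc (1 : ℝ≥0∞) = queryLaw B s σ T {n | (n : ℝ) ≤ x} + queryLaw B s σ T {n | (n : ℝ) ≤ x}ᶜ := by
        rw [measure_add_measure_compl .of_discrete, measure_univ]
    _ ≤ queryLaw B s σ T {n | (n : ℝ) ≤ x} + ENNReal.ofReal ε := by gcongr

end Queries

section Schedule

/-- The ratio `σ_{n+1}² / (1 - σ_{n+1}²)` of noise to signal along `geomSchedule σ₀ h`. -/
def noiseRatio (σ₀ h : ℝ) (n : ℕ) : ℝ := σ₀ ^ 2 / (1 - σ₀ ^ 2) * (1 + h) ^ n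

/-- The noise schedule from `σ₀` along which the ratio of noise to signal grows by the factor
`1 + h` in each step, that is, `η_t = h σ_t²`. -/
def geomSchedule (σ₀ h : ℝ) : ℕ → ℝ
  | 0 => 0
  | n + 1 => √(noiseRatio σ₀ h n / (1 + noiseRatio σ₀ h n))

variable {σ₀ h : ℝ}

lemma geomSchedule_one (h0 : 0 < σ₀) (h1 : σ₀ < 1) : geomSchedule σ₀ h 1 = σ₀ := by
  have : 0 < 1 - σ₀ ^ 2 := by nlinarith
  have hsq : σ₀ ^ 2 / (1 - σ₀ ^ 2) / (1 + σ₀ ^ 2 / (1 - σ₀ ^ 2)) = σ₀ ^ 2 := by field_simp; ring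
  rw [geomSchedule, noiseRatio, pow_zero, mul_one, hsq, Real.sqrt_sq h0.le]

variable (h0 : 0 < σ₀) (h1 : σ₀ < 1) (hh : 0 < h)

include h0 h1 hh

lemma noiseRatio_pos (n : ℕ) : 0 < noiseRatio σ₀ h n := by
  have : 0 < 1 - σ₀ ^ 2 := by nlinarith
  rw [noiseRatio]
  positivity

lemma sq_geomSchedule_succ (n : ℕ) :
    geomSchedule σ₀ h (n + 1) ^ 2 = noiseRatio σ₀ h n / (1 + noiseRatio σ₀ h n) := by
  have := noiseRatio_pos h0 h1 hh n
  rw [geomSchedule, Real.sq_sqrt (by positivity)]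

lemma sq_vpAlphaBar_geomSchedule_succ (n : ℕ) :
    vpAlphaBar (geomSchedule σ₀ h) (n + 1) ^ 2 = 1 / (1 + noiseRatio σ₀ h n) := by
  have := noiseRatio_pos h0 h1 hh n
  have hsignal : 1 - noiseRatio σ₀ h n / (1 + noiseRatio σ₀ h n) =
      1 / (1 + noiseRatio σ₀ h n) := by
    field_simp
    ring
  rw [vpAlphaBar, sq_geomSchedule_succ h0 h1 hh, hsignal, Real.sq_sqrt (by positivity)]

lemma vpEta_geomSchedule_succ (n : ℕ) :
    vpEta (geomSchedule σ₀ h) (n + 1) = h * geomSchedule σ₀ h (n + 1) ^ 2 := by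
  have := noiseRatio_pos h0 h1 hh n
  have hsucc : noiseRatio σ₀ h (n + 1) = noiseRatio σ₀ h n * (1 + h) := by
    rw [noiseRatio, noiseRatio, pow_succ (1 + h), mul_assoc]
  simp only [vpEta, vpAlpha, div_pow, sq_vpAlphaBar_geomSchedule_succ h0 h1 hh,
    sq_geomSchedule_succ h0 h1 hh, hsucc]
  field_simp
  ring

lemma isVPSchedule_geomSchedule {T : ℕ} (hT : 1 ≤ T) : IsVPSchedule T (geomSchedule σ₀ h) σ₀ where
  one_le := hT
  zero := rfl
  one := geomSchedule_one h0 h1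
  pos
    | n + 1, _, _ => by
      have := noiseRatio_pos h0 h1 hh n
      exact Real.sqrt_pos.2 (by positivity)
  lt_one
    | n + 1, _, _ => by
      have := noiseRatio_pos h0 h1 hh n
      rw [geomSchedule, Real.sqrt_lt' one_pos, one_pow, div_lt_one (by positivity)]
      linarith
  eta_pos
    | 0, _ => by
      have : 0 < √(1 - σ₀ ^ 2) := Real.sqrt_pos.2 (by nlinarith)
      have hzero : geomSchedule σ₀ h 0 = 0 := rfl
      rw [vpEta, vpAlpha, vpAlphaBar, vpAlphaBar, zero_add, geomSchedule_one h0 h1, hzero,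
        zero_pow two_ne_zero, sub_zero, sub_zero, Real.sqrt_one, div_one]
      positivity
    | n + 1, _ => by
      have := noiseRatio_pos h0 h1 hh n
      rw [vpEta_geomSchedule_succ h0 h1 hh, sq_geomSchedule_succ h0 h1 hh]
      positivity

lemma sq_vpAlphaBar_div_geomSchedule_le (n : ℕ) :
    (vpAlphaBar (geomSchedule σ₀ h) (n + 1) / geomSchedule σ₀ h (n + 1)) ^ 2 ≤
      1 / (σ₀ ^ 2 * (1 + h) ^ n) := by
  have := noiseRatio_pos h0 h1 hh n
  have hratio : (vpAlphaBar (geomSchedule σ₀ h) (n + 1) / geomSchedule σ₀ h (n + 1)) ^ 2 =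
      1 / noiseRatio σ₀ h n := by
    rw [div_pow, sq_vpAlphaBar_geomSchedule_succ h0 h1 hh, sq_geomSchedule_succ h0 h1 hh]
    field_simp
  rw [hratio, noiseRatio]
  refine one_div_le_one_div_of_le (by positivity) ?_
  gcongr
  exact le_div_self (sq_nonneg _) (by nlinarith) (by linarith [sq_nonneg σ₀])

end Schedule

section StepSize

/-- The step size in units of `1 / (a L)`, see `stepSize`. -/
def stepConst (B : ℝ) : ℝ := min (B ^ 2 / 580) (min (B / 144) (1 / 4))

/-- The ratio `η_t / σ_t²` of the schedule. It is used with `a = d + log (1 / δ)` and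
`L = log (κ / δ)`. -/
def stepSize (B a L : ℝ) : ℝ := stepConst B / (a * L)

/-- The number of steps of size `stepSize B a L` which take the noise level from `σ₀` to its final
value. -/
def stepCount (B a L : ℝ) : ℕ := ⌈4 * L / stepSize B a L⌉₊

/-- The factor between the number of noise levels and `a L²`. -/
def lengthConst (B : ℝ) : ℝ := 8 + 4 / stepConst B

/-- The exponent, up to a numerical factor, in the probability that a step of size
`stepSize B a L` is not good. -/
def tailExponent (a L : ℝ) : ℝ := √(min a L * L)

/-- The factor of `exp (-4 * tailExponent a L)` in the divergence contributed by the states and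
seeds of a single step which are not good. -/
def stepFailConst (B : ℝ) : ℝ :=
  (Real.exp B + 1) * (2 + Real.exp B) + 6 * (B ^ 2 + 3 * Real.exp 1)

variable {a L l B : ℝ}

lemma stepConst_pos (hB : 0 < B) : 0 < stepConst B := by
  rw [stepConst]
  positivity

lemma stepFailConst_pos (B : ℝ) : 0 < stepFailConst B := by
  rw [stepFailConst]
  positivity

lemma stepConst_le_sq_div : stepConst B ≤ B ^ 2 / 580 := min_le_left _ _

lemma stepConst_le_div : stepConst B ≤ B / 144 := (min_le_right _ _).trans (min_le_left _ _)

lemma stepConst_le_quarter : stepConst B ≤ 1 / 4 := (min_le_right _ _).trans (min_le_right _ _)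

lemma lengthConst_pos (hB : 0 < B) : 0 < lengthConst B := by
  have := stepConst_pos hB
  rw [lengthConst]
  positivity

lemma tailExponent_nonneg : 0 ≤ tailExponent a L := Real.sqrt_nonneg _

lemma le_tailExponent (hl : 0 ≤ l) (hla : l ≤ a) (hlL : l ≤ L) : l ≤ tailExponent a L := by
  refine Real.le_sqrt_of_sq_le ?_
  rw [sq]
  exact mul_le_mul (le_min hla hlL) hlL hl (hl.trans (le_min hla hlL))

lemma tailExponent_le (hL : 0 ≤ L) : tailExponent a L ≤ L := by
  refine Real.sqrt_le_iff.2 ⟨hL, ?_⟩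
  rw [sq]
  gcongr
  exact min_le_right _ _

variable (ha : 1 ≤ a) (hL : 1 / 2 ≤ L)

include ha hL

lemma sq_tailExponent_le : tailExponent a L ^ 2 ≤ a * L := by
  rw [tailExponent, Real.sq_sqrt (mul_nonneg (le_min (by linarith) (by linarith)) (by linarith))]
  gcongr
  exact min_le_left _ _

/- The tail absorbs the factor `a L²` from the number of steps: if `a ≤ L`, this factor is at most
the fourth power of the exponent, and otherwise the exponent is `L` itself. -/
lemma mul_sq_le_exp_tailExponent (haL : a ≤ 2 * Real.exp L) :
    a * L ^ 2 ≤ 24 * Real.exp (2 * tailExponent a L) := by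
  rcases le_total a L with h | h
  · have hS : tailExponent a L ^ 2 = a * L := by
      rw [tailExponent, min_eq_left h, Real.sq_sqrt (by positivity)]
    set S := tailExponent a L
    have hS0 : 0 ≤ S := tailExponent_nonneg
    have hfour : S ^ 4 / 24 ≤ Real.exp S := by
      simpa [Nat.factorial] using Real.pow_div_factorial_le_exp S hS0 4
    calc a * L ^ 2 = 1 * (a * L ^ 2) := (one_mul _).symm
      _ ≤ a * (a * L ^ 2) := by gcongr
      _ = (S ^ 2) ^ 2 := by rw [hS]; ring
      _ = S ^ 4 := by ring
      _ ≤ 24 * Real.exp S := by linarith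
      _ ≤ 24 * Real.exp (2 * S) := by gcongr; linarith
  · rw [tailExponent, min_eq_right h, Real.sqrt_mul_self (by linarith)]
    calc a * L ^ 2 ≤ (2 * Real.exp L) * (2 * Real.exp L) := by
          gcongr
          exact sq_le_two_mul_exp (by linarith)
      _ = 4 * Real.exp (2 * L) := by rw [two_mul L, Real.exp_add]; ring
      _ ≤ 24 * Real.exp (2 * L) := by gcongr; norm_num

lemma mul_sq_mul_exp_neg_tailExponent_le (haL : a ≤ 2 * Real.exp L)
    (hl : l ≤ tailExponent a L) :
    a * L ^ 2 * Real.exp (-4 * tailExponent a L) ≤ 24 * Real.exp (-l) ^ 2 := by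
  have hpoly := mul_sq_le_exp_tailExponent ha hL haL
  set S := tailExponent a L
  calc a * L ^ 2 * Real.exp (-4 * S) ≤ 24 * Real.exp (2 * S) * Real.exp (-4 * S) := by gcongr
    _ = 24 * Real.exp (-S) ^ 2 := by
        rw [mul_assoc, ← Real.exp_add, ← Real.exp_nat_mul]
        push_cast
        ring_nf
    _ ≤ 24 * Real.exp (-l) ^ 2 := by gcongr

lemma stepSize_le_half : stepSize B a L ≤ 1 / 2 := by
  rw [stepSize, div_le_iff₀ (by positivity)]
  nlinarith [stepConst_le_quarter (B := B)]

lemma stepSize_mul_le_one : stepSize B a L * a ≤ 1 := by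
  rw [stepSize, div_mul_eq_mul_div, div_le_one (by positivity)]
  calc stepConst B * a ≤ 1 / 4 * a := by gcongr; exact stepConst_le_quarter
    _ ≤ a * L := by nlinarith

variable (hB : 0 < B)

include hB

lemma stepSize_pos : 0 < stepSize B a L := by
  have := stepConst_pos hB
  rw [stepSize]
  positivity

lemma le_stepCount_mul_stepSize : 4 * L ≤ stepCount B a L * stepSize B a L :=
  (div_le_iff₀ (stepSize_pos ha hL hB)).1 (Nat.le_ceil _)

lemma stepCount_add_one_le : (stepCount B a L : ℝ) + 1 ≤ lengthConst B * (a * L ^ 2) := by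
  have hc := stepConst_pos hB
  have hh := stepSize_pos ha hL hB
  have hceil := Nat.ceil_lt_add_one (show 0 ≤ 4 * L / stepSize B a L by positivity)
  have hquot : 4 * L / stepSize B a L = 4 / stepConst B * (a * L ^ 2) := by
    rw [stepSize]
    field_simp
  rw [stepCount, lengthConst]
  nlinarith

lemma sq_mul_stepSize_le :
    (17 * tailExponent a L / B) ^ 2 * stepSize B a L ≤ tailExponent a L ^ 2 / (a * L) / 2 := by
  have hcB : 289 * stepConst B / B ^ 2 ≤ 1 / 2 := by
    rw [div_le_iff₀ (by positivity)]
    linarith [stepConst_le_sq_div (B := B), sq_nonneg B]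
  calc (17 * tailExponent a L / B) ^ 2 * stepSize B a L
      = 289 * stepConst B / B ^ 2 * (tailExponent a L ^ 2 / (a * L)) := by
        rw [stepSize]
        field_simp
        ring
    _ ≤ 1 / 2 * (tailExponent a L ^ 2 / (a * L)) := by gcongr
    _ = tailExponent a L ^ 2 / (a * L) / 2 := by ring

lemma mul_le_div_stepSize : 18 * (a * L) ≤ B / 2 / (4 * stepSize B a L) := by
  have hh := stepSize_pos ha hL hB
  rw [le_div_iff₀ (by positivity)]
  calc 18 * (a * L) * (4 * stepSize B a L) = 72 * stepConst B := by
        rw [stepSize]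
        field_simp
        ring
    _ ≤ B / 2 := by linarith [stepConst_le_div (B := B)]

variable {d : ℕ} {p : Euc d → ℝ} {σ η : ℝ} (hd : (d : ℝ) ≤ a) (hp : LogSmooth p σ)
  (hp1 : ∫⁻ x, ENNReal.ofReal (p x) = 1) (hσ : 0 < σ) (hη : η = stepSize B a L * σ ^ 2)

include hd hp hp1 hσ hη

lemma measure_compl_goodStep_le_exp_tailExponent :
    stateNoise p (goodStep p η (stepSize B a L) (B / 2))ᶜ ≤
      ENNReal.ofReal ((2 + Real.exp B) * Real.exp (-8 * tailExponent a L)) := by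
  have hS : 0 < tailExponent a L :=
    (show (0 : ℝ) < 1 / 2 by norm_num).trans_le (le_tailExponent (by norm_num) (by linarith) hL)
  have hSL : tailExponent a L ≤ L := tailExponent_le (by linarith)
  have hrate := sq_mul_stepSize_le ha hL hB
  have hSaL := sq_tailExponent_le ha hL
  have hnorm := mul_le_div_stepSize ha hL hB
  set S := tailExponent a L
  have hhalf : (17 * S / B) ^ 2 * stepSize B a L ≤ 1 / 2 :=
    hrate.trans (by gcongr; exact (div_le_one (by positivity)).2 hSaL)
  have hdim : (17 * S / B) ^ 2 * stepSize B a L * d ≤ S / 2 :=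
    calc (17 * S / B) ^ 2 * stepSize B a L * d ≤ S ^ 2 / (a * L) / 2 * a := by gcongr
      _ = S * (S / L) / 2 := by field_simp
      _ ≤ S * 1 / 2 := by gcongr; exact (div_le_one (by linarith)).2 hSL
      _ = S / 2 := by rw [mul_one]
  have hscore : Real.exp ((17 * S / B) ^ 2 * stepSize B a L * d - 17 * S / B * (B / 2)) ≤
      Real.exp (-8 * S) := by
    have : 17 * S / B * (B / 2) = 17 / 2 * S := by field_simp
    gcongr
    linarith
  have hnoise : Real.exp (d / 2 - B / 2 / (4 * stepSize B a L)) ≤ Real.exp (-8 * S) := by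
    gcongr
    nlinarith
  refine (measure_compl_goodStep_le hp hp1 hσ (stepSize_pos ha hL hB) hη (by positivity)
    (c := 17 * S / B) (by positivity) hhalf).trans (ENNReal.ofReal_le_ofReal ?_)
  rw [finrank_euclideanSpace_fin, mul_div_cancel₀ B two_ne_zero]
  nlinarith [Real.exp_pos B]

lemma klDiv_reverseStep_weightedStep_le_exp_tailExponent {s : Euc d → Euc d} (hs : Measurable s) :
    klDiv (reverseStep p η) (weightedStep B s p η) ≤
      ENNReal.ofReal (Real.exp (3 * B)) * (ENNReal.ofReal η *
        ∫⁻ x, ENNReal.ofReal (p x) * ‖s x - gradient (fun y => Real.log (p y)) x‖ₑ ^ 2) +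
      ENNReal.ofReal (stepFailConst B * Real.exp (-4 * tailExponent a L)) := by
  have hh := stepSize_pos ha hL hB
  have hhd : stepSize B a L * d ≤ 1 :=
    (mul_le_mul_of_nonneg_left hd hh.le).trans (stepSize_mul_le_one ha hL)
  have hbad := measure_compl_goodStep_le_exp_tailExponent ha hL hB hd hp hp1 hσ hη
  have hS : 0 ≤ tailExponent a L := tailExponent_nonneg
  set S := tailExponent a L
  have he : Real.exp (-8 * S) = Real.exp (-4 * S) * Real.exp (-4 * S) := by
    rw [← Real.exp_add]
    ring_nf
  have he1 : Real.exp (-4 * S) ≤ 1 := Real.exp_le_one_iff.2 (by linarith)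
  refine (klDiv_reverseStep_weightedStep_le (τ := Real.exp (-4 * S)) hp hp1 hs hσ hB.le hh.le hη
    (stepSize_le_half ha hL) hhd (Real.exp_pos _) (by positivity) hbad).trans ?_
  gcongr
  have : 0 < Real.exp (-4 * S) := Real.exp_pos _
  rw [he, stepFailConst]
  set x := Real.exp (-4 * S)
  calc Real.exp B * ((2 + Real.exp B) * (x * x)) + (x * (6 * (B ^ 2 + 3 * Real.exp 1)) +
        1 / x * ((2 + Real.exp B) * (x * x)))
      = ((Real.exp B * x + 1) * (2 + Real.exp B) + 6 * (B ^ 2 + 3 * Real.exp 1)) * x := by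
        field_simp
        ring
    _ ≤ ((Real.exp B * 1 + 1) * (2 + Real.exp B) + 6 * (B ^ 2 + 3 * Real.exp 1)) * x := by gcongr
    _ = _ := by rw [mul_one]

end StepSize

section Convergence

lemma exp_mul_half_le_one_add_pow {h : ℝ} (hh0 : 0 ≤ h) (hh2 : h ≤ 2) (n : ℕ) :
    Real.exp (n * (h / 2)) ≤ (1 + h) ^ n := by
  have hlog : h / 2 ≤ Real.log (1 + h) := by
    refine le_trans ?_ (Real.le_log_one_add_of_nonneg hh0)
    rw [div_le_div_iff₀ two_pos (by linarith)]
    nlinarith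
  rw [Real.exp_nat_mul]
  gcongr
  exact (Real.le_log_iff_exp_le (by linarith)).1 hlog

lemma le_add_secondMoment_div_sq {d : ℕ} {σ₀ : ℝ} (pdata : Measure (Euc d)) (h0 : 0 < σ₀)
    (h1 : σ₀ < 1) :
    (d : ℝ) ≤ (d + secondMoment pdata) / σ₀ ^ 2 := by
  have hM := secondMoment_nonneg pdata
  rw [le_div_iff₀ (by positivity)]
  nlinarith [mul_le_of_le_one_right (Nat.cast_nonneg (α := ℝ) d) (pow_le_one₀ h0.le h1.le (n := 2))]

lemma scoreErrorSq_forwardLaw {d : ℕ} {s : Euc d → Euc d} (hs : Measurable s)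
    {pdata : Measure (Euc d)} [IsProbabilityMeasure pdata] {T t : ℕ} {σ : ℕ → ℝ} {σ₁ : ℝ}
    (hσ : IsVPSchedule T σ σ₁) (h1 : 1 ≤ t) (ht : t ≤ T) :
    scoreErrorSq (forwardLaw pdata σ t) s =
      ∫⁻ x, ENNReal.ofReal (forwardDensity pdata σ t x) *
        ‖s x - gradient (fun y => Real.log (forwardDensity pdata σ t y)) x‖ₑ ^ 2 := by
  have hp := logSmooth_forwardDensity pdata hσ h1 ht
  have hmeas : Measurable fun x =>
      ‖s x - gradient (fun y => Real.log (forwardDensity pdata σ t y)) x‖ₑ ^ 2 :=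
    ((hs.sub (measurable_gradient _)).enorm).pow_const 2
  rw [scoreErrorSq, score_forwardLaw pdata hσ h1 ht, forwardLaw_eq_withDensity pdata hσ h1 ht,
    lintegral_withDensity_eq_lintegral_mul _ hp.diff.continuous.measurable.ennreal_ofReal hmeas]
  rfl

variable {d : ℕ} {B a L σ₀ δ : ℝ} {pdata : Measure (Euc d)} [IsProbabilityMeasure pdata]

lemma klDiv_outputLaw_le (hB : 0 < B) {s : ℕ → Euc d → Euc d} (hs : ∀ t, Measurable (s t))
    {T : ℕ} {σ : ℕ → ℝ} (hσ : IsVPSchedule T σ σ₀) (hd : (d : ℝ) ≤ a) (ha : 1 ≤ a)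
    (hL : 1 / 2 ≤ L) (hη : ∀ n, vpEta σ (n + 1) = stepSize B a L * σ (n + 1) ^ 2) :
    klDiv (forwardLaw pdata σ 1) (outputLaw B s σ T) ≤
      klDiv (forwardLaw pdata σ T) (isoGaussian 0 (σ T ^ 2)) +
      (ENNReal.ofReal (Real.exp (3 * B)) * totalScoreError pdata s σ T +
        T * ENNReal.ofReal (stepFailConst B * Real.exp (-4 * tailExponent a L))) := by
  have := isProbabilityMeasure_isoGaussian (0 : Euc d) (σ T ^ 2)
  have hT := hσ.one_le
  have hstep (t : ℕ) (ht : t ∈ Finset.Ico 1 T) :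
      klDiv (reverseStep (forwardDensity pdata σ t) (vpEta σ t))
          (weightedStep B (s t) (forwardDensity pdata σ t) (vpEta σ t)) ≤
        ENNReal.ofReal (Real.exp (3 * B)) *
          (ENNReal.ofReal (vpEta σ t) * scoreErrorSq (forwardLaw pdata σ t) (s t)) +
        ENNReal.ofReal (stepFailConst B * Real.exp (-4 * tailExponent a L)) := by
    obtain ⟨h1, htT⟩ := Finset.mem_Ico.1 ht
    rw [scoreErrorSq_forwardLaw (hs t) hσ h1 htT.le]
    refine klDiv_reverseStep_weightedStep_le_exp_tailExponent ha hL hB hd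
      (logSmooth_forwardDensity pdata hσ h1 htT.le) (lintegral_forwardDensity hσ h1 htT.le)
      (hσ.pos t h1 htT.le) ?_ (hs t)
    obtain ⟨n, rfl⟩ := Nat.exists_eq_add_of_le' h1
    exact hη n
  have hchain := klDiv_forwardLaw_backwardState_le (pdata := pdata)
    (init := isoGaussian 0 (σ T ^ 2)) hB hs hσ (show T - 1 < T by omega)
  rw [show T - (T - 1) = 1 by omega] at hchain
  refine hchain.trans (add_le_add_right ((Finset.sum_le_sum hstep).trans ?_) _)
  rw [Finset.sum_add_distrib, ← Finset.mul_sum, Finset.sum_const, Nat.card_Ico, nsmul_eq_mul]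
  gcongr
  exacts [le_rfl, Nat.sub_le T 1]

lemma klDiv_forwardLaw_geomSchedule_le (hd : 1 ≤ d)
    (hm : Integrable (fun x : Euc d => ‖x‖ ^ 2) pdata) (h0 : 0 < σ₀) (h1 : σ₀ < 1) (hδ : 0 < δ)
    {h : ℝ} (hh0 : 0 < h) (hh2 : h ≤ 2) {n : ℕ}
    (hn : 4 * Real.log ((d + secondMoment pdata) / σ₀ ^ 2 / δ) ≤ n * h) :
    klDiv (forwardLaw pdata (geomSchedule σ₀ h) (n + 1))
      (isoGaussian 0 (geomSchedule σ₀ h (n + 1) ^ 2)) ≤ ENNReal.ofReal (δ ^ 2) := by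
  refine (klDiv_forwardLaw_isoGaussian_le pdata hm
    (isVPSchedule_geomSchedule h0 h1 hh0 (Nat.le_add_left 1 n))).trans (ENNReal.ofReal_le_ofReal ?_)
  have hM := secondMoment_nonneg pdata
  have hκ1 : 1 ≤ (d + secondMoment pdata) / σ₀ ^ 2 :=
    (Nat.one_le_cast.2 hd).trans (le_add_secondMoment_div_sq pdata h0 h1)
  set M := secondMoment pdata
  set κ := (d + M) / σ₀ ^ 2 with hκ
  have hgrowth : (κ / δ) ^ 2 ≤ (1 + h) ^ n := by
    refine le_trans ?_ (exp_mul_half_le_one_add_pow hh0.le hh2 n)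
    rw [← Real.exp_log (show 0 < κ / δ by positivity), ← Real.exp_nat_mul]
    refine Real.exp_le_exp.2 ?_
    push_cast
    linarith
  have hMle : M ≤ δ ^ 2 * (σ₀ ^ 2 * (1 + h) ^ n) :=
    calc M ≤ d + M := le_add_of_nonneg_left d.cast_nonneg
      _ = σ₀ ^ 2 * κ := by rw [hκ]; field_simp
      _ ≤ σ₀ ^ 2 * κ ^ 2 := by gcongr; exact le_self_pow₀ hκ1 two_ne_zero
      _ = δ ^ 2 * (σ₀ ^ 2 * (κ / δ) ^ 2) := by field_simp
      _ ≤ δ ^ 2 * (σ₀ ^ 2 * (1 + h) ^ n) := by gcongr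
  calc (vpAlphaBar (geomSchedule σ₀ h) (n + 1) / geomSchedule σ₀ h (n + 1)) ^ 2 * M / 2
      ≤ 1 / (σ₀ ^ 2 * (1 + h) ^ n) * M / 2 := by
        gcongr
        exact sq_vpAlphaBar_div_geomSchedule_le h0 h1 hh0 n
    _ = M / (σ₀ ^ 2 * (1 + h) ^ n) / 2 := by ring
    _ ≤ δ ^ 2 / 2 := by
        gcongr
        exact (div_le_iff₀ (by positivity)).2 hMle
    _ ≤ δ ^ 2 := half_le_self (sq_nonneg δ)

/-- The constant in the bound on the divergence of the output law. -/
def klConst (B : ℝ) : ℝ := 1 + Real.exp (3 * B) + 24 * stepFailConst B * lengthConst B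

lemma klConst_pos (hB : 0 < B) : 0 < klConst B := by
  have := lengthConst_pos hB
  have := stepFailConst_pos B
  rw [klConst]
  positivity

lemma add_add_le_klConst_mul (hB : 0 < B) {x : ℝ} (hx : 0 ≤ x) (e : ℝ≥0∞) :
    ENNReal.ofReal x + (ENNReal.ofReal (Real.exp (3 * B)) * e +
      ENNReal.ofReal (24 * stepFailConst B * lengthConst B * x)) ≤
      ENNReal.ofReal (klConst B) * (ENNReal.ofReal x + e) := by
  have hF := stepFailConst_pos B
  have hC := lengthConst_pos hB
  calc ENNReal.ofReal x + (ENNReal.ofReal (Real.exp (3 * B)) * e +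
        ENNReal.ofReal (24 * stepFailConst B * lengthConst B * x))
      = ENNReal.ofReal (1 + 24 * stepFailConst B * lengthConst B) * ENNReal.ofReal x +
          ENNReal.ofReal (Real.exp (3 * B)) * e := by
        rw [← ENNReal.ofReal_mul (by positivity), one_add_mul,
          ENNReal.ofReal_add hx (by positivity), add_assoc, add_comm (ENNReal.ofReal _ * e)]
    _ ≤ ENNReal.ofReal (klConst B) * ENNReal.ofReal x + ENNReal.ofReal (klConst B) * e := by
        rw [klConst]
        gcongr
        · linarith [Real.exp_pos (3 * B)]
        · linarith [mul_pos hF hC]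
    _ = ENNReal.ofReal (klConst B) * (ENNReal.ofReal x + e) := (mul_add _ _ _).symm

lemma half_le_log_one_div (hδ : 0 < δ) (hδ2 : δ ≤ 1 / 2) : 1 / 2 ≤ Real.log (1 / δ) := by
  have hlog : Real.log 2 ≤ Real.log (1 / δ) :=
    Real.log_le_log two_pos ((le_div_iff₀ hδ).2 (by linarith))
  linarith [Real.log_two_gt_d9]

lemma add_log_one_div_le_exp_log {x κ : ℝ} (hδ : 0 < δ) (hδ1 : δ ≤ 1) (hx : x ≤ κ) (hκ : 1 ≤ κ) :
    x + Real.log (1 / δ) ≤ 2 * Real.exp (Real.log (κ / δ)) := by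
  have hlog : Real.log (1 / δ) ≤ Real.log (κ / δ) := Real.log_le_log (by positivity) (by gcongr)
  have hexp : Real.exp (Real.log (κ / δ)) = κ / δ := Real.exp_log (by positivity)
  have hκδ : κ ≤ κ / δ := le_div_self (by positivity) hδ hδ1
  linarith [Real.add_one_le_exp (Real.log (κ / δ))]

lemma stepCount_mul_stepFailConst_le (hB : 0 < B) (ha : 1 ≤ a) (hL : 1 / 2 ≤ L)
    (haL : a ≤ 2 * Real.exp L) (hδ : 0 < δ) (hδS : Real.log (1 / δ) ≤ tailExponent a L) :
    (stepCount B a L + 1) * (stepFailConst B * Real.exp (-4 * tailExponent a L)) ≤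
      24 * stepFailConst B * lengthConst B * δ ^ 2 := by
  have hF := stepFailConst_pos B
  have hC := lengthConst_pos hB
  have htail := mul_sq_mul_exp_neg_tailExponent_le ha hL haL hδS
  rw [one_div, Real.log_inv, neg_neg, Real.exp_log hδ] at htail
  set S := tailExponent a L
  calc (stepCount B a L + 1) * (stepFailConst B * Real.exp (-4 * S))
      ≤ lengthConst B * (a * L ^ 2) * (stepFailConst B * Real.exp (-4 * S)) := by
        gcongr
        exact stepCount_add_one_le ha hL hB
    _ = stepFailConst B * lengthConst B * (a * L ^ 2 * Real.exp (-4 * S)) := by ring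
    _ ≤ stepFailConst B * lengthConst B * (24 * δ ^ 2) := by gcongr
    _ = 24 * stepFailConst B * lengthConst B * δ ^ 2 := by ring

lemma exists_schedule_klDiv_le (hB : 0 < B) (hd : 1 ≤ d)
    (hm : Integrable (fun x : Euc d => ‖x‖ ^ 2) pdata) (hδ : 0 < δ) (hδ2 : δ ≤ 1 / 2)
    (h0 : 0 < σ₀) (h1 : σ₀ < 1) :
    ∃ (T : ℕ) (σ : ℕ → ℝ), IsVPSchedule T σ σ₀ ∧ Real.log (1 / δ) ≤ T ∧
      (T : ℝ) ≤ lengthConst B * ((d + Real.log (1 / δ)) *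
        Real.log ((d + secondMoment pdata) / σ₀ ^ 2 / δ) ^ 2) ∧
      ∀ s : ℕ → Euc d → Euc d, (∀ t, Measurable (s t)) →
        klDiv (forwardLaw pdata σ 1) (outputLaw B s σ T) ≤
          ENNReal.ofReal (klConst B) *
            (ENNReal.ofReal (δ ^ 2) + totalScoreError pdata s σ T) := by
  have hd1 : (1 : ℝ) ≤ d := Nat.one_le_cast.2 hd
  have hdκ := le_add_secondMoment_div_sq pdata h0 h1
  have hl := half_le_log_one_div hδ hδ2
  have haL := add_log_one_div_le_exp_log hδ (by linarith) hdκ (hd1.trans hdκ)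
  set κ := (d + secondMoment pdata) / σ₀ ^ 2
  set l := Real.log (1 / δ)
  set L := Real.log (κ / δ)
  set a := d + l
  have hlL : l ≤ L := Real.log_le_log (by positivity) (by gcongr; exact hd1.trans hdκ)
  have ha : 1 ≤ a := by linarith
  have hL : 1 / 2 ≤ L := hl.trans hlL
  have hh := stepSize_pos ha hL hB
  have hh2 := stepSize_le_half (B := B) ha hL
  have hn := le_stepCount_mul_stepSize ha hL hB
  have hinit := klDiv_forwardLaw_geomSchedule_le hd hm h0 h1 hδ hh (by linarith) hn
  have htail := stepCount_mul_stepFailConst_le hB ha hL haL hδ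
    (le_tailExponent (by linarith) (by linarith) hlL)
  refine ⟨stepCount B a L + 1, geomSchedule σ₀ (stepSize B a L),
    isVPSchedule_geomSchedule h0 h1 hh (by omega), ?_, ?_, fun s hs => ?_⟩
  · push_cast
    nlinarith
  · push_cast
    exact stepCount_add_one_le ha hL hB
  refine (klDiv_outputLaw_le hB hs (isVPSchedule_geomSchedule h0 h1 hh (by omega)) (by linarith)
    ha hL (vpEta_geomSchedule_succ h0 h1 hh)).trans
    (le_trans ?_ (add_add_le_klConst_mul hB (sq_nonneg δ) _))
  rw [← ENNReal.ofReal_natCast, ← ENNReal.ofReal_mul (Nat.cast_nonneg _)]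
  push_cast
  gcongr

end Convergence

section QueryBounds

/-- The constant in the bound on the number of queries. -/
def queryConst (B : ℝ) : ℝ := (2 * B + Real.log 4 + 1) / queryRate B

variable {d : ℕ} {B C : ℝ} {s : ℕ → Euc d → Euc d} {σ : ℕ → ℝ} {T : ℕ}

lemma le_queryLaw_mul (hB : 0 < B) (hC : queryConst B ≤ C) (hs : ∀ t, Measurable (s t)) {δ : ℝ}
    (hδ : 0 < δ) (hT : Real.log (1 / δ) ≤ T) :
    ENNReal.ofReal (1 - δ) ≤ queryLaw B s σ T {n | (n : ℝ) ≤ C * T} := by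
  have hrate : 2 * B + Real.log 4 + 1 ≤ C * queryRate B := (div_le_iff₀ (queryRate_pos hB)).1 hC
  refine le_queryLaw hB hs hδ ?_
  calc (2 * B + Real.log 4) * T + Real.log (1 / δ) ≤ (2 * B + Real.log 4 + 1) * T := by linarith
    _ ≤ C * queryRate B * T := by gcongr
    _ = queryRate B * (C * T) := by ring

lemma le_queryLaw_mul_add (hB : 0 < B) (hC : queryConst B ≤ C) (hs : ∀ t, Measurable (s t))
    {ε : ℝ} (hε : 0 < ε) (hε1 : ε ≤ 1) :
    ENNReal.ofReal (1 - ε) ≤ queryLaw B s σ T {n | (n : ℝ) ≤ C * (T + Real.log (1 / ε))} := by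
  have hrate : 2 * B + Real.log 4 + 1 ≤ C * queryRate B := (div_le_iff₀ (queryRate_pos hB)).1 hC
  have hlog : 0 ≤ Real.log (1 / ε) := Real.log_nonneg (one_le_one_div hε hε1)
  have : 0 ≤ Real.log 4 := Real.log_nonneg (by norm_num)
  refine le_queryLaw hB hs hε ?_
  calc (2 * B + Real.log 4) * T + Real.log (1 / ε)
      ≤ (2 * B + Real.log 4 + 1) * (T + Real.log (1 / ε)) := by
        have : 0 ≤ (2 * B + Real.log 4) * Real.log (1 / ε) := by positivity
        linarith [T.cast_nonneg (α := ℝ)]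
    _ ≤ C * queryRate B * (T + Real.log (1 / ε)) := by gcongr
    _ = queryRate B * (C * (T + Real.log (1 / ε))) := by ring

lemma le_queryLaw_and_forall_le_queryLaw (hB : 0 < B) (hC : queryConst B ≤ C)
    (hs : ∀ t, Measurable (s t)) {δ : ℝ} (hδ : 0 < δ) (hT : Real.log (1 / δ) ≤ T) :
    ENNReal.ofReal (1 - δ) ≤ queryLaw B s σ T {n | (n : ℝ) ≤ C * T} ∧
      ∀ ε : ℝ, 0 < ε → ε < 1 →
        ENNReal.ofReal (1 - ε) ≤ queryLaw B s σ T {n | (n : ℝ) ≤ C * (T + Real.log (1 / ε))} :=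
  ⟨le_queryLaw_mul hB hC hs hδ hT, fun _ hε hε1 => le_queryLaw_mul_add hB hC hs hε hε1.le⟩

end QueryBounds

section DataDistribution

lemma div_sqrt_lt_one {A δ : ℝ} (hA : 1 ≤ A) (hδ1 : δ < 1) : δ / √A < 1 :=
  (div_lt_one (by positivity)).2 (hδ1.trans_le (Real.one_le_sqrt.2 hA))

lemma sq_log_div_sq_div_sqrt_le {A δ : ℝ} (hA : 1 ≤ A) (hδ : 0 < δ) (hδ1 : δ ≤ 1) :
    Real.log (A / (δ / √A) ^ 2 / δ) ^ 2 ≤ 4 * Real.log (A / δ ^ 2) ^ 2 := by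
  have hcube : A / (δ / √A) ^ 2 / δ = A ^ 2 / δ ^ 3 := by
    rw [div_pow, Real.sq_sqrt (by linarith)]
    field_simp
  have hone : 1 ≤ A ^ 2 / δ ^ 3 :=
    (one_le_div (by positivity)).2 ((pow_le_one₀ hδ.le hδ1).trans (one_le_pow₀ hA))
  have hle : A ^ 2 / δ ^ 3 ≤ (A / δ ^ 2) ^ 2 := by
    rw [div_pow, ← pow_mul]
    gcongr A ^ 2 / ?_
    exact pow_le_pow_of_le_one hδ.le hδ1 (by norm_num)
  calc Real.log (A / (δ / √A) ^ 2 / δ) ^ 2 ≤ Real.log ((A / δ ^ 2) ^ 2) ^ 2 := by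
        rw [hcube]
        gcongr
        exact Real.log_nonneg hone
    _ = 4 * Real.log (A / δ ^ 2) ^ 2 := by
        rw [Real.log_pow]
        push_cast
        ring

lemma mul_add_mul_sq_log_le {A δ x l K C : ℝ} (hA : 1 ≤ A) (hδ : 0 < δ) (hδ1 : δ ≤ 1)
    (hx : 0 ≤ x) (hK : 0 ≤ K) (hC : 8 * K ≤ C) :
    K * ((x + l) * Real.log (A / (δ / √A) ^ 2 / δ) ^ 2) ≤
      C * max x l * Real.log (A / δ ^ 2) ^ 2 := by
  have hmax : x + l ≤ 2 * max x l := by linarith [le_max_left x l, le_max_right x l]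
  have : 0 ≤ max x l := le_max_of_le_left hx
  calc K * ((x + l) * Real.log (A / (δ / √A) ^ 2 / δ) ^ 2)
      ≤ K * (2 * max x l * (4 * Real.log (A / δ ^ 2) ^ 2)) := by
        gcongr
        exact sq_log_div_sq_div_sqrt_le hA hδ hδ1
    _ = 8 * K * max x l * Real.log (A / δ ^ 2) ^ 2 := by ring
    _ ≤ C * max x l * Real.log (A / δ ^ 2) ^ 2 := by gcongr

lemma blDist_sq_le_of_klDiv_le {d T : ℕ} {σ : ℕ → ℝ} {δ C : ℝ} {pdata μ : Measure (Euc d)}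
    [IsProbabilityMeasure pdata] [IsProbabilityMeasure μ] {e : ℝ≥0∞}
    (hm : Integrable (fun x : Euc d => ‖x‖ ^ 2) pdata)
    (hσ : IsVPSchedule T σ (δ / √(d + secondMoment pdata)))
    (hA : 1 ≤ d + secondMoment pdata) (hC : 0 ≤ C)
    (hkl : klDiv (forwardLaw pdata σ 1) μ ≤ ENNReal.ofReal C * (ENNReal.ofReal (δ ^ 2) + e)) :
    blDist pdata μ ^ 2 ≤ ENNReal.ofReal (24 * C + 4) * (ENNReal.ofReal (δ ^ 2) + e) := by
  have hnoise : 4 * (δ / √(d + secondMoment pdata)) ^ 2 * (d + secondMoment pdata) =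
      4 * δ ^ 2 := by
    rw [div_pow, Real.sq_sqrt (by linarith)]
    field_simp
  have hbl := blDist_sq_le pdata μ hm hσ
  rw [hnoise, ENNReal.ofReal_mul (by norm_num), ENNReal.ofReal_ofNat] at hbl
  calc blDist pdata μ ^ 2
      ≤ 4 * ENNReal.ofReal (δ ^ 2) + 24 * klDiv (forwardLaw pdata σ 1) μ := hbl
    _ ≤ 4 * (ENNReal.ofReal (δ ^ 2) + e) +
          24 * (ENNReal.ofReal C * (ENNReal.ofReal (δ ^ 2) + e)) := by
        gcongr
        exact le_self_add
    _ = ENNReal.ofReal (24 * C + 4) * (ENNReal.ofReal (δ ^ 2) + e) := by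
        rw [ENNReal.ofReal_add (by positivity) (by norm_num), ENNReal.ofReal_mul (by norm_num),
          ENNReal.ofReal_ofNat, ENNReal.ofReal_ofNat]
        ring

end DataDistribution

end

theorem corollary4 (B : ℝ) (hB : 0 < B) :
    ∃ C : ℝ, 0 < C ∧
      ∀ (d : ℕ), 1 ≤ d →
      ∀ (pdata : Measure (Euc d)) [IsProbabilityMeasure pdata],
      Integrable (fun x : Euc d => ‖x‖ ^ 2) pdata →
      ∀ (δ : ℝ), 0 < δ → δ ≤ 1 / 2 →
        -- sampling from the early stopped law `p_1`, for every early stopping noise level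
        (∀ σ₀ : ℝ, 0 < σ₀ → σ₀ < 1 →
          ∃ (T : ℕ) (σ : ℕ → ℝ), IsVPSchedule T σ σ₀ ∧
            (T : ℝ) ≤ C * (d + Real.log (1 / δ)) *
              Real.log (((d + secondMoment pdata) / σ₀ ^ 2) / δ) ^ 2 ∧
            ∀ s : ℕ → Euc d → Euc d, (∀ t, Measurable (s t)) →
              klDiv (forwardLaw pdata σ 1) (outputLaw B s σ T) ≤
                ENNReal.ofReal C * (ENNReal.ofReal (δ ^ 2) + totalScoreError pdata s σ T) ∧
              ENNReal.ofReal (1 - δ) ≤ queryLaw B s σ T {n | (n : ℝ) ≤ C * T} ∧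
              ∀ ε : ℝ, 0 < ε → ε < 1 →
                ENNReal.ofReal (1 - ε) ≤
                  queryLaw B s σ T {n | (n : ℝ) ≤ C * (T + Real.log (1 / ε))}) ∧
        -- sampling from `p_data`, with early stopping noise level `δ / √(d + M₂²)`
        (∃ (T : ℕ) (σ : ℕ → ℝ), IsVPSchedule T σ (δ / √(d + secondMoment pdata)) ∧
            (T : ℝ) ≤ C * max (d : ℝ) (Real.log (1 / δ)) *
              Real.log ((d + secondMoment pdata) / δ ^ 2) ^ 2 ∧
            ∀ s : ℕ → Euc d → Euc d, (∀ t, Measurable (s t)) →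
              blDist pdata (outputLaw B s σ T) ^ 2 ≤
                ENNReal.ofReal C * (ENNReal.ofReal (δ ^ 2) + totalScoreError pdata s σ T) ∧
              ENNReal.ofReal (1 - δ) ≤ queryLaw B s σ T {n | (n : ℝ) ≤ C * T} ∧
              ∀ ε : ℝ, 0 < ε → ε < 1 →
                ENNReal.ofReal (1 - ε) ≤
                  queryLaw B s σ T {n | (n : ℝ) ≤ C * (T + Real.log (1 / ε))}) := by
  obtain ⟨C, hkl, hlen, hquery⟩ :
      ∃ C, 24 * klConst B + 4 ≤ C ∧ 8 * lengthConst B ≤ C ∧ queryConst B ≤ C :=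
    ⟨max (24 * klConst B + 4) (max (8 * lengthConst B) (queryConst B)), le_max_left _ _,
      (le_max_left _ _).trans (le_max_right _ _), (le_max_right _ _).trans (le_max_right _ _)⟩
  have hK := klConst_pos hB
  have hΛ := lengthConst_pos hB
  refine ⟨C, by linarith, fun d hd pdata _ hm δ hδ hδ2 => ⟨fun σ₀ h0 h1 => ?_, ?_⟩⟩
  · obtain ⟨T, σ, hσ, hδT, hT, hdiv⟩ := exists_schedule_klDiv_le hB hd hm hδ hδ2 h0 h1
    have := half_le_log_one_div hδ hδ2
    exact ⟨T, σ, hσ, hT.trans (by rw [mul_assoc]; gcongr; linarith), fun s hs =>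
      ⟨(hdiv s hs).trans (by gcongr; linarith),
        le_queryLaw_and_forall_le_queryLaw hB hquery hs hδ hδT⟩⟩
  · have hA : 1 ≤ d + secondMoment pdata :=
      le_add_of_le_of_nonneg (Nat.one_le_cast.2 hd) (secondMoment_nonneg pdata)
    obtain ⟨T, σ, hσ, hδT, hT, hdiv⟩ := exists_schedule_klDiv_le hB hd hm hδ hδ2
      (div_pos hδ (by positivity)) (div_sqrt_lt_one hA (by linarith))
    have hTmax := hT.trans (mul_add_mul_sq_log_le hA hδ (by linarith) d.cast_nonneg hΛ.le hlen)
    refine ⟨T, σ, hσ, hTmax, fun s hs =>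
      ⟨?_, le_queryLaw_and_forall_le_queryLaw hB hquery hs hδ hδT⟩⟩
    have := isProbabilityMeasure_outputLaw (B := B) (σ := σ) (T := T) hs
    exact (blDist_sq_le_of_klDiv_le hm hσ hA hK.le (hdiv s hs)).trans (by gcongr)
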